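/- Let $k$ be a perfect field and let $\mathrm{Sm}_k$ be the category of smooth quasi-compact quasi-separated $k$-schemes. Presheaves, maps and colimits below are taken in the homotopical ($\infty$-categorical) sense, with values in spaces. For a presheaf of spaces $F$ on $\mathrm{Sm}_k$ put $$(\hat C_1F)(Y)=\operatorname{colim}_{Y\times\{0,1\}\subset U\subset Y\times\mathbb A^1}F(U),$$ the colimit being over the open subschemes $U$ of $Y\times\mathbb A^1$ that contain $Y\times\{0,1\}$, and let $i_0^*,i_1^*:\hat C_1F\to F$ be the pullbacks to $Y\times\{0\}$ and $Y\times\{1\}$. Call $F$ *rationally contractible* if there is a map $s:F\to\hat C_1F$ of presheaves of spaces such that $i_0^*s\simeq\mathrm{id}_F$ and $i_1^*s$ is constant, i.e. factors, up to homotopy, through the terminal presheaf. For $X,Y\in\mathrm{Sm}_k$ let $h^{\mathrm{flf}}(X_+)(Y)$ be the groupoid of spans of $k$-schemes $Y\xleftarrow{p}Z\xrightarrow{q}X$ with $p$ finite locally free, and of isomorphisms of such spans; this is the mapping space from $Y$ to $X$ in the category $\mathrm{Cor}^{\mathrm{flf}}(k)$ of finite locally free correspondences. Via disjoint union of spans,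 $h^{\mathrm{flf}}(X_+)$ is a presheaf of $E_\infty$-monoids on $\mathrm{Sm}_k$, contravariant in $Y$ by base change. The functor $X_+\mapsto h^{\mathrm{flf}}(X_+)$ is functorial for pointed maps and is extended, commuting with geometric realizations, to pointed presheaves that are realizations of simplicial diagrams of smooth schemes with a disjoint base point; so $h^{\mathrm{flf}}(X,x_0)$ is the quotient of $h^{\mathrm{flf}}(X_+)$ by $h^{\mathrm{flf}}((x_0)_+)$ in presheaves of $E_\infty$-monoids. Let $\mathbb G_m=\mathbb A^1\setminus 0$ be pointed at $1$, let $\mathbb G_m^{\wedge n}$ be its $n$-fold smash power, and let $(-)^{\mathrm{gp}}$ denote the (sectionwise) group completion of $E_\infty$-monoids. Then $\mathrm{Cor}^{\mathrm{flf}}(k)$ satisfies rational contractibility: for every integer $n>0$ the presheaf of spaces $h^{\mathrm{flf}}(\mathbb G_m^{\wedge n})^{\mathrm{gp}}$ on $\mathrm{Sm}_k$ is rationally contractible. -/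

import Mathlib

open CategoryTheory Limits Opposite Simplicial MonoidalCategory AlgebraicGeometry

universe w u

noncomputable section

set_option linter.unusedSectionVars false
set_option linter.unusedVariables false

namespace SSet

/-- Weak homotopy equivalences of simplicial sets: the maps `f : X ⟶ Y` such that precomposition
with `f` is a bijection `[Y, K] → [X, K]` on homotopy classes of maps, for every Kan complex `K`. -/
def weakEq : MorphismProperty SSet.{w} := fun X Y f =>
  ∀ K : SSet.{w}, K.KanComplex →
    (∀ g : X ⟶ K, ∃ h : Y ⟶ K, Nonempty (Homotopy (f ≫ h) g)) ∧
    (∀ h h' : Y ⟶ K, Nonempty (Homotopy (f ≫ h) (f ≫ h')) → Nonempty (Homotopy h h'))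

/-- The last vertex of a nonempty chain in `{0, …, n}`. -/
def lastVertex (n : SimplexCategory) :
    PartialOrder.NonemptyFiniteChains (ULift.{w} (Fin (n.len + 1))) →o Fin (n.len + 1) where
  toFun s := (s.finset.max' s.nonempty).down
  monotone' _ _ h := Finset.max'_subset _ h

lemma lastVertex_map {n m : SimplexCategory} (f : n ⟶ m)
    (s : PartialOrder.NonemptyFiniteChains (ULift.{w} (Fin (n.len + 1)))) :
    lastVertex m (s.map (SimplexCategory.toPartOrd.{w}.map f).hom) =
      f (lastVertex n s) := by
  apply ULift.up_injective
  apply le_antisymm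
  · refine Finset.max'_le _ (s.map _).nonempty _ fun y hy => ?_
    obtain ⟨x, hx, rfl⟩ := (PartialOrder.NonemptyFiniteChains.mem_map_iff _ _ _).1 hy
    exact (SimplexCategory.toPartOrd.{w}.map f).hom.monotone (Finset.le_max' _ _ hx)
  · apply Finset.le_max'
    exact (PartialOrder.NonemptyFiniteChains.mem_map_iff _ _ _).2
      ⟨_, Finset.max'_mem _ s.nonempty, rfl⟩

/-- The last vertex map `sd Δ[n] ⟶ Δ[n]`. -/
def lastVertexMap : SimplexCategory.sd.{w} ⟶ stdSimplex.{w} where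
  app n :=
    { app m := ↾fun (s : ComposableArrows (PartialOrder.NonemptyFiniteChains
          (ULift.{w} (Fin (n.len + 1)))) m.unop.len) =>
        stdSimplex.objEquiv.symm (SimplexCategory.mkHom
          { toFun i := lastVertex n (s.obj i)
            monotone' i j h := (lastVertex n).monotone (s.map h.hom).le })
      naturality _ _ _ := rfl }
  naturality n m f := by
    ext k (s : ComposableArrows (PartialOrder.NonemptyFiniteChains
          (ULift.{w} (Fin (n.len + 1)))) k.unop.len)
    apply stdSimplex.objEquiv.injective
    ext i
    exact congrArg Fin.val (lastVertex_map f (s.obj i))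

/-- The natural map `X ⟶ Ex X` given by the last vertex maps. -/
def toEx : 𝟭 SSet.{w} ⟶ ex where
  app X :=
    { app n := ↾fun x => ULift.up (lastVertexMap.app n.unop ≫ yonedaEquiv.symm x)
      naturality n m f := by
        ext x
        apply ULift.ext
        change lastVertexMap.app m.unop ≫ yonedaEquiv.symm (X.map f x) =
          SimplexCategory.sd.map f.unop ≫ lastVertexMap.app n.unop ≫ yonedaEquiv.symm x
        rw [lastVertexMap.naturality_assoc]
        congr 1
        exact (yonedaEquiv_symm_naturality_left (X := X) f.unop x).symm }
  naturality X Y f := by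
    ext n x
    apply ULift.ext
    change lastVertexMap.app n.unop ≫ yonedaEquiv.symm (f.app n x) =
      (lastVertexMap.app n.unop ≫ yonedaEquiv.symm x) ≫ f
    rw [Category.assoc]
    exact congrArg (lastVertexMap.app n.unop ≫ ·) (yonedaEquiv_symm_comp x f).symm

/-- The iterates of Kan's functor `Ex`. -/
def exIter (i : ℕ) : SSet.{w} ⥤ SSet.{w} :=
  Nat.rec (𝟭 _) (fun _ F => F ⋙ ex) i

/-- Kan's fibrant replacement functor `Ex^∞`, the colimit of `X ⟶ Ex X ⟶ Ex² X ⟶ ⋯`. -/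
def exInf : SSet.{w} ⥤ SSet.{w} :=
  colimit (Functor.ofSequence (X := exIter.{w}) fun i => (exIter i).whiskerLeft toEx)

/-- The natural map `X ⟶ Ex^∞ X`. -/
def toExInf : 𝟭 SSet.{w} ⟶ exInf :=
  colimit.ι (Functor.ofSequence (X := exIter.{w}) fun i => (exIter i).whiskerLeft toEx) 0

end SSet

/-- Pointed simplicial sets. -/
abbrev PSSet := SimplicialObject Pointed.{w}

namespace PSSet

/-- The underlying simplicial set. -/
def forget : PSSet.{w} ⥤ SSet.{w} :=
  (SimplicialObject.whiskering _ _).obj (CategoryTheory.forget Pointed)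

/-- The constant map to the base point. -/
def basept (X : PSSet.{w}) (T : SSet.{w}) : T ⟶ forget.obj X where
  app m := ↾fun _ => (X.obj m).point
  naturality m m' f := by
    ext x
    exact (X.map f).map_point.symm

/-- The constant map to the base point of `Ex^∞ X`. -/
def exBasept (X : PSSet.{w}) (T : SSet.{w}) : T ⟶ SSet.exInf.obj (forget.obj X) :=
  basept X T ≫ SSet.toExInf.app (forget.obj X)

lemma comp_exBasept (X : PSSet.{w}) {T T' : SSet.{w}} (f : T ⟶ T') :
    f ≫ exBasept X T' = exBasept X T := rfl

lemma exBasept_comp {X Y : PSSet.{w}} (f : X ⟶ Y) (T : SSet.{w}) :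
    exBasept X T ≫ SSet.exInf.map (forget.map f) = exBasept Y T := by
  have h : basept X T ≫ forget.map f = basept Y T := by
    ext m x
    exact (f.app m).map_point
  have h' : SSet.toExInf.app (forget.obj X) ≫ SSet.exInf.map (forget.map f) =
      forget.map f ≫ SSet.toExInf.app (forget.obj Y) :=
    (SSet.toExInf.naturality (forget.map f)).symm
  calc _ = basept X T ≫ (SSet.toExInf.app (forget.obj X) ≫ SSet.exInf.map (forget.map f)) :=
        Category.assoc _ _ _
    _ = basept X T ≫ (forget.map f ≫ SSet.toExInf.app (forget.obj Y)) := by rw [h']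
    _ = (basept X T ≫ forget.map f) ≫ SSet.toExInf.app (forget.obj Y) :=
        (Category.assoc _ _ _).symm
    _ = _ := by rw [h]; rfl

/-- A homotopy `T ⊗ Δ[1] ⟶ Ex^∞ X` that is constant at the base point on both ends. -/
def IsLoop (X : PSSet.{w}) {T : SSet.{w}} (γ : T ⊗ Δ[1] ⟶ SSet.exInf.obj (forget.obj X)) :
    Prop :=
  SSet.ι₀ ≫ γ = exBasept X T ∧ SSet.ι₁ ≫ γ = exBasept X T

lemma IsLoop.precomp {X : PSSet.{w}} {T T' : SSet.{w}}
    {γ : T ⊗ Δ[1] ⟶ SSet.exInf.obj (forget.obj X)} (h : X.IsLoop γ) (f : T' ⟶ T) :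
    X.IsLoop (f ▷ Δ[1] ≫ γ) := by
  constructor
  · rw [SSet.ι₀_comp_assoc, h.1, comp_exBasept]
  · rw [SSet.ι₁_comp_assoc, h.2, comp_exBasept]

lemma IsLoop.postcomp {X Y : PSSet.{w}} {T : SSet.{w}}
    {γ : T ⊗ Δ[1] ⟶ SSet.exInf.obj (forget.obj X)} (h : X.IsLoop γ) (f : X ⟶ Y) :
    Y.IsLoop (γ ≫ SSet.exInf.map (forget.map f)) := by
  constructor
  · rw [← Category.assoc, h.1, exBasept_comp]
  · rw [← Category.assoc, h.2, exBasept_comp]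

/-- The (derived) loop space `Ω X`: the loops in the Kan complex `Ex^∞ X`. -/
def loopSpace : PSSet.{w} ⥤ SSet.{w} where
  obj X :=
    { obj m := { γ : SSet.stdSimplex.obj m.unop ⊗ Δ[1] ⟶ SSet.exInf.obj (forget.obj X) //
        X.IsLoop γ }
      map f := ↾fun γ => ⟨SSet.stdSimplex.map f.unop ▷ Δ[1] ≫ γ.1, γ.2.precomp _⟩
      map_id m := ConcreteCategory.hom_ext _ _ fun γ => Subtype.ext (by
        have h : SSet.stdSimplex.{w}.map (𝟙 m.unop) = 𝟙 _ := CategoryTheory.Functor.map_id _ _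
        change SSet.stdSimplex.map (𝟙 m.unop) ▷ Δ[1] ≫ γ.1 = γ.1
        rw [h, id_whiskerRight, Category.id_comp])
      map_comp f g := ConcreteCategory.hom_ext _ _ fun γ => Subtype.ext (by
        have h : SSet.stdSimplex.{w}.map (g.unop ≫ f.unop) =
          SSet.stdSimplex.map g.unop ≫ SSet.stdSimplex.map f.unop :=
            CategoryTheory.Functor.map_comp _ _ _
        change SSet.stdSimplex.map (g.unop ≫ f.unop) ▷ Δ[1] ≫ γ.1 =
          SSet.stdSimplex.map g.unop ▷ Δ[1] ≫ SSet.stdSimplex.map f.unop ▷ Δ[1] ≫ γ.1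
        rw [h, comp_whiskerRight, Category.assoc]) }
  map {X Y} f :=
    { app m := ↾fun γ => ⟨γ.1 ≫ SSet.exInf.map (forget.map f), γ.2.postcomp f⟩
      naturality m m' g := by refine ConcreteCategory.hom_ext _ _ fun γ => Subtype.ext ?_; simp }
  map_id X := by
    apply NatTrans.ext
    funext m
    refine ConcreteCategory.hom_ext _ _ fun γ => Subtype.ext ?_
    simp
  map_comp f g := by
    apply NatTrans.ext
    funext m
    refine ConcreteCategory.hom_ext _ _ fun γ => Subtype.ext ?_
    simp

/-- The diagonal of a simplicial pointed simplicial set, a model of its homotopy colimit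
(geometric realization). -/
def diag : SimplicialObject PSSet.{w} ⥤ PSSet.{w} where
  obj X :=
    { obj m := (X.obj m).obj m
      map {m m'} f := (X.map f).app m ≫ (X.obj m').map f
      map_id m := by simp
      map_comp f g := by simp }
  map φ := { app m := (φ.app m).app m
             naturality m m' f := by
               have := congr_app (φ.naturality f) m
               simp only [NatTrans.comp_app] at this
               simp only [Category.assoc, (φ.app m').naturality]
               rw [reassoc_of% this] }
  map_id X := rfl
  map_comp f g := rfl
end PSSet

namespace FlfCor

lemma smooth_affineLine (S : Scheme.{u}) : Smooth (𝔸(PUnit.{u + 1}; S) ↘ S) := by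
  have := isIso_of_isTerminal specULiftZIsTerminal.{u} terminalIsTerminal (terminal.from _)
  have h : Smooth (terminal.from
      (Spec (CommRingCat.of (MvPolynomial PUnit.{u + 1} (ULift.{u} ℤ))))) := by
    rw [← terminal.comp_from (Spec.map (CommRingCat.ofHom MvPolynomial.C))]
    have : Smooth (Spec.map (CommRingCat.ofHom
        (MvPolynomial.C : ULift.{u} ℤ →+* MvPolynomial PUnit.{u + 1} (ULift.{u} ℤ)))) := by
      rw [HasRingHomProperty.Spec_iff (P := @Smooth)]
      exact RingHom.smooth_algebraMap.2 ⟨inferInstance, inferInstance⟩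
    infer_instance
  exact inferInstanceAs (Smooth (pullback.fst (terminal.from S) (terminal.from
      (Spec (CommRingCat.of (MvPolynomial PUnit.{u + 1} (ULift.{u} ℤ)))))))

variable (k : Type u) [Field k]

/-- The spectrum of `k`. -/
abbrev SpecK : Scheme.{u} := Spec (CommRingCat.of k)

/-- Smooth, quasi-compact and quasi-separated `k`-schemes. -/
def isSm : ObjectProperty (Over (SpecK k)) := fun X =>
  Smooth X.hom ∧ QuasiCompact X.hom ∧ QuasiSeparated X.hom

/-- The category of smooth quasi-compact quasi-separated `k`-schemes. -/
abbrev Sm := (isSm k).FullSubcategory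

/-- The inclusion of smooth `k`-schemes into all `k`-schemes. -/
abbrev Sm.toOver : Sm k ⥤ Over (SpecK k) := (isSm k).ι

variable {k}
namespace Sm
/-- The affine line `Y × 𝔸¹` over `Y`. -/
abbrev A1 (Y : Sm k) : Scheme.{u} := 𝔸(PUnit.{u+1}; Y.obj.left)

/-- The projection `Y × 𝔸¹ ⟶ Y`. -/
abbrev A1.proj (Y : Sm k) : Y.A1 ⟶ Y.obj.left := Y.A1 ↘ Y.obj.left

/-- The zero section of `Y × 𝔸¹`. -/
def zero (Y : Sm k) : Y.obj.left ⟶ Y.A1 := AffineSpace.homOfVector (𝟙 _) 0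

/-- The unit section of `Y × 𝔸¹`. -/
def one (Y : Sm k) : Y.obj.left ⟶ Y.A1 := AffineSpace.homOfVector (𝟙 _) 1

/-- The map `Y' × 𝔸¹ ⟶ Y × 𝔸¹` induced by `g : Y' ⟶ Y`. -/
def A1map {Y' Y : Sm k} (g : Y' ⟶ Y) : Y'.A1 ⟶ Y.A1 := AffineSpace.map _ g.hom.left

lemma A1map_proj {Y' Y : Sm k} (g : Y' ⟶ Y) :
    A1map g ≫ A1.proj Y = A1.proj Y' ≫ g.hom.left :=
  AffineSpace.map_over _

lemma zero_A1map {Y' Y : Sm k} (g : Y' ⟶ Y) : Y'.zero ≫ A1map g = g.hom.left ≫ Y.zero := by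
  apply AffineSpace.hom_ext
  · simp [zero, A1map]
  · intro i
    simp only [zero, A1map, Scheme.Hom.comp_appTop, CommRingCat.comp_apply,
      AffineSpace.map_appTop_coord, AffineSpace.homOfVector_appTop_coord]
    simp

lemma one_A1map {Y' Y : Sm k} (g : Y' ⟶ Y) : Y'.one ≫ A1map g = g.hom.left ≫ Y.one := by
  apply AffineSpace.hom_ext
  · simp [one, A1map]
  · intro i
    simp only [one, A1map, Scheme.Hom.comp_appTop, CommRingCat.comp_apply,
      AffineSpace.map_appTop_coord, AffineSpace.homOfVector_appTop_coord]
    simp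

/-- The open subschemes `U` with `Y × {0, 1} ⊆ U ⊆ Y × 𝔸¹`, ordered by inclusion. -/
@[ext]
structure Nbhd (Y : Sm k) where
  U : Y.A1.Opens
  zero_mem : ∀ y, Y.zero y ∈ U
  one_mem : ∀ y, Y.one y ∈ U

instance (Y : Sm k) : PartialOrder (Nbhd Y) := PartialOrder.lift Nbhd.U (fun _ _ h => Nbhd.ext h)

lemma isSm_open (Y : Sm k) (U : Y.A1.Opens) : isSm k (Over.mk (U.ι ≫ A1.proj Y ≫ Y.obj.hom)) := by
  obtain ⟨_, _, _⟩ := Y.property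
  have := smooth_affineLine Y.obj.left
  have : IsLocallyNoetherian Y.A1 :=
    LocallyOfFiniteType.isLocallyNoetherian (A1.proj Y ≫ Y.obj.hom)
  have h1 : Smooth (U.ι ≫ A1.proj Y ≫ Y.obj.hom) := inferInstance
  have h2 : QuasiCompact (U.ι ≫ A1.proj Y ≫ Y.obj.hom) := inferInstance
  have h3 : QuasiSeparated (U.ι ≫ A1.proj Y ≫ Y.obj.hom) := inferInstance
  exact ⟨h1, h2, h3⟩

namespace Nbhd

/-- The open subscheme `U` as a smooth `k`-scheme. -/
def toSm {Y : Sm k} (U : Nbhd Y) : Sm k :=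
  ⟨Over.mk (U.U.ι ≫ A1.proj Y ≫ Y.obj.hom), Y.isSm_open U.U⟩

/-- The inclusion `U ⟶ Y × 𝔸¹`. -/
def ι {Y : Sm k} (U : Nbhd Y) : U.toSm.obj.left ⟶ Y.A1 := U.U.ι

instance {Y : Sm k} (U : Nbhd Y) : IsOpenImmersion U.ι := inferInstanceAs (IsOpenImmersion U.U.ι)

lemma ι_mem {Y : Sm k} (U : Nbhd Y) (x : U.toSm.obj.left) : U.ι x ∈ U.U := x.2

/-- Maps into `U` are maps into `Y × 𝔸¹` with image in `U`. -/
def lift {Y T : Sm k} (U : Nbhd Y) (f : T.obj.left ⟶ Y.A1)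
    (hf : f ≫ A1.proj Y ≫ Y.obj.hom = T.obj.hom) (h : ∀ t, f t ∈ U.U) : T ⟶ U.toSm :=
  ObjectProperty.homMk (Over.homMk (U := T.obj) (V := U.toSm.obj)
    (IsOpenImmersion.lift U.ι f (by
      rintro _ ⟨t, rfl⟩
      exact ⟨⟨_, h t⟩, rfl⟩))
    ((IsOpenImmersion.lift_fac_assoc U.ι f _ _).trans hf))

@[simp]
lemma lift_ι {Y T : Sm k} (U : Nbhd Y) (f : T.obj.left ⟶ Y.A1)
    (hf : f ≫ A1.proj Y ≫ Y.obj.hom = T.obj.hom) (h : ∀ t, f t ∈ U.U) :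
    (U.lift f hf h).hom.left ≫ U.ι = f :=
  IsOpenImmersion.lift_fac U.ι f _

@[simp]
lemma lift_ι_assoc {Y T : Sm k} (U : Nbhd Y) (f : T.obj.left ⟶ Y.A1)
    (hf : f ≫ A1.proj Y ≫ Y.obj.hom = T.obj.hom) (h : ∀ t, f t ∈ U.U) {X : Scheme.{u}}
    (g : Y.A1 ⟶ X) : (U.lift f hf h).hom.left ≫ U.ι ≫ g = f ≫ g := by
  rw [← Category.assoc, lift_ι]

lemma hom_ext {Y T : Sm k} {U : Nbhd Y} {a b : T ⟶ U.toSm}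
    (h : a.hom.left ≫ U.ι = b.hom.left ≫ U.ι) : a = b := by
  ext : 2
  exact (cancel_mono U.ι).1 h

lemma comp_ι {Y T T' : Sm k} {U : Nbhd Y} (a : T' ⟶ T) (b : T ⟶ U.toSm) (c : T.obj.left ⟶ Y.A1)
    (h : b.hom.left ≫ U.ι = c) : (a ≫ b).hom.left ≫ U.ι = a.hom.left ≫ c := by
  subst h
  exact Category.assoc _ _ _

lemma ι_proj {Y : Sm k} (U : Nbhd Y) : U.ι ≫ A1.proj Y ≫ Y.obj.hom = U.toSm.obj.hom := rfl

/-- The inclusion `V ⟶ U`. -/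
def incl {Y : Sm k} {V U : Nbhd Y} (h : V ≤ U) : V.toSm ⟶ U.toSm :=
  U.lift V.ι V.ι_proj fun t => h (V.ι_mem t)

@[simp]
lemma incl_ι {Y : Sm k} {V U : Nbhd Y} (h : V ≤ U) : (incl h).hom.left ≫ U.ι = V.ι :=
  U.lift_ι _ _ _

/-- The functor sending `U` to the smooth `k`-scheme `U`. -/
def toSmFunctor (Y : Sm k) : Nbhd Y ⥤ Sm k where
  obj U := U.toSm
  map {U V} h := incl h.le
  map_id U := hom_ext (by simp [incl])
  map_comp f g := hom_ext (by simp [incl])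

/-- The section `Y = Y × {0} ⟶ U`. -/
def zeroLift {Y : Sm k} (U : Nbhd Y) : Y ⟶ U.toSm :=
  U.lift Y.zero (by simp [zero]) U.zero_mem

/-- The section `Y = Y × {1} ⟶ U`. -/
def oneLift {Y : Sm k} (U : Nbhd Y) : Y ⟶ U.toSm :=
  U.lift Y.one (by simp [one]) U.one_mem

@[simp]
lemma zeroLift_ι {Y : Sm k} (U : Nbhd Y) : U.zeroLift.hom.left ≫ U.ι = Y.zero := U.lift_ι _ _ _

@[simp]
lemma oneLift_ι {Y : Sm k} (U : Nbhd Y) : U.oneLift.hom.left ≫ U.ι = Y.one := U.lift_ι _ _ _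

/-- The preimage of `U ⊆ Y × 𝔸¹` in `Y' × 𝔸¹`. -/
def preimage {Y' Y : Sm k} (g : Y' ⟶ Y) (U : Nbhd Y) : Nbhd Y' where
  U := A1map g ⁻¹ᵁ U.U
  zero_mem y := by
    change A1map g (Y'.zero y) ∈ U.U
    rw [← Scheme.Hom.comp_apply, zero_A1map, Scheme.Hom.comp_apply]
    exact U.zero_mem _
  one_mem y := by
    change A1map g (Y'.one y) ∈ U.U
    rw [← Scheme.Hom.comp_apply, one_A1map, Scheme.Hom.comp_apply]
    exact U.one_mem _

lemma preimage_mono {Y' Y : Sm k} (g : Y' ⟶ Y) {U V : Nbhd Y} (h : U ≤ V) :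
    U.preimage g ≤ V.preimage g :=
  fun _ hx => h hx

/-- The projection from the preimage of `U` to `U`. -/
def preimageHom {Y' Y : Sm k} (g : Y' ⟶ Y) (U : Nbhd Y) : (U.preimage g).toSm ⟶ U.toSm :=
  U.lift ((U.preimage g).ι ≫ A1map g) (by
      have h := Over.w g.hom
      rw [Category.assoc, reassoc_of% (A1map_proj g), h]
      rfl) fun t => (U.preimage g).ι_mem t

@[simp]
lemma preimageHom_ι {Y' Y : Sm k} (g : Y' ⟶ Y) (U : Nbhd Y) :
    (U.preimageHom g).hom.left ≫ U.ι = (U.preimage g).ι ≫ A1map g := U.lift_ι _ _ _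

end Nbhd


/-- The structure map `F(U) ⟶ colim_U F(U)`. -/
def C1ι (F : (Sm k)ᵒᵖ ⥤ SSet.{u + 1}) {Y : Sm k} (U : Nbhd Y) :
    F.obj (op U.toSm) ⟶ colimit ((Nbhd.toSmFunctor Y).op ⋙ F) :=
  colimit.ι ((Nbhd.toSmFunctor Y).op ⋙ F) (op U)

lemma map_C1ι (F : (Sm k)ᵒᵖ ⥤ SSet.{u + 1}) {Y W : Sm k} {U V : Nbhd Y} (h : V ≤ U)
    (a : U.toSm ⟶ W) (b : V.toSm ⟶ W) (hab : Nbhd.incl h ≫ a = b) :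
    F.map a.op ≫ C1ι F U = F.map b.op ≫ C1ι F V := by
  have := colimit.w ((Nbhd.toSmFunctor Y).op ⋙ F) (homOfLE h).op
  subst hab
  rw [op_comp, F.map_comp, Category.assoc]
  exact congrArg (F.map a.op ≫ ·) this.symm

lemma C1_hom_ext (F : (Sm k)ᵒᵖ ⥤ SSet.{u + 1}) {Y : Sm k} {X : SSet.{u + 1}}
    {a b : colimit ((Nbhd.toSmFunctor Y).op ⋙ F) ⟶ X}
    (h : ∀ U : Nbhd Y, C1ι F U ≫ a = C1ι F U ≫ b) : a = b :=
  colimit.hom_ext fun U => h U.unop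

/-- Maps out of `colim_U F(U)`. -/
def C1desc (F : (Sm k)ᵒᵖ ⥤ SSet.{u + 1}) {Y : Sm k} {X : SSet.{u + 1}}
    (a : ∀ U : Nbhd Y, F.obj (op U.toSm) ⟶ X)
    (ha : ∀ {U V : Nbhd Y} (h : V ≤ U),
      F.map (Nbhd.incl h).op ≫ a V = a U) :
    colimit ((Nbhd.toSmFunctor Y).op ⋙ F) ⟶ X :=
  colimit.desc ((Nbhd.toSmFunctor Y).op ⋙ F)
    { pt := X
      ι := { app U := a U.unop
             naturality U V f := (ha f.unop.le).trans (Category.comp_id _).symm } }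

lemma C1ι_desc (F : (Sm k)ᵒᵖ ⥤ SSet.{u + 1}) {Y : Sm k} {X : SSet.{u + 1}}
    (a : ∀ U : Nbhd Y, F.obj (op U.toSm) ⟶ X) (ha) (U : Nbhd Y) :
    C1ι F U ≫ C1desc F a ha = a U :=
  colimit.ι_desc _ _

lemma C1ι_desc_assoc (F : (Sm k)ᵒᵖ ⥤ SSet.{u + 1}) {Y : Sm k} {X : SSet.{u + 1}}
    (a : ∀ U : Nbhd Y, F.obj (op U.toSm) ⟶ X) (ha) (U : Nbhd Y) {X' : SSet.{u + 1}} (b : X ⟶ X') :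
    C1ι F U ≫ C1desc F a ha ≫ b = a U ≫ b := by
  rw [← Category.assoc, C1ι_desc]

/-- The presheaf `Ĉ₁ F` with `(Ĉ₁ F)(Y) = colim_U F(U)`, the filtered colimit over the open
subschemes `Y × {0, 1} ⊆ U ⊆ Y × 𝔸¹`. As filtered colimits of simplicial sets are homotopy
colimits, this is also the colimit of spaces. -/
def C1 (F : (Sm k)ᵒᵖ ⥤ SSet.{u + 1}) : (Sm k)ᵒᵖ ⥤ SSet.{u + 1} where
  obj Y := colimit ((Nbhd.toSmFunctor Y.unop).op ⋙ F)
  map {Y Y'} g := C1desc F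
    (fun U => F.map (Nbhd.preimageHom g.unop U).op ≫ C1ι F (U.preimage g.unop)) (by
      intro U V h
      rw [← Category.assoc, ← F.map_comp, ← op_comp]
      refine (map_C1ι F (Nbhd.preimage_mono g.unop h) _ _ ?_).symm
      apply Nbhd.hom_ext
      rw [Nbhd.comp_ι _ _ _ (Nbhd.preimageHom_ι _ _), Nbhd.comp_ι _ _ _ (Nbhd.incl_ι _),
        ← Category.assoc, Nbhd.incl_ι, Nbhd.preimageHom_ι])
  map_id Y := C1_hom_ext F fun U => by
    rw [C1ι_desc, Category.comp_id]
    have h : Nbhd.preimage (𝟙 Y.unop) U = U := by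
      ext1
      simp [Nbhd.preimage, A1map]
    have := map_C1ι F h.le (𝟙 U.toSm) (Nbhd.preimageHom (𝟙 Y.unop) U)
      (Nbhd.hom_ext (by simp [Nbhd.incl, Nbhd.preimageHom, A1map]))
    rw [op_id, F.map_id, Category.id_comp] at this
    exact this.symm
  map_comp f g := C1_hom_ext F fun U => by
    rw [C1ι_desc, C1ι_desc_assoc, Category.assoc, C1ι_desc, ← Category.assoc, ← F.map_comp,
      ← op_comp]
    refine (map_C1ι F (le_of_eq ?_) _ _ (Nbhd.hom_ext ?_)).symm
    · ext1
      simp [Nbhd.preimage, A1map]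
    · simp [Nbhd.incl, Nbhd.preimageHom, A1map]

/-- The restriction `i₀^* : Ĉ₁ F ⟶ F` to `Y × {0}`. -/
def evalZero (F : (Sm k)ᵒᵖ ⥤ SSet.{u + 1}) : C1 F ⟶ F where
  app Y := C1desc F (fun U => F.map U.zeroLift.op) (by
    intro U V h
    rw [← F.map_comp, ← op_comp]
    congr 2
    exact Nbhd.hom_ext (by simp [Nbhd.incl, Nbhd.zeroLift]))
  naturality Y Y' g := C1_hom_ext F fun U => by
    simp only [C1]
    rw [C1ι_desc_assoc, Category.assoc, C1ι_desc, C1ι_desc_assoc, ← F.map_comp, ← F.map_comp]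
    congr 1
    apply Quiver.Hom.unop_inj
    apply Nbhd.hom_ext
    change (Nbhd.zeroLift _ ≫ Nbhd.preimageHom _ _).hom.left ≫ _ =
      (g.unop ≫ U.zeroLift).hom.left ≫ _
    rw [Nbhd.comp_ι _ _ _ (Nbhd.preimageHom_ι _ _), Nbhd.comp_ι _ _ _ (Nbhd.zeroLift_ι _),
      ← zero_A1map, ← Category.assoc, Nbhd.zeroLift_ι]

/-- The restriction `i₁^* : Ĉ₁ F ⟶ F` to `Y × {1}`. -/
def evalOne (F : (Sm k)ᵒᵖ ⥤ SSet.{u + 1}) : C1 F ⟶ F where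
  app Y := C1desc F (fun U => F.map U.oneLift.op) (by
    intro U V h
    rw [← F.map_comp, ← op_comp]
    congr 2
    exact Nbhd.hom_ext (by simp [Nbhd.incl, Nbhd.oneLift]))
  naturality Y Y' g := C1_hom_ext F fun U => by
    simp only [C1]
    rw [C1ι_desc_assoc, Category.assoc, C1ι_desc, C1ι_desc_assoc, ← F.map_comp, ← F.map_comp]
    congr 1
    apply Quiver.Hom.unop_inj
    apply Nbhd.hom_ext
    change (Nbhd.oneLift _ ≫ Nbhd.preimageHom _ _).hom.left ≫ _ =
      (g.unop ≫ U.oneLift).hom.left ≫ _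
    rw [Nbhd.comp_ι _ _ _ (Nbhd.preimageHom_ι _ _), Nbhd.comp_ι _ _ _ (Nbhd.oneLift_ι _),
      ← one_A1map, ← Category.assoc, Nbhd.oneLift_ι]

end Sm

variable (k)
/-- A pointed `k`-scheme `P = P° ⊔ Spec k` whose base point is open and closed, that is,
a `k`-scheme `P°` with a disjoint base point added. -/
structure PtdSch where
  X : Over (SpecK k)
  pt : Over.mk (𝟙 (SpecK k)) ⟶ X
  isOpenImmersion : IsOpenImmersion pt.left
  isClosed : IsClosed (Set.range pt.left)

variable {k}

namespace PtdSch

/-- Base point preserving morphisms of `k`-schemes. -/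
@[ext]
structure Hom (P Q : PtdSch k) where
  hom : P.X ⟶ Q.X
  w : P.pt ≫ hom = Q.pt

instance : Category (PtdSch k) where
  Hom := Hom
  id P := ⟨𝟙 _, Category.comp_id _⟩
  comp f g := ⟨f.hom ≫ g.hom, by rw [← Category.assoc, f.w, g.w]⟩
  id_comp _ := Hom.ext (Category.id_comp _)
  comp_id _ := Hom.ext (Category.comp_id _)
  assoc _ _ _ := Hom.ext (Category.assoc _ _ _)

@[simp] lemma id_hom (P : PtdSch k) : Hom.hom (𝟙 P) = 𝟙 P.X := rfl
@[simp] lemma comp_hom {P Q R : PtdSch k} (f : P ⟶ Q) (g : Q ⟶ R) :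
    (f ≫ g).hom = f.hom ≫ g.hom := rfl

@[ext] lemma hom_ext {P Q : PtdSch k} {f g : P ⟶ Q} (h : f.hom = g.hom) : f = g := Hom.ext h

/-- The complement `P°` of the base point. -/
def away (P : PtdSch k) : P.X.left.Opens := ⟨(Set.range P.pt.left)ᶜ, P.isClosed.isOpen_compl⟩

lemma mem_away_of_map {P Q : PtdSch k} (f : P ⟶ Q) {x : P.X.left} (h : f.hom.left x ∈ Q.away) :
    x ∈ P.away := by
  rintro ⟨y, rfl⟩
  refine h ⟨y, ?_⟩
  rw [← f.w, Over.comp_left, Scheme.Hom.comp_apply]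

end PtdSch

/-- Spans `Y ⟵ Z ⟶ ⋀ᵢ Pᵢ` with finite locally free left leg, together with chosen base changes.

For `D = (Sm k)/Y` and `j` the functor `T ↦ T` (see `FlfSpan.base`), the datum `(Z, p)` is a
`k`-scheme `Z_T` with a finite locally free (finite, flat and locally of finite presentation) map
`p_T : Z_T ⟶ T` for every smooth `T ⟶ Y`, functorial and cartesian in `T`. So `Z_T = Z_Y ×_Y T`, and
`(Z, p)` is the finite locally free `Y`-scheme `Z_Y` with a functorial choice of its base changes.
Likewise the maps `q i` amount to maps `Z_Y ⟶ P i`. The choices make base change strictly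
functorial and do not change the groupoid of spans up to equivalence.

The tuple `q` stands for the map of `Z_Y` to the smash product of the pointed schemes `P i`; what
lies over the base point of the smash product is disregarded, see `FlfSpan.support` and
`FlfSpan.Hom`. -/
structure FlfSpan {D : Type (u + 1)} [Category.{u} D] (j : D ⥤ Over (SpecK k)) {ι : Type}
    (P : ι → PtdSch k) where
  Z : D ⥤ Over (SpecK k)
  p : Z ⟶ j
  equifibered : NatTrans.Equifibered p
  isFinite (T : D) : IsFinite (p.app T).left
  flat (T : D) : Flat (p.app T).left
  locallyOfFinitePresentation (T : D) : LocallyOfFinitePresentation (p.app T).left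
  q (i : ι) : Z ⟶ (Functor.const D).obj (P i).X

namespace FlfSpan

variable {D : Type (u + 1)} [Category.{u} D] {j : D ⥤ Over (SpecK k)} {ι : Type} [Finite ι]
  {P P' P'' : ι → PtdSch k}

/-- The part of `Z_T` that does not lie over the base point of the smash product `⋀ᵢ Pᵢ`, i.e. where
no `q i` takes the base point as its value. It is open and closed. -/
def support (α : FlfSpan j P) (T : D) : (α.Z.obj T).left.Opens where
  carrier := {z | ∀ i, ((α.q i).app T).left z ∈ (P i).away}
  is_open' := by
    simp only [Set.ofPred_forall]
    exact isOpen_iInter_of_finite fun i =>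
      (P i).away.isOpen.preimage ((α.q i).app T).left.continuous

lemma q_map (α : FlfSpan j P) {T T' : D} (f : T ⟶ T') (i : ι) (z : (α.Z.obj T).left) :
    ((α.q i).app T').left ((α.Z.map f).left z) = ((α.q i).app T).left z := by
  have h := (α.q i).naturality f
  have h' : α.Z.map f ≫ (α.q i).app T' = (α.q i).app T := h.trans (Category.comp_id _)
  rw [← h', Over.comp_left, Scheme.Hom.comp_apply]

lemma map_mem_support (α : FlfSpan j P) {T T' : D} (f : T ⟶ T') (z : (α.Z.obj T).left)
    (hz : z ∈ α.support T) : (α.Z.map f).left z ∈ α.support T' := fun i => by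
  rw [q_map]; exact hz i

lemma support_le (α : FlfSpan j P) {T T' : D} (f : T ⟶ T') :
    α.support T ≤ (α.Z.map f).left ⁻¹ᵁ α.support T' := α.map_mem_support f

/-- The subfunctor `T ↦ support T` of `Z`. It is a span from `Y` to `∏ᵢ Pᵢ°`. -/
def N (α : FlfSpan j P) : D ⥤ Over (SpecK k) where
  obj T := Over.mk ((α.support T).ι ≫ (α.Z.obj T).hom)
  map {T T'} f := Over.homMk ((α.Z.map f).left.resLE (α.support T') (α.support T)
    (α.support_le f)) (by
      change (α.Z.map f).left.resLE _ _ _ ≫ (α.support T').ι ≫ (α.Z.obj T').hom =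
        (α.support T).ι ≫ (α.Z.obj T).hom
      rw [Scheme.Hom.resLE_comp_ι_assoc, Over.w])
  map_id T := by
    ext1
    refine (cancel_mono (α.support T).ι).1 ?_
    change (α.Z.map (𝟙 T)).left.resLE _ _ _ ≫ (α.support T).ι = 𝟙 _ ≫ (α.support T).ι
    rw [Scheme.Hom.resLE_comp_ι, CategoryTheory.Functor.map_id, Category.id_comp]
    exact Category.comp_id _
  map_comp {T T' T''} f g := by
    ext1
    refine (cancel_mono (α.support T'').ι).1 ?_
    change (α.Z.map (f ≫ g)).left.resLE _ _ _ ≫ (α.support T'').ι =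
      ((α.Z.map f).left.resLE _ _ _ ≫ (α.Z.map g).left.resLE _ _ _) ≫ (α.support T'').ι
    rw [Scheme.Hom.resLE_comp_ι, Category.assoc, Scheme.Hom.resLE_comp_ι,
      Scheme.Hom.resLE_comp_ι_assoc, CategoryTheory.Functor.map_comp, Over.comp_left]

/-- The inclusion of the support into `Z`. -/
def ιN (α : FlfSpan j P) : α.N ⟶ α.Z where
  app T := Over.homMk (α.support T).ι rfl
  naturality T T' f := by
    ext1
    exact Scheme.Hom.resLE_comp_ι _ _

instance (α : FlfSpan j P) (T : D) : IsOpenImmersion (α.ιN.app T).left :=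
  inferInstanceAs (IsOpenImmersion (α.support T).ι)

instance (α : FlfSpan j P) (T : D) : Mono (α.ιN.app T) :=
  (Over.forget _).mono_of_mono_map (inferInstanceAs (Mono (α.ιN.app T).left))

instance (α : FlfSpan j P) : Mono α.ιN := NatTrans.mono_of_mono_app _

lemma ιN_mem (α : FlfSpan j P) (T : D) (x : (α.N.obj T).left) :
    (α.ιN.app T).left x ∈ α.support T := x.2

lemma range_subset (α : FlfSpan j P) (T : D) {M : Over (SpecK k)} (g : M ⟶ α.Z.obj T)
    (h : ∀ x, g.left x ∈ α.support T) : Set.range g.left ⊆ Set.range (α.ιN.app T).left :=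
  Set.range_subset_iff.2 fun x => Set.mem_range.2 ⟨⟨_, h x⟩, rfl⟩

/-- Maps into `Z_T` with image in the support factor through the support. -/
def liftApp (α : FlfSpan j P) (T : D) {M : Over (SpecK k)} (g : M ⟶ α.Z.obj T)
    (h : ∀ x, g.left x ∈ α.support T) : M ⟶ α.N.obj T :=
  Over.homMk (IsOpenImmersion.lift (α.ιN.app T).left g.left (α.range_subset T g h))
    ((IsOpenImmersion.lift_fac_assoc (α.ιN.app T).left _ _ _).trans (Over.w g))

lemma liftApp_ιN (α : FlfSpan j P) (T : D) {M : Over (SpecK k)} (g : M ⟶ α.Z.obj T)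
    (h : ∀ x, g.left x ∈ α.support T) : α.liftApp T g h ≫ α.ιN.app T = g := by
  ext1
  exact IsOpenImmersion.lift_fac (α.ιN.app T).left _ _

/-- Maps into `Z` with image in the support factor through the support. -/
def liftN (α : FlfSpan j P) {M : D ⥤ Over (SpecK k)} (g : M ⟶ α.Z)
    (h : ∀ T x, (g.app T).left x ∈ α.support T) : M ⟶ α.N where
  app T := α.liftApp T (g.app T) (h T)
  naturality T T' f := by
    rw [← cancel_mono (α.ιN.app T'), Category.assoc, Category.assoc, α.ιN.naturality,
      liftApp_ιN, ← Category.assoc, liftApp_ιN, g.naturality]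

lemma liftN_ιN (α : FlfSpan j P) {M : D ⥤ Over (SpecK k)} (g : M ⟶ α.Z)
    (h : ∀ T x, (g.app T).left x ∈ α.support T) : α.liftN g h ≫ α.ιN = g := by
  ext T : 2
  exact α.liftApp_ιN T _ (h T)

lemma liftN_ιN_assoc (α : FlfSpan j P) {M M' : D ⥤ Over (SpecK k)} (g : M ⟶ α.Z)
    (h : ∀ T x, (g.app T).left x ∈ α.support T) (a : α.Z ⟶ M') :
    α.liftN g h ≫ α.ιN ≫ a = g ≫ a := by
  rw [← Category.assoc, liftN_ιN]

/-- Morphisms of spans: isomorphisms of the supports over `Y` and over `∏ᵢ Pᵢ°`. So the category of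
these spans is equivalent to the groupoid of all spans `Y ⟵ Z ⟶ ∏ᵢ Pᵢ°` with finite locally free
left leg and their isomorphisms, that is, to the mapping groupoid from `Y` to `∏ᵢ Pᵢ°` in the
category of finite locally free correspondences. -/
@[ext]
structure Hom (α β : FlfSpan j P) where
  iso : α.N ≅ β.N
  w_p : iso.hom ≫ β.ιN ≫ β.p = α.ιN ≫ α.p
  w_q (i : ι) : iso.hom ≫ β.ιN ≫ β.q i = α.ιN ≫ α.q i

instance : Category (FlfSpan j P) where
  Hom := Hom
  id α := ⟨Iso.refl _, Category.id_comp _, fun _ => Category.id_comp _⟩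
  comp f g := ⟨f.iso ≪≫ g.iso, by simp [g.w_p, f.w_p], fun i => by simp [g.w_q, f.w_q]⟩
  id_comp _ := Hom.ext (Iso.refl_trans _)
  comp_id _ := Hom.ext (Iso.trans_refl _)
  assoc _ _ _ := Hom.ext (Iso.trans_assoc _ _ _)


@[simp] lemma id_iso (α : FlfSpan j P) : Hom.iso (𝟙 α) = Iso.refl _ := rfl
@[simp] lemma comp_iso {α β γ : FlfSpan j P} (f : α ⟶ β) (g : β ⟶ γ) :
    (f ≫ g).iso = f.iso ≪≫ g.iso := rfl

lemma hom_ext {α β : FlfSpan j P} {f g : α ⟶ β} (h : f.iso.hom ≫ β.ιN = g.iso.hom ≫ β.ιN) :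
    f = g :=
  Hom.ext (Iso.ext ((cancel_mono β.ιN).1 h))

lemma eqToHom_ιN {α β : FlfSpan j P} (h : α = β) :
    (eqToHom h).iso.hom ≫ β.ιN = α.ιN ≫ eqToHom (congrArg Z h) := by
  subst h
  simp

lemma mk_congr {Z : D ⥤ Over (SpecK k)} {p p' : Z ⟶ j} {h₁ h₂ h₃ h₄ h₁' h₂' h₃' h₄'}
    {q q' : ∀ i, Z ⟶ (Functor.const D).obj (P i).X} (hp : p = p') (hq : q = q') :
    FlfSpan.mk Z p h₁ h₂ h₃ h₄ q = FlfSpan.mk Z p' h₁' h₂' h₃' h₄' q' := by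
  subst hp hq
  rfl

lemma mem_support {α γ : FlfSpan j P} (g : α.N ⟶ γ.Z) (h : ∀ i, g ≫ γ.q i = α.ιN ≫ α.q i)
    (T : D) (x : (α.N.obj T).left) : (g.app T).left x ∈ γ.support T := fun i => by
  have h₁ : ((g ≫ γ.q i).app T).left x = ((α.ιN ≫ α.q i).app T).left x := by rw [h]
  have h₂ : ((γ.q i).app T).left ((g.app T).left x) =
      ((α.q i).app T).left ((α.ιN.app T).left x) := h₁
  rw [h₂]
  exact α.ιN_mem T x i

/-- The inverse of a morphism of spans. -/
def Hom.symm {α β : FlfSpan j P} (φ : α ⟶ β) : β ⟶ α :=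
  ⟨φ.iso.symm, by rw [← φ.w_p]; simp, fun i => by rw [← φ.w_q]; simp⟩

/-- Composition of a span with pointed maps `P i ⟶ P' i`. -/
abbrev pushObj (f : P ⟶ P') (α : FlfSpan j P) : FlfSpan j P' :=
  { α with q := fun i => α.q i ≫ (Functor.const D).map (f i).hom }

lemma support_pushObj_le (f : P ⟶ P') (α : FlfSpan j P) (T : D) :
    (pushObj f α).support T ≤ α.support T := fun z hz i =>
  PtdSch.mem_away_of_map (f i) (by
    have := hz i
    exact this)

/-- The inclusion of the support of the composed span. -/
def inclN (f : P ⟶ P') (α : FlfSpan j P) : (pushObj f α).N ⟶ α.N :=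
  α.liftN (pushObj f α).ιN fun T x => support_pushObj_le f α T ((pushObj f α).ιN_mem T x)

lemma inclN_ιN (f : P ⟶ P') (α : FlfSpan j P) : inclN f α ≫ α.ιN = (pushObj f α).ιN :=
  α.liftN_ιN _ _

lemma inclN_ιN_assoc (f : P ⟶ P') (α : FlfSpan j P) {M : D ⥤ Over (SpecK k)} (a : α.Z ⟶ M) :
    inclN f α ≫ α.ιN ≫ a = (pushObj f α).ιN ≫ a :=
  α.liftN_ιN_assoc _ _ _

instance (f : P ⟶ P') (α : FlfSpan j P) : Mono (inclN f α) :=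
  have : Mono (inclN f α ≫ α.ιN) := by
    rw [inclN_ιN]
    exact inferInstanceAs (Mono (pushObj f α).ιN)
  mono_of_mono _ α.ιN

/-- The restriction of a morphism of spans to the supports of the composed spans. -/
def pushN (f : P ⟶ P') {α β : FlfSpan j P} (φ : α ⟶ β) : (pushObj f α).N ⟶ (pushObj f β).N :=
  (pushObj f β).liftN (inclN f α ≫ φ.iso.hom ≫ β.ιN) (mem_support _ fun i => by
    have h := φ.w_q i
    change (inclN f α ≫ φ.iso.hom ≫ β.ιN) ≫ β.q i ≫ (Functor.const D).map (f i).hom =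
      (pushObj f α).ιN ≫ α.q i ≫ (Functor.const D).map (f i).hom
    rw [Category.assoc, Category.assoc, reassoc_of% h, inclN_ιN_assoc])

lemma pushN_ιN (f : P ⟶ P') {α β : FlfSpan j P} (φ : α ⟶ β) :
    pushN f φ ≫ (pushObj f β).ιN = inclN f α ≫ φ.iso.hom ≫ β.ιN :=
  (pushObj f β).liftN_ιN _ _

lemma pushN_inclN (f : P ⟶ P') {α β : FlfSpan j P} (φ : α ⟶ β) :
    pushN f φ ≫ inclN f β = inclN f α ≫ φ.iso.hom := by
  rw [← cancel_mono β.ιN, Category.assoc, Category.assoc, inclN_ιN]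
  exact pushN_ιN f φ

lemma pushN_id (f : P ⟶ P') (α : FlfSpan j P) : pushN f (𝟙 α) = 𝟙 _ := by
  rw [← cancel_mono (inclN f α), pushN_inclN, id_iso, Iso.refl_hom, Category.comp_id,
    Category.id_comp]

lemma pushN_comp (f : P ⟶ P') {α β γ : FlfSpan j P} (φ : α ⟶ β) (ψ : β ⟶ γ) :
    pushN f (φ ≫ ψ) = pushN f φ ≫ pushN f ψ := by
  rw [← cancel_mono (inclN f γ), pushN_inclN, Category.assoc, pushN_inclN, ← Category.assoc,
    pushN_inclN, comp_iso, Iso.trans_hom, Category.assoc]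

/-- Functoriality of the composition with pointed maps. -/
def pushHom (f : P ⟶ P') {α β : FlfSpan j P} (φ : α ⟶ β) : pushObj f α ⟶ pushObj f β where
  iso :=
    { hom := pushN f φ
      inv := pushN f φ.symm
      hom_inv_id := by
        rw [← pushN_comp, show φ ≫ φ.symm = 𝟙 α from Hom.ext φ.iso.self_symm_id, pushN_id]
      inv_hom_id := by
        rw [← pushN_comp, show φ.symm ≫ φ = 𝟙 β from Hom.ext φ.iso.symm_self_id, pushN_id] }
  w_p := by
    have h := φ.w_p
    have h₁ := pushN_ιN f φ
    change pushN f φ ≫ (pushObj f β).ιN ≫ β.p = (pushObj f α).ιN ≫ α.p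
    rw [reassoc_of% h₁, h, inclN_ιN_assoc]
  w_q i := by
    have h := φ.w_q i
    have h₁ := pushN_ιN f φ
    change pushN f φ ≫ (pushObj f β).ιN ≫ β.q i ≫ (Functor.const D).map (f i).hom =
      (pushObj f α).ιN ≫ α.q i ≫ (Functor.const D).map (f i).hom
    rw [reassoc_of% h₁, reassoc_of% h, inclN_ιN_assoc]

/-- The functor of composition with pointed maps `P i ⟶ P' i`. -/
def push (f : P ⟶ P') : FlfSpan j P ⥤ FlfSpan j P' where
  obj α := pushObj f α
  map φ := pushHom f φ
  map_id α := Hom.ext (Iso.ext (pushN_id f α))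
  map_comp φ ψ := Hom.ext (Iso.ext (pushN_comp f φ ψ))

lemma pushObj_id (α : FlfSpan j P) : pushObj (𝟙 P) α = α :=
  mk_congr rfl (funext fun i => (congrArg (α.q i ≫ ·) ((Functor.const D).map_id _)).trans
    (Category.comp_id _))

lemma pushObj_comp (f : P ⟶ P') (g : P' ⟶ P'') (α : FlfSpan j P) :
    pushObj (f ≫ g) α = pushObj g (pushObj f α) :=
  mk_congr rfl (funext fun i => (congrArg (α.q i ≫ ·) ((Functor.const D).map_comp _ _)).trans
    (Category.assoc _ _ _).symm)

lemma conj_ιN {α α' β β' : FlfSpan j P} (h : α = α') (h' : β' = β) (φ : α' ⟶ β') :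
    (eqToHom h ≫ φ ≫ eqToHom h').iso.hom ≫ β.ιN =
      (eqToHom h).iso.hom ≫ φ.iso.hom ≫ β'.ιN ≫ eqToHom (congrArg Z h') := by
  subst h h'
  simp

lemma push_id : push (j := j) (𝟙 P) = 𝟭 _ := by
  refine CategoryTheory.Functor.ext pushObj_id fun α β φ => hom_ext ?_
  have h₁ : (eqToHom (pushObj_id α)).iso.hom = inclN (𝟙 P) α := by
    rw [← cancel_mono α.ιN, eqToHom_ιN, inclN_ιN]
    exact Category.comp_id _
  refine Eq.trans ?_ (conj_ιN (pushObj_id α) (pushObj_id β).symm φ).symm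
  rw [h₁]
  refine (pushN_ιN (𝟙 P) φ).trans ?_
  exact congrArg (fun t => inclN (𝟙 P) α ≫ φ.iso.hom ≫ t) (Category.comp_id β.ιN).symm

lemma push_comp (f : P ⟶ P') (g : P' ⟶ P'') : push (j := j) (f ≫ g) = push f ⋙ push g := by
  refine CategoryTheory.Functor.ext (pushObj_comp f g) fun α β φ => hom_ext ?_
  have h₁ : (eqToHom (pushObj_comp f g α)).iso.hom ≫ inclN g (pushObj f α) ≫ inclN f α =
      inclN (f ≫ g) α := by
    rw [← cancel_mono α.ιN, Category.assoc, Category.assoc, inclN_ιN, inclN_ιN, inclN_ιN,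
      eqToHom_ιN]
    exact Category.comp_id _
  refine Eq.trans ?_
    (conj_ιN (pushObj_comp f g α) (pushObj_comp f g β).symm (pushHom g (pushHom f φ))).symm
  refine (pushN_ιN (f ≫ g) φ).trans ?_
  have h₂ : pushN g (pushHom f φ) ≫ (pushObj g (pushObj f β)).ιN =
      inclN g (pushObj f α) ≫ inclN f α ≫ φ.iso.hom ≫ β.ιN :=
    (pushN_ιN g (pushHom f φ)).trans (congrArg (inclN g (pushObj f α) ≫ ·) (pushN_ιN f φ))
  have h₃ : pushN g (pushHom f φ) ≫ (pushObj g (pushObj f β)).ιN ≫ 𝟙 β.Z =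
      inclN g (pushObj f α) ≫ inclN f α ≫ φ.iso.hom ≫ β.ιN :=
    (congrArg (pushN g (pushHom f φ) ≫ ·) (Category.comp_id _)).trans h₂
  refine Eq.trans ?_ (congrArg ((eqToHom (pushObj_comp f g α)).iso.hom ≫ ·) h₃.symm)
  rw [← h₁, Category.assoc, Category.assoc]

variable {D' D'' : Type (u + 1)} [Category.{u} D'] [Category.{u} D'']

/-- Restriction of a span along a functor. -/
abbrev preObj (H : D' ⥤ D) (α : FlfSpan j P) : FlfSpan (H ⋙ j) P where
  Z := H ⋙ α.Z
  p := H.whiskerLeft α.p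
  equifibered := α.equifibered.whiskerLeft H
  isFinite T := α.isFinite (H.obj T)
  flat T := α.flat (H.obj T)
  locallyOfFinitePresentation T := α.locallyOfFinitePresentation (H.obj T)
  q i := H.whiskerLeft (α.q i)

/-- Restriction of spans along a functor. -/
def preAux (H : D' ⥤ D) : FlfSpan j P ⥤ FlfSpan (H ⋙ j) P where
  obj α := preObj H α
  map {α β} φ :=
    { iso := Functor.isoWhiskerLeft H φ.iso
      w_p := congrArg H.whiskerLeft φ.w_p
      w_q i := congrArg H.whiskerLeft (φ.w_q i) }
  map_id _ := rfl
  map_comp _ _ := rfl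

/-- Restriction of spans along a functor `H`, with `j'` equal to `H ⋙ j`. -/
def pre (H : D' ⥤ D) {j' : D' ⥤ Over (SpecK k)} (h : H ⋙ j = j') :
    FlfSpan j P ⥤ FlfSpan j' P :=
  h ▸ preAux H

lemma pre_id (H : D ⥤ D) (hH : H = 𝟭 D) (h : H ⋙ j = j) : pre (P := P) H h = 𝟭 _ := by
  subst hH
  rfl

lemma pre_comp (H : D' ⥤ D) (H' : D'' ⥤ D') (H'' : D'' ⥤ D) (hH : H'' = H' ⋙ H)
    {j' : D' ⥤ Over (SpecK k)} {j'' : D'' ⥤ Over (SpecK k)} (h : H ⋙ j = j') (h' : H' ⋙ j' = j'')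
    (h'' : H'' ⋙ j = j'') : pre (P := P) H'' h'' = pre H h ⋙ pre H' h' := by
  subst hH h h'
  rfl

lemma pre_push (H : D' ⥤ D) {j' : D' ⥤ Over (SpecK k)} (h : H ⋙ j = j') (f : P ⟶ P') :
    pre H h ⋙ push f = push f ⋙ pre H h := by
  subst h
  rfl

variable (k) in
/-- The empty scheme over `Spec k`. -/
abbrev emptyOver : Over (SpecK k) := Over.mk (initial.to (SpecK k))

lemma over_hom_ext_of_isEmpty {W X : Over (SpecK k)} [IsEmpty W.left] (f g : W ⟶ X) : f = g := by
  ext1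
  exact isInitialOfIsEmpty.hom_ext _ _

instance : IsEmpty (emptyOver k).left := inferInstanceAs (IsEmpty ↥(⊥_ Scheme.{u}))

lemma const_empty_hom_ext {F : D ⥤ Over (SpecK k)}
    (f g : (Functor.const D).obj (emptyOver k) ⟶ F) : f = g := by
  apply NatTrans.ext
  funext T
  exact over_hom_ext_of_isEmpty (W := emptyOver k) _ _

/-- The map from the constant functor at the empty scheme. -/
def fromEmpty (F : D ⥤ Over (SpecK k)) : (Functor.const D).obj (emptyOver k) ⟶ F where
  app T := Over.homMk (U := emptyOver k) (initial.to _) (initial.hom_ext _ _)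
  naturality _ _ _ := over_hom_ext_of_isEmpty (W := emptyOver k) _ _

lemma fromEmpty_equifibered (F : D ⥤ Over (SpecK k)) :
    NatTrans.Equifibered (fromEmpty F) := fun T T' f =>
  ⟨⟨(fromEmpty F).naturality f⟩, ⟨PullbackCone.IsLimit.mk _ (fun s => s.fst)
    (fun s => Category.comp_id _)
    (fun s => by
      have : IsEmpty s.pt.left := (Function.isEmpty (β := (emptyOver k).left) s.fst.left)
      exact over_hom_ext_of_isEmpty _ _)
    (fun s m h _ => (Category.comp_id m).symm.trans h)⟩⟩

/-- The empty span, the zero for the disjoint union of spans. -/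
def zero (j : D ⥤ Over (SpecK k)) (P : ι → PtdSch k) : FlfSpan j P where
  Z := (Functor.const D).obj (emptyOver k)
  p := fromEmpty j
  equifibered := fromEmpty_equifibered j
  isFinite T := inferInstanceAs (IsFinite (initial.to (j.obj T).left))
  flat T := inferInstanceAs (Flat (initial.to (j.obj T).left))
  locallyOfFinitePresentation T :=
    inferInstanceAs (LocallyOfFinitePresentation (initial.to (j.obj T).left))
  q _ := fromEmpty _

lemma push_zero (f : P ⟶ P') : (push f).obj (zero j P) = zero j P' :=
  mk_congr rfl (funext fun _ => const_empty_hom_ext _ _)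

lemma pre_zero (H : D' ⥤ D) {j' : D' ⥤ Over (SpecK k)} (h : H ⋙ j = j') :
    (pre H h).obj (zero j P) = zero j' P := by
  subst h
  exact mk_congr (const_empty_hom_ext _ _) (funext fun _ => const_empty_hom_ext _ _)

end FlfSpan

/-- Categories with a distinguished object. -/
structure PCat where
  C : Type w
  [cat : Category.{w} C]
  pt : C

attribute [instance] PCat.cat

namespace PCat

/-- Functors that preserve the distinguished object strictly. -/
@[ext]
structure Hom (A B : PCat.{w}) where
  F : A.C ⥤ B.C
  w : F.obj A.pt = B.pt

instance : Category PCat.{w} where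
  Hom := Hom
  id A := ⟨𝟭 _, rfl⟩
  comp f g := ⟨f.F ⋙ g.F, (congrArg g.F.obj f.w).trans g.w⟩

/-- The nerve of a category, pointed by the distinguished object. -/
def nerve : PCat.{w} ⥤ PSSet.{w} where
  obj A :=
    { obj m := ⟨ComposableArrows A.C m.unop.len, (Functor.const _).obj A.pt⟩
      map f := ⟨fun x => (CategoryTheory.nerve A.C).map f x, rfl⟩ }
  map {A B} f :=
    { app m := ⟨fun x => x ⋙ f.F, by
        change (Functor.const _).obj A.pt ⋙ f.F = (Functor.const _).obj B.pt
        exact CategoryTheory.Functor.ext (fun _ => f.w) (by simp)⟩ }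

end PCat

namespace FlfSpan

variable {ι : Type} [Finite ι]

/-- The functor sending a smooth `k`-scheme `T` over `Y` to `T`. -/
abbrev base (Y : Sm k) : Over Y ⥤ Over (SpecK k) := Over.forget Y ⋙ Sm.toOver k

lemma map_base {Y' Y : Sm k} (g : Y' ⟶ Y) : Over.map g ⋙ base Y = base Y' :=
  congrArg (· ⋙ Sm.toOver k) (Over.mapForget_eq g)

/-- The groupoid of finite locally free spans from `Y` to `⋀ᵢ Pᵢ`, pointed by the empty span. -/
def category (P : ι → PtdSch k) (Y : Sm k) : PCat.{u + 1} := ⟨FlfSpan (base Y) P, zero _ _⟩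

/-- Base change of spans along `g : Y' ⟶ Y`. -/
def restrict (P : ι → PtdSch k) {Y' Y : Sm k} (g : Y' ⟶ Y) : category P Y ⟶ category P Y' :=
  ⟨pre (P := P) (Over.map g) (map_base g), pre_zero (P := P) (Over.map g) (map_base g)⟩

/-- Composition of spans with pointed maps. -/
def pushforward {P P' : ι → PtdSch k} (f : P ⟶ P') (Y : Sm k) : category P Y ⟶ category P' Y :=
  ⟨push f, push_zero f⟩

/-- The groupoid of finite locally free spans from `Y` to `⋀ᵢ Pᵢ`, as a functor of `Y` and of the
pointed schemes `Pᵢ`. -/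
def presheaf : (ι → PtdSch k) ⥤ (Sm k)ᵒᵖ ⥤ PCat.{u + 1} where
  obj P :=
    { obj Y := category P Y.unop
      map g := restrict P g.unop
      map_id Y := PCat.Hom.ext (pre_id (P := P) (j := base Y.unop) (Over.map (𝟙 Y.unop))
        (Over.mapId_eq Y.unop)
        (map_base (𝟙 Y.unop)))
      map_comp g g' := PCat.Hom.ext (pre_comp (P := P) (Over.map g.unop)
        (Over.map g'.unop) (Over.map (g'.unop ≫ g.unop)) (Over.mapComp_eq _ _)
        (map_base g.unop) (map_base g'.unop) (map_base (g'.unop ≫ g.unop))) }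
  map f :=
    { app Y := pushforward f Y.unop
      naturality Y Y' g := PCat.Hom.ext (pre_push (Over.map g.unop) (map_base g.unop) f) }
  map_id P := by
    apply NatTrans.ext
    funext Y
    exact PCat.Hom.ext push_id
  map_comp f g := by
    apply NatTrans.ext
    funext Y
    exact PCat.Hom.ext (push_comp f g)

end FlfSpan
section Coproducts

variable {I : Type} (X : I → Over (SpecK k))

/-- The coproduct of a family of `k`-schemes. -/
abbrev sigmaOver : Over (SpecK k) := Over.mk (Sigma.desc fun i => (X i).hom)

/-- The inclusion of a summand. -/
abbrev sigmaOverι (i : I) : X i ⟶ sigmaOver X :=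
  Over.homMk (Sigma.ι (fun i => (X i).left) i) (Sigma.ι_desc _ _)

variable {X} in
/-- Maps out of a coproduct. -/
abbrev sigmaOverDesc {W : Over (SpecK k)} (f : ∀ i, X i ⟶ W) : sigmaOver X ⟶ W :=
  Over.homMk (U := sigmaOver X) (Sigma.desc fun i => (f i).left) (by
    apply Sigma.hom_ext
    intro i
    refine (Sigma.ι_desc_assoc _ _ _).trans ((Over.w (f i)).trans ?_)
    exact (Sigma.ι_desc (fun i => (X i).hom) i).symm)

lemma sigmaOverι_desc {W : Over (SpecK k)} (f : ∀ i, X i ⟶ W) (i : I) :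
    sigmaOverι X i ≫ sigmaOverDesc f = f i := by
  ext1
  exact Sigma.ι_desc _ _

lemma sigmaOverι_desc_assoc {W W' : Over (SpecK k)} (f : ∀ i, X i ⟶ W) (i : I) (g : W ⟶ W') :
    sigmaOverι X i ≫ sigmaOverDesc f ≫ g = f i ≫ g := by
  rw [← Category.assoc, sigmaOverι_desc]

variable {X} in
lemma sigmaOver_hom_ext {W : Over (SpecK k)} {f g : sigmaOver X ⟶ W}
    (h : ∀ i, sigmaOverι X i ≫ f = sigmaOverι X i ≫ g) : f = g := by
  ext1
  refine Sigma.hom_ext _ _ fun i => ?_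
  exact congrArg (fun r => Over.Hom.left r) (h i)

instance (i : I) : IsOpenImmersion (sigmaOverι X i).left :=
  inferInstanceAs (IsOpenImmersion (Sigma.ι (fun i => (X i).left) i))

lemma isClosed_range_sigmaι (X : I → Scheme.{u}) (i : I) :
    IsClosed (Set.range (Sigma.ι X i)) := by
  have h : (Set.range (Sigma.ι X i))ᶜ = ⋃ j : {j // j ≠ i}, Set.range (Sigma.ι X j) := by
    ext x
    obtain ⟨j, y, rfl⟩ := (sigmaOpenCover X).exists_eq x
    change Sigma.ι X j y ∈ _ ↔ Sigma.ι X j y ∈ _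
    simp only [Set.mem_compl_iff, Set.mem_range, Set.mem_iUnion]
    constructor
    · intro h
      exact ⟨⟨j, fun hj => by subst hj; exact h ⟨y, rfl⟩⟩, y, rfl⟩
    · rintro ⟨⟨j', hj'⟩, y', hy⟩ ⟨z, hz⟩
      have h₁ : j' = j := congrArg Sigma.fst ((sigmaι_eq_iff X _ _ _ _).1 hy)
      have h₂ : i = j := congrArg Sigma.fst ((sigmaι_eq_iff X _ _ _ _).1 hz)
      exact hj' (h₁.trans h₂.symm)
  rw [← isOpen_compl_iff, h]
  exact isOpen_iUnion fun j => (Sigma.ι X j).opensRange.isOpen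

/-- A coproduct of `k`-schemes, pointed by a summand that is a copy of `Spec k`. -/
def PtdSch.ofSigma (i : I) (e : Over.mk (𝟙 (SpecK k)) ≅ X i) : PtdSch k where
  X := sigmaOver X
  pt := e.hom ≫ sigmaOverι X i
  isOpenImmersion :=
    have : IsIso e.hom.left := inferInstanceAs (IsIso ((Over.forget _).map e.hom))
    inferInstanceAs (IsOpenImmersion (e.hom.left ≫ Sigma.ι (fun i => (X i).left) i))
  isClosed := by
    have : IsIso e.hom.left := inferInstanceAs (IsIso ((Over.forget _).map e.hom))
    have h : Function.Surjective e.hom.left := Scheme.Hom.surjective _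
    have h' : Set.range (e.hom.left ≫ Sigma.ι (fun i => (X i).left) i) =
        Set.range (Sigma.ι (fun i => (X i).left) i) := h.range_comp _
    change IsClosed (Set.range (e.hom.left ≫ Sigma.ι (fun i => (X i).left) i))
    rw [h']
    exact isClosed_range_sigmaι _ i

end Coproducts

section ConstantSchemes

variable (k) in
/-- The map `∐_A Spec k ⟶ ∐_B Spec k` induced by a map `A → B`. -/
def constMap {A B : Type} (f : A → B) :
    sigmaOver (fun _ : A => Over.mk (𝟙 (SpecK k))) ⟶
      sigmaOver (fun _ : B => Over.mk (𝟙 (SpecK k))) :=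
  sigmaOverDesc fun a => sigmaOverι (fun _ : B => Over.mk (𝟙 (SpecK k))) (f a)

lemma sigmaOverι_constMap {A B : Type} (f : A → B) (a : A) :
    sigmaOverι (fun _ : A => Over.mk (𝟙 (SpecK k))) a ≫ constMap k f =
      sigmaOverι (fun _ : B => Over.mk (𝟙 (SpecK k))) (f a) :=
  sigmaOverι_desc _ _ _

lemma constMap_id (A : Type) : constMap k (id : A → A) = 𝟙 _ :=
  sigmaOver_hom_ext fun a => (sigmaOverι_constMap _ a).trans (Category.comp_id _).symm

lemma constMap_comp {A B B' : Type} (f : A → B) (g : B → B') :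
    constMap k (g ∘ f) = constMap k f ≫ constMap k g :=
  sigmaOver_hom_ext fun a => by
    rw [sigmaOverι_constMap, ← Category.assoc, sigmaOverι_constMap, sigmaOverι_constMap]
    rfl

variable (k) in
/-- The constant pointed scheme `∐_A Spec k` on a pointed set `A`. -/
def constSch : Pointed.{0} ⥤ PtdSch k where
  obj A := PtdSch.ofSigma (fun _ : A.X => Over.mk (𝟙 (SpecK k))) A.point (Iso.refl _)
  map {A B} f :=
    { hom := constMap k f.toFun
      w := by
        refine (Category.assoc _ _ _).trans ((Category.id_comp _).trans ?_)
        refine (sigmaOverι_constMap _ _).trans (Eq.trans ?_ (Category.id_comp _).symm)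
        rw [f.map_point] }
  map_id A := PtdSch.hom_ext (constMap_id A.X)
  map_comp f g := PtdSch.hom_ext (constMap_comp f.toFun g.toFun)

end ConstantSchemes

section Gm

open LaurentPolynomial

variable (k)

/-- The multiplicative group `Spec k[T, T⁻¹]`. -/
def Gm : Over (SpecK k) :=
  Over.mk (Spec.map (CommRingCat.ofHom (LaurentPolynomial.C : k →+* k[T;T⁻¹])))

/-- The point `1` of the multiplicative group. -/
def Gm.one : Over.mk (𝟙 (SpecK k)) ⟶ Gm k :=
  Over.homMk (V := Gm k)
    (Spec.map (CommRingCat.ofHom (LaurentPolynomial.eval₂ (RingHom.id k) 1))) (by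
    change Spec.map _ ≫ Spec.map _ = 𝟙 _
    rw [← Spec.map_comp, ← CommRingCat.ofHom_comp, ← Spec.map_id]
    congr 2
    ext r
    exact LaurentPolynomial.eval₂_C _ _ r)

/-- The index set of the summands in degree `m` of the whiskered multiplicative group: `none` for
`𝔾_m`, and an `m`-simplex of `Δ[1]` other than the one at the vertex `0`. -/
abbrev WhiskerIndex (m : SimplexCategory) : Type :=
  Option { σ : m ⟶ ⦋1⦌ // σ ≠ SimplexCategory.const m ⦋1⦌ 0 }

/-- The summands in degree `m` of the whiskered multiplicative group. -/
abbrev whiskerSummand (m : SimplexCategory) (i : WhiskerIndex m) : Over (SpecK k) :=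
  match i with
  | none => Gm k
  | some _ => Over.mk (𝟙 (SpecK k))

lemma const_one_ne (m : SimplexCategory) :
    SimplexCategory.const m ⦋1⦌ 1 ≠ SimplexCategory.const m ⦋1⦌ 0 := fun h =>
  absurd (congrArg (fun f : m ⟶ ⦋1⦌ => f.toOrderHom 0) h) (by simp)

open Classical in
/-- The `m`-simplex `σ` of the whisker `Δ[1]`, where the vertex `0` is glued to `1 ∈ 𝔾_m`. -/
def whiskerCell (m : SimplexCategory) (σ : m ⟶ ⦋1⦌) :
    Over.mk (𝟙 (SpecK k)) ⟶ sigmaOver (whiskerSummand k m) :=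
  if h : σ = SimplexCategory.const m ⦋1⦌ 0 then
    Gm.one k ≫ sigmaOverι (whiskerSummand k m) none
  else sigmaOverι (whiskerSummand k m) (some ⟨σ, h⟩)

/-- The simplicial structure maps of the whiskered multiplicative group. -/
def whiskerMap {m m' : SimplexCategory} (φ : m' ⟶ m) :
    sigmaOver (whiskerSummand k m) ⟶ sigmaOver (whiskerSummand k m') :=
  sigmaOverDesc fun i => match i with
    | none => sigmaOverι (whiskerSummand k m') none
    | some σ => whiskerCell k m' (φ ≫ σ.1)

lemma whiskerι_none_map {m m' : SimplexCategory} (φ : m' ⟶ m) :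
    sigmaOverι (whiskerSummand k m) none ≫ whiskerMap k φ =
      sigmaOverι (whiskerSummand k m') none :=
  sigmaOverι_desc _ _ _

lemma whiskerCell_map {m m' : SimplexCategory} (φ : m' ⟶ m) (σ : m ⟶ ⦋1⦌) :
    whiskerCell k m σ ≫ whiskerMap k φ = whiskerCell k m' (φ ≫ σ) := by
  by_cases h : σ = SimplexCategory.const m ⦋1⦌ 0
  · subst h
    have h : φ ≫ SimplexCategory.const m ⦋1⦌ 0 = SimplexCategory.const m' ⦋1⦌ 0 := rfl
    rw [h, whiskerCell, whiskerCell, dif_pos rfl, dif_pos rfl, Category.assoc, whiskerι_none_map]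
  · rw [whiskerCell, dif_neg h]
    exact sigmaOverι_desc _ _ _

lemma whiskerCell_of_ne {m : SimplexCategory} (σ : m ⟶ ⦋1⦌)
    (h : σ ≠ SimplexCategory.const m ⦋1⦌ 0) :
    whiskerCell k m σ = sigmaOverι (whiskerSummand k m) (some ⟨σ, h⟩) :=
  dif_neg h

lemma whiskerι_some_map {m m' : SimplexCategory} (φ : m' ⟶ m)
    (σ : { σ : m ⟶ ⦋1⦌ // σ ≠ SimplexCategory.const m ⦋1⦌ 0 }) :
    sigmaOverι (whiskerSummand k m) (some σ) ≫ whiskerMap k φ = whiskerCell k m' (φ ≫ σ.1) :=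
  sigmaOverι_desc _ _ _

lemma whiskerMap_id (m : SimplexCategory) : whiskerMap k (𝟙 m) = 𝟙 _ := by
  refine sigmaOver_hom_ext fun i => ?_
  rw [Category.comp_id]
  obtain _ | σ := i
  · exact whiskerι_none_map k _
  · rw [whiskerι_some_map, Category.id_comp, whiskerCell_of_ne k σ.1 σ.2]

lemma whiskerMap_comp {m m' m'' : SimplexCategory} (φ : m' ⟶ m) (ψ : m'' ⟶ m') :
    whiskerMap k (ψ ≫ φ) = whiskerMap k φ ≫ whiskerMap k ψ := by
  refine sigmaOver_hom_ext fun i => ?_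
  rw [← Category.assoc]
  obtain _ | σ := i
  · rw [whiskerι_none_map, whiskerι_none_map, whiskerι_none_map]
  · rw [whiskerι_some_map, whiskerι_some_map, whiskerCell_map, Category.assoc]

/-- The whiskered multiplicative group: the simplicial scheme `𝔾_m ⊔_{1} Δ[1]` obtained by gluing
the vertex `0` of the interval to the point `1`, pointed at the free vertex `1` of the interval.
It is a simplicial resolution of the pointed presheaf `(𝔾_m, 1)` by smooth `k`-schemes with a
disjoint base point: contracting the interval is a weak equivalence of pointed simplicial
presheaves onto `(𝔾_m, 1)`. -/
def whiskeredGm : SimplicialObject (PtdSch k) where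
  obj m := PtdSch.ofSigma (whiskerSummand k m.unop)
    (some ⟨SimplexCategory.const m.unop ⦋1⦌ 1, const_one_ne _⟩) (Iso.refl _)
  map {m m'} φ :=
    { hom := whiskerMap k φ.unop
      w := by
        refine (Category.assoc _ _ _).trans ((Category.id_comp _).trans ?_)
        refine Eq.trans ?_ (Category.id_comp _).symm
        refine (whiskerι_some_map k φ.unop _).trans ?_
        exact whiskerCell_of_ne k _ (const_one_ne m'.unop) }
  map_id m := PtdSch.hom_ext (whiskerMap_id k m.unop)
  map_comp φ ψ := PtdSch.hom_ext (whiskerMap_comp k φ.unop ψ.unop)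

end Gm

/-- The relation identifying the two (constant) `m`-simplices of `∂Δ[1]`. -/
def CircleRel (m : SimplexCategory) (σ τ : m ⟶ ⦋1⦌) : Prop :=
  (∃ a, σ = SimplexCategory.const m ⦋1⦌ a) ∧ (∃ b, τ = SimplexCategory.const m ⦋1⦌ b)

/-- The simplicial circle `Δ[1] / ∂Δ[1]`. -/
def circle : SimplicialObject Pointed.{0} where
  obj m := ⟨Quot (CircleRel m.unop), Quot.mk _ (SimplexCategory.const m.unop ⦋1⦌ 0)⟩
  map φ := ⟨Quot.map (φ.unop ≫ ·) (by
    rintro _ _ ⟨⟨a, rfl⟩, ⟨b, rfl⟩⟩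
    exact ⟨⟨a, rfl⟩, ⟨b, rfl⟩⟩), rfl⟩
  map_id m := Pointed.Hom.ext (funext fun x => by
    induction x using Quot.ind with
    | _ σ => exact congrArg (Quot.mk _) (Category.id_comp σ))
  map_comp φ ψ := Pointed.Hom.ext (funext fun x => by
    induction x using Quot.ind with
    | _ σ => exact congrArg (Quot.mk _) (Category.assoc ψ.unop φ.unop σ))

section Flf

/-- The smash products `K ∧ A` of a (termwise iterated smash product) simplicial pointed scheme
`K = ⋀ᵢ Kᵢ` with the constant pointed schemes on pointed sets `A`. -/
def smashWith {ι : Type} (K : SimplicialObject (ι → PtdSch k)) :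
    Pointed.{0} ⥤ SimplicialObject (Option ι → PtdSch k) :=
  Functor.curry.obj (Functor.pi' fun i : Option ι => match i with
    | none => CategoryTheory.Prod.fst _ _ ⋙ constSch k
    | some i => CategoryTheory.Prod.snd _ _ ⋙ K ⋙ Pi.eval (fun _ : ι => PtdSch k) i)

/-- The sectionwise geometric realization of a simplicial presheaf of pointed spaces. -/
def diagPresheaf {C : Type*} [Category* C] : SimplicialObject (C ⥤ PSSet.{w}) ⥤ (C ⥤ PSSet.{w}) :=
  flipFunctor _ _ _ ⋙ (Functor.whiskeringRight _ _ _).obj PSSet.diag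

/-- The space (nerve of the groupoid) of finite locally free spans from `Y` to `⋀ᵢ Pᵢ`, that is, the
presheaf of spaces on `Sm k` represented by `∏ᵢ Pᵢ°` in finite locally free correspondences. -/
def spanNerve {ι : Type} [Finite ι] : (ι → PtdSch k) ⥤ (Sm k)ᵒᵖ ⥤ PSSet.{u + 1} :=
  FlfSpan.presheaf ⋙ (Functor.whiskeringRight _ _ _).obj PCat.nerve

/-- The presheaf of `E_∞`-monoids `h^flf(K)` on `Sm k`, for a simplicial pointed scheme `K = ⋀ᵢ Kᵢ`
with disjoint base points in each degree. On such a scheme `X` with a disjoint base point, `h^flf` is the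
presheaf represented by `X` in finite locally free correspondences, and `h^flf` commutes with
geometric realizations.

The monoid structure (disjoint union of spans) is recorded as a special `Γ`-space: the functor
sending a pointed set `A` to `h^flf(K ∧ A)`. Its value at `{0, …, r}` is equivalent to `h^flf(K)^r`, and
the fold map `{0, 1, 2} → {0, 1}` induces the disjoint union. -/
def hflf {ι : Type} [Finite ι] (K : SimplicialObject (ι → PtdSch k)) :
    Pointed.{0} ⥤ (Sm k)ᵒᵖ ⥤ PSSet.{u + 1} :=
  smashWith K ⋙ (SimplicialObject.whiskering _ _).obj spanNerve ⋙ diagPresheaf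

/-- The group completion of a presheaf of `E_∞`-monoids given as a special `Γ`-space: the
presheaf of spaces `Ω B M`, where `B M` is the geometric realization of `M` on the simplicial circle. -/
def gp (M : Pointed.{0} ⥤ (Sm k)ᵒᵖ ⥤ PSSet.{u + 1}) : (Sm k)ᵒᵖ ⥤ SSet.{u + 1} :=
  diagPresheaf.obj (circle ⋙ M) ⋙ PSSet.loopSpace

variable (k) in
/-- The `n`-fold smash power `𝔾_m^{∧ n}` of the pointed presheaf `(𝔾_m, 1)`, as a simplicial
pointed scheme with disjoint base points: the termwise smash power of the whiskered multiplicative group. -/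
def GmSmash (n : ℕ) : SimplicialObject (Fin n → PtdSch k) :=
  Functor.pi' fun _ => whiskeredGm k

variable (k) in
/-- The sectionwise weak equivalences of simplicial presheaves. -/
abbrev presheafWeakEq : MorphismProperty ((Sm k)ᵒᵖ ⥤ SSet.{u + 1}) :=
  SSet.weakEq.functorCategory (Sm k)ᵒᵖ

variable (k) in
/-- The homotopy category of presheaves of spaces on `Sm k`. -/
abbrev HoPSh := (presheafWeakEq k).Localization

variable (k) in
/-- The localization functor. -/
abbrev HoPSh.of : ((Sm k)ᵒᵖ ⥤ SSet.{u + 1}) ⥤ HoPSh k := (presheafWeakEq k).Q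

/-- A presheaf of spaces `F` is rationally contractible if there is a map `s : F ⟶ Ĉ₁ F` of
presheaves of spaces such that `i₀^* s` is homotopic to the identity and `i₁^* s` factors, up to homotopy,
through the terminal presheaf. -/
def RationallyContractible (F : (Sm k)ᵒᵖ ⥤ SSet.{u + 1}) : Prop :=
  ∃ s : (HoPSh.of k).obj F ⟶ (HoPSh.of k).obj (Sm.C1 F),
    s ≫ (HoPSh.of k).map (Sm.evalZero F) = 𝟙 _ ∧
    ∃ (a : (HoPSh.of k).obj F ⟶ (HoPSh.of k).obj (⊤_ _))
      (b : (HoPSh.of k).obj (⊤_ _) ⟶ (HoPSh.of k).obj F),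
      s ≫ (HoPSh.of k).map (Sm.evalOne F) = a ≫ b

end Flf

end FlfCor

end

set_option linter.unusedVariables false

noncomputable section

/-! ### Directed unions of simplicial sets, and their preservation by `Ex` and `Ex^∞` -/

namespace SSet

/-! A span from `Y` to `𝔾_m` is a finite locally free `Z` over `Y` with a unit `x` on `Z`. On `Z ×
𝔸¹` the function `(1 - t) x + t` joins `x` at `t = 0` to `1` at `t = 1`. It need not be a unit
everywhere, but it is one at both ends, and since `Z ⟶ Y` is finite, the image in `Y × 𝔸¹` of its
zero locus is closed. The complement of this image is a neighbourhood `U` of `Y × {0, 1}` over which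
the deformed function is again a unit (`FlfSpan.exists_isDeformableOn`). The formula applies to all
factors of `𝔾_m^{∧ n}` at once and leaves the left leg unchanged.

The group completion is the loop space of a bar construction `B`. A simplex of `B(Y)` is a chain of
finitely many spans, so one `U` serves for all of them, and `B(Y)` is the directed union over `U` of
the subspaces on which the deformation over `U` is defined. Simplices of `Ex` and of the loop space
are maps out of finite simplicial sets, so the loops of `B(Y)` are the directed union of the loops
of these subspaces. The deformations therefore glue to a strict map `s` from the loops to `Ĉ₁` of
the loops (`RationalDeformation.sectionMap`), with `i₀^* s` equal to the identity.

At `t = 1` the deformation collapses `𝔾_m` to its point `1` and fixes the whisker (`deformMap_one`).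
Sliding along the whisker is a homotopy from this map to one that sends every whiskered factor to
its base point (`contractHomotopy`). As `n > 0`, all spans then have empty support. Such a span is
uniquely isomorphic to the empty span, which gives a second homotopy, to the constant map
(`collapseHomotopy`). Both homotopies are pointed, so they pass to loop spaces and become equalities
in the homotopy category (`PointedHomotopy.map_loopSpace_eq`); hence `i₁^* s` factors through the
terminal presheaf there. -/

/-- A family of monomorphisms `T j ⟶ X` that exhibits `X` as a directed union. -/
structure IsDirectedUnion {J : Type*} {X : SSet.{w}} {T : J → SSet.{w}} (f : ∀ j, T j ⟶ X) :
    Prop where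
  nonempty : Nonempty J
  mono (j : J) : Mono (f j)
  directed (i j : J) : ∃ (l : J) (a : T i ⟶ T l) (b : T j ⟶ T l), a ≫ f l = f i ∧ b ≫ f l = f j
  exists_eq (n : SimplexCategoryᵒᵖ) (x : X.obj n) : ∃ (j : J) (y : (T j).obj n), (f j).app n y = x

namespace IsDirectedUnion

variable {J : Type*} {X : SSet.{w}} {T : J → SSet.{w}} {f : ∀ j, T j ⟶ X}

/-- Each simplex lies in some member, and finitely many members have an upper bound for the relation
that one inclusion factors through another. -/
lemma exists_forall (h : IsDirectedUnion f) {I : Type*} [Finite I] (n : I → SimplexCategoryᵒᵖ)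
    (x : ∀ i, X.obj (n i)) : ∃ j, ∀ i, ∃ y, (f j).app (n i) y = x i := by
  classical
  have := h.nonempty
  choose j y hy using fun i => h.exists_eq (n i) (x i)
  let r : J → J → Prop := fun i l => ∃ a : T i ⟶ T l, a ≫ f l = f i
  have hr : IsTrans J r := ⟨fun _ _ _ ⟨a, ha⟩ ⟨b, hb⟩ => ⟨a ≫ b, by rw [Category.assoc, hb, ha]⟩⟩
  have hd : IsDirected J r := ⟨fun i l =>
    let ⟨m, a, b, ha, hb⟩ := h.directed i l
    ⟨m, ⟨a, ha⟩, ⟨b, hb⟩⟩⟩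
  have := Fintype.ofFinite I
  obtain ⟨l, hl⟩ := Directed.finset_le (r := r) (f := id)
    (fun i j => let ⟨m, a, b⟩ := hd.directed i j; ⟨m, a, b⟩) (Finset.univ.image j)
  refine ⟨l, fun i => ?_⟩
  obtain ⟨a, ha⟩ := hl (j i) (by simp)
  refine ⟨a.app _ (y i), ?_⟩
  have := ConcreteCategory.congr_hom (congr_app ha (n i)) (y i)
  exact this.trans (hy i)

/-- A map out of a finite simplicial set is determined by its values on the finitely many
nondegenerate simplices, so its range lies in one member. This compactness is what makes `Ex`,
`Ex^∞` and loops compatible with directed unions. -/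
lemma exists_lift (h : IsDirectedUnion f) {K : SSet.{w}} [K.Finite] (g : K ⟶ X) :
    ∃ (j : J) (g' : K ⟶ T j), g' ≫ f j = g := by
  obtain ⟨j, hj⟩ := h.exists_forall (fun x : K.N => op ⦋x.dim⦌) (fun x => g.app _ x.simplex)
  have := h.mono j
  have hg : Subcomplex.range g ≤ Subcomplex.range (f j) := by
    intro n y
    obtain ⟨n⟩ := n
    induction n using SimplexCategory.rec with | _ n
    rintro ⟨x, rfl⟩
    obtain ⟨m, φ, _, z, rfl⟩ := K.exists_nonDegenerate x
    obtain ⟨y, hy⟩ := hj (N.mk z.1 z.2)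
    refine ⟨(T j).map φ.op y, ?_⟩
    have h1 := ConcreteCategory.congr_hom ((f j).naturality φ.op) y
    have h2 := ConcreteCategory.congr_hom (g.naturality φ.op) z.1
    refine h1.trans (Eq.trans ?_ h2.symm)
    exact congrArg (X.map φ.op) hy
  -- A monomorphism is an isomorphism onto its range, so a map into the range lifts to `T j`.
  have hiso : IsIso (Subcomplex.toRange (f j)) := by
    have : Mono (Subcomplex.toRange (f j)) := 
      mono_of_mono_fac (Subcomplex.toRange_ι (f j))
    exact isIso_of_mono_of_epi _
  refine ⟨j, Subcomplex.lift g hg ≫ inv (Subcomplex.toRange (f j)), ?_⟩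
  rw [Category.assoc]
  have : inv (Subcomplex.toRange (f j)) ≫ f j = (Subcomplex.range (f j)).ι := by
    rw [IsIso.inv_comp_eq, Subcomplex.toRange_ι]
  rw [this, Subcomplex.lift_ι]

/-- Directedness is inherited by any functor, so for `Ex` and `Ex^∞` only injectivity and exhaustion
remain to be checked. -/
lemma ofMap (h : IsDirectedUnion f) (G : SSet.{w} ⥤ SSet.{w}) (hG : ∀ j, Mono (G.map (f j)))
    (hG' : ∀ (n : SimplexCategoryᵒᵖ) (x : (G.obj X).obj n),
      ∃ (j : J) (y : (G.obj (T j)).obj n), (G.map (f j)).app n y = x) :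
    IsDirectedUnion fun j => G.map (f j) where
  nonempty := h.nonempty
  mono := hG
  directed i j := by
    obtain ⟨l, a, b, ha, hb⟩ := h.directed i j
    exact ⟨l, G.map a, G.map b, by rw [← G.map_comp, ha], by rw [← G.map_comp, hb]⟩
  exists_eq := hG'

end IsDirectedUnion

/-- Nondegenerate simplices are injective chains, which bounds the dimension by the cardinality of
`P`; in each degree a simplex is determined by its vertices. -/
lemma finite_nerve (P : Type w) [PartialOrder P] [Finite P] : (nerve P).Finite := by
  have := Fintype.ofFinite P
  have hdim : (nerve P).HasDimensionLT (Fintype.card P) := ⟨fun n hn => by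
    ext s
    simp only [mem_degenerate_iff_notMem_nonDegenerate, Set.top_eq_univ, Set.mem_univ, iff_true,
      PartialOrder.mem_nerve_nonDegenerate_iff_injective]
    intro hs
    have := Fintype.card_le_of_injective _ hs
    simp at this
    omega⟩
  refine finite_of_hasDimensionLT _ (Fintype.card P) fun i _ => ?_
  have : Finite ((nerve P) _⦋i⦌) := by
    refine Finite.of_injective (β := Fin (i + 1) → P) (fun s => s.obj) fun s t hst => ?_
    exact CategoryTheory.Functor.ext (fun j => congrFun hst j) (fun _ _ _ => Subsingleton.elim _ _)
  infer_instance

instance (n : SimplexCategory) : (SimplexCategory.sd.{w}.obj n).Finite := by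
  have : Finite (PartialOrder.NonemptyFiniteChains (ULift.{w} (Fin (n.len + 1)))) :=
    Finite.of_injective (fun s => s.finset) fun s t h => by
      cases s; cases t; simp at h; subst h; rfl
  exact finite_nerve (PartialOrder.NonemptyFiniteChains (ULift.{w} (Fin (n.len + 1))))

namespace IsDirectedUnion

variable {J : Type*} {X : SSet.{w}} {T : J → SSet.{w}} {f : ∀ j, T j ⟶ X}

/-- An `n`-simplex of `Ex X` is a map `sd Δ[n] ⟶ X` out of a finite simplicial set, so it factors
through one member. -/
lemma ex (h : IsDirectedUnion f) : IsDirectedUnion fun j => SSet.ex.map (f j) := by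
  refine h.ofMap SSet.ex (fun j => ?_) fun n x => ?_
  · have := h.mono j
    infer_instance
  · obtain ⟨j, g, hg⟩ := h.exists_lift (K := SimplexCategory.sd.obj n.unop) x.down
    exact ⟨j, ULift.up g, ULift.ext _ _ hg⟩

lemma exIter (h : IsDirectedUnion f) (i : ℕ) :
    IsDirectedUnion fun j => (SSet.exIter i).map (f j) := by
  induction i with
  | zero => exact h
  | succ i ih => exact ih.ex

end IsDirectedUnion

/-- The natural map `Ex^i X ⟶ Ex^∞ X`. -/
def exIterι (i : ℕ) : exIter.{w} i ⟶ exInf :=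
  colimit.ι (Functor.ofSequence (X := exIter.{w}) fun i => (exIter i).whiskerLeft toEx) i

/-- The simplices of `Ex^∞ X` are the colimit of the simplices of `Ex^i X`. -/
def isColimitExInf (X : SSet.{w}) (n : SimplexCategoryᵒᵖ) :
    IsColimit (((evaluation _ _).obj X ⋙ (evaluation _ _).obj n).mapCocone
      (colimit.cocone (Functor.ofSequence (X := exIter.{w})
        fun i => (exIter i).whiskerLeft toEx))) :=
  isColimitOfPreserves _ (colimit.isColimit _)

lemma exInf_exists_rep {X : SSet.{w}} {n : SimplexCategoryᵒᵖ} (x : (exInf.obj X).obj n) :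
    ∃ (i : ℕ) (y : ((exIter i).obj X).obj n), ((exIterι i).app X).app n y = x :=
  Types.jointly_surjective_of_isColimit (isColimitExInf X n) x

/-- The transition map `Ex^i X ⟶ Ex^j X`. -/
def exIterMap {i j : ℕ} (h : i ≤ j) : exIter.{w} i ⟶ exIter j :=
  (Functor.ofSequence (X := exIter.{w}) fun i => (exIter i).whiskerLeft toEx).map (homOfLE h)

lemma exInf_rep_eq_iff {X : SSet.{w}} {n : SimplexCategoryᵒᵖ} {i j : ℕ}
    (x : ((exIter i).obj X).obj n) (y : ((exIter j).obj X).obj n) :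
    ((exIterι i).app X).app n x = ((exIterι j).app X).app n y ↔
      ∃ (l : ℕ) (hi : i ≤ l) (hj : j ≤ l),
        ((exIterMap hi).app X).app n x = ((exIterMap hj).app X).app n y := by
  refine (Types.FilteredColimit.isColimit_eq_iff _ (isColimitExInf X n)).trans ?_
  constructor
  · rintro ⟨l, a, b, h⟩
    exact ⟨l, a.le, b.le, h⟩
  · rintro ⟨l, a, b, h⟩
    exact ⟨l, homOfLE a, homOfLE b, h⟩

lemma exIterMap_succ (i : ℕ) :
    exIterMap (Nat.le_succ i) = (exIter.{w} i).whiskerLeft toEx :=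
  Functor.ofSequence_map_homOfLE_succ _ i

instance mono_exIter_map (i : ℕ) {X Y : SSet.{w}} (f : X ⟶ Y) [Mono f] :
    Mono ((exIter i).map f) := by
  induction i with
  | zero => assumption
  | succ i ih => exact inferInstanceAs (Mono (ex.map ((exIter i).map f)))

lemma natTrans_apply {G H : SSet.{w} ⥤ SSet.{w}} (τ : G ⟶ H) {X Y : SSet.{w}} (f : X ⟶ Y)
    {n : SimplexCategoryᵒᵖ} (x : (G.obj X).obj n) :
    (H.map f).app n ((τ.app X).app n x) = (τ.app Y).app n ((G.map f).app n x) :=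
  (ConcreteCategory.congr_hom (congr_app (τ.naturality f) n) x).symm

/-- Equality in `Ex^∞ Y` is equality at some finite stage `l`, where `Ex^l f` is injective. -/
instance mono_exInf_map {X Y : SSet.{w}} (f : X ⟶ Y) [Mono f] : Mono (exInf.map f) := by
  rw [NatTrans.mono_iff_mono_app]
  intro n
  rw [mono_iff_injective]
  intro x y hxy
  obtain ⟨i, x, rfl⟩ := exInf_exists_rep x
  obtain ⟨j, y, rfl⟩ := exInf_exists_rep y
  rw [natTrans_apply, natTrans_apply, exInf_rep_eq_iff] at hxy
  obtain ⟨l, hi, hj, h⟩ := hxy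
  rw [exInf_rep_eq_iff]
  refine ⟨l, hi, hj, ?_⟩
  rw [← natTrans_apply, ← natTrans_apply] at h
  have : Mono (((exIter l).map f).app n) := inferInstance
  exact (mono_iff_injective _).1 this h

lemma IsDirectedUnion.exInf {J : Type*} {X : SSet.{w}} {T : J → SSet.{w}} {f : ∀ j, T j ⟶ X}
    (h : IsDirectedUnion f) : IsDirectedUnion fun j => SSet.exInf.map (f j) := by
  refine h.ofMap SSet.exInf (fun j => ?_) fun n x => ?_
  · have := h.mono j
    infer_instance
  · obtain ⟨i, x, rfl⟩ := exInf_exists_rep x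
    obtain ⟨j, y, rfl⟩ := (h.exIter i).exists_eq n x
    exact ⟨j, ((exIterι i).app _).app n y, natTrans_apply _ _ _⟩

end SSet

/-! ### Loops in a directed union -/

namespace PSSet

lemma loopSpace_map_injective {X Y : PSSet.{w}} (f : X ⟶ Y) [Mono (forget.map f)]
    (m : SimplexCategoryᵒᵖ) : Function.Injective ((loopSpace.map f).app m) := by
  intro γ γ' h
  have h' : γ.1 ≫ SSet.exInf.map (forget.map f) = γ'.1 ≫ SSet.exInf.map (forget.map f) :=
    congrArg Subtype.val h
  exact Subtype.ext ((cancel_mono _).1 h')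

/-- A simplex of the loop space is a map out of the finite simplicial set `Δ[m] ⊗ Δ[1]`, so it
factors through one member; the boundary conditions descend because the inclusion is a monomorphism.
-/
lemma loopSpace_exists_eq {J : Type*} {X : PSSet.{w}} {T : J → PSSet.{w}} {f : ∀ j, T j ⟶ X}
    (h : SSet.IsDirectedUnion fun j => forget.map (f j)) (m : SimplexCategoryᵒᵖ)
    (γ : (loopSpace.obj X).obj m) :
    ∃ (j : J) (γ' : (loopSpace.obj (T j)).obj m), (loopSpace.map (f j)).app m γ' = γ := by
  obtain ⟨j, γ', hγ'⟩ := h.exInf.exists_lift (K := SSet.stdSimplex.obj m.unop ⊗ Δ[1]) γ.1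
  have := h.mono j
  refine ⟨j, ⟨γ', ?_, ?_⟩, Subtype.ext hγ'⟩
  · rw [← cancel_mono (SSet.exInf.map (forget.map (f j))), Category.assoc, hγ', γ.2.1,
      exBasept_comp]
  · rw [← cancel_mono (SSet.exInf.map (forget.map (f j))), Category.assoc, hγ', γ.2.2,
      exBasept_comp]

end PSSet

/-! ### Extending homotopies through `Ex^∞` -/

namespace SSet

lemma app_congr {X Y : SSet.{w}} {f g : X ⟶ Y} (h : f = g) {n : SimplexCategoryᵒᵖ}
    (x : X.obj n) : f.app n x = g.app n x := by rw [h]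

lemma app_map {X Y : SSet.{w}} (f : X ⟶ Y) {n m : SimplexCategoryᵒᵖ} (φ : n ⟶ m)
    (x : X.obj n) : f.app m (X.map φ x) = Y.map φ (f.app n x) :=
  ConcreteCategory.congr_hom (f.naturality φ) x

/-- The simplex of `X ⊗ Δ[1]` with given components. -/
abbrev pair {X : SSet.{w}} {n : SimplexCategoryᵒᵖ} (x : X.obj n) (τ : Δ[1].obj n) :
    (X ⊗ Δ[1]).obj n := (x, τ)

/-- The map `Ex X ⊗ Δ[1] ⟶ Ex (X ⊗ Δ[1])` given by the last vertex map. -/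
def exTensor (X : SSet.{w}) : ex.obj X ⊗ Δ[1] ⟶ ex.obj (X ⊗ Δ[1]) where
  app n := ↾fun x => ULift.up (CartesianMonoidalCategory.lift x.1.down
    ((toEx.app Δ[1]).app n x.2).down)
  naturality n m f := by
    ext x
    apply ULift.ext
    have h := ConcreteCategory.congr_hom ((toEx.app Δ[1]).naturality f) x.2
    have h' : ((toEx.app Δ[1]).app m (Δ[1].map f x.2)).down =
        SimplexCategory.sd.map f.unop ≫ ((toEx.app Δ[1]).app n x.2).down := congrArg ULift.down h
    change CartesianMonoidalCategory.lift (SimplexCategory.sd.map f.unop ≫ x.1.down)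
      ((toEx.app Δ[1]).app m (Δ[1].map f x.2)).down = SimplexCategory.sd.map f.unop ≫
        CartesianMonoidalCategory.lift x.1.down ((toEx.app Δ[1]).app n x.2).down
    rw [h', CartesianMonoidalCategory.comp_lift]

lemma exTensor_naturality {X Y : SSet.{w}} (f : X ⟶ Y) :
    ex.map f ▷ Δ[1] ≫ exTensor Y = exTensor X ≫ ex.map (f ▷ Δ[1]) := by
  ext n x
  apply ULift.ext
  change CartesianMonoidalCategory.lift (x.1.down ≫ f) _ =
    CartesianMonoidalCategory.lift x.1.down _ ≫ f ▷ Δ[1]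
  rw [CartesianMonoidalCategory.lift_whiskerRight]
  rfl

lemma toEx_tensor (X : SSet.{w}) : toEx.app X ▷ Δ[1] ≫ exTensor X = toEx.app (X ⊗ Δ[1]) := by
  ext n x
  apply ULift.ext
  rfl

lemma ι₀_exTensor (X : SSet.{w}) : ι₀ ≫ exTensor X = ex.map ι₀ := by
  ext n x
  apply ULift.ext
  change CartesianMonoidalCategory.lift x.down _ = x.down ≫ ι₀
  ext m y
  rfl
  rfl

lemma ι₁_exTensor (X : SSet.{w}) : ι₁ ≫ exTensor X = ex.map ι₁ := by
  ext n x
  apply ULift.ext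
  change CartesianMonoidalCategory.lift x.down _ = x.down ≫ ι₁
  ext m y
  rfl
  rfl

/-- The map `Ex^i X ⊗ Δ[1] ⟶ Ex^i (X ⊗ Δ[1])`. -/
def exIterTensor (i : ℕ) (X : SSet.{w}) :
    (exIter i).obj X ⊗ Δ[1] ⟶ (exIter i).obj (X ⊗ Δ[1]) :=
  Nat.rec (motive := fun i => (exIter i).obj X ⊗ Δ[1] ⟶ (exIter i).obj (X ⊗ Δ[1])) (𝟙 _)
    (fun i θ => exTensor ((exIter i).obj X) ≫ ex.map θ) i

lemma exIterTensor_succ (i : ℕ) (X : SSet.{w}) :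
    exIterTensor (i + 1) X = exTensor ((exIter i).obj X) ≫ ex.map (exIterTensor i X) := rfl

lemma exIter_succ_map (i : ℕ) {X Y : SSet.{w}} (f : X ⟶ Y) :
    (exIter (i + 1)).map f = ex.map ((exIter i).map f) := rfl

lemma toEx_exIterTensor (i : ℕ) (X : SSet.{w}) :
    (exIterMap (Nat.le_succ i)).app X ▷ Δ[1] ≫ exIterTensor (i + 1) X =
      exIterTensor i X ≫ (exIterMap (Nat.le_succ i)).app (X ⊗ Δ[1]) := by
  have h (X : SSet.{w}) : (exIterMap (Nat.le_succ i)).app X = toEx.app ((exIter i).obj X) := by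
    rw [exIterMap_succ]
    rfl
  rw [h, h, exIterTensor_succ]
  have h₁ := toEx_tensor ((exIter i).obj X)
  have h₂ := toEx.naturality (exIterTensor i X)
  exact ((Category.assoc _ _ _).symm.trans (congrArg (· ≫ ex.map (exIterTensor i X)) h₁)).trans
    h₂.symm

lemma exIterMap_trans {i j l : ℕ} (h : i ≤ j) (h' : j ≤ l) :
    exIterMap.{w} (h.trans h') = exIterMap h ≫ exIterMap h' :=
  (Functor.ofSequence (X := exIter.{w}) fun i => (exIter i).whiskerLeft toEx).map_comp
    (homOfLE h) (homOfLE h')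

lemma exIterMap_refl (i : ℕ) : exIterMap.{w} (le_refl i) = 𝟙 _ :=
  (Functor.ofSequence (X := exIter.{w}) fun i => (exIter i).whiskerLeft toEx).map_id i

/-- Compatibility with the transition maps, needed for the maps `exIterTensor i X` to induce one on
the colimit. -/
lemma exIterMap_exIterTensor {i j : ℕ} (h : i ≤ j) (X : SSet.{w}) :
    (exIterMap h).app X ▷ Δ[1] ≫ exIterTensor j X =
      exIterTensor i X ≫ (exIterMap h).app (X ⊗ Δ[1]) := by
  induction j, h using Nat.le_induction with
  | base => simp [exIterMap_refl]
  | succ j h ih =>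
    rw [exIterMap_trans h (Nat.le_succ j), NatTrans.comp_app, NatTrans.comp_app, comp_whiskerRight,
      Category.assoc, toEx_exIterTensor, reassoc_of% ih]

lemma exIterTensor_naturality (i : ℕ) {X Y : SSet.{w}} (f : X ⟶ Y) :
    (exIter i).map f ▷ Δ[1] ≫ exIterTensor i Y = exIterTensor i X ≫ (exIter i).map (f ▷ Δ[1]) := by
  induction i with
  | zero => rfl
  | succ i ih =>
    have h₁ := exTensor_naturality ((exIter i).map f)
    calc _ = ex.map ((exIter i).map f) ▷ Δ[1] ≫ exTensor _ ≫ ex.map (exIterTensor i Y) := rfl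
      _ = exTensor _ ≫ ex.map ((exIter i).map f ▷ Δ[1] ≫ exIterTensor i Y) := by
        rw [reassoc_of% h₁, Functor.map_comp]
      _ = exTensor _ ≫ ex.map (exIterTensor i X) ≫ ex.map ((exIter i).map (f ▷ Δ[1])) := by
        rw [ih, Functor.map_comp]
      _ = _ := (Category.assoc _ _ _).symm

lemma ι₀_exIterTensor (i : ℕ) (X : SSet.{w}) : ι₀ ≫ exIterTensor i X = (exIter i).map ι₀ := by
  induction i with
  | zero => rfl
  | succ i ih =>
    rw [exIterTensor_succ, exIter_succ_map, ← ih, Functor.map_comp, ← ι₀_exTensor, Category.assoc]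
    rfl

lemma ι₁_exIterTensor (i : ℕ) (X : SSet.{w}) : ι₁ ≫ exIterTensor i X = (exIter i).map ι₁ := by
  induction i with
  | zero => rfl
  | succ i ih =>
    rw [exIterTensor_succ, exIter_succ_map, ← ih, Functor.map_comp, ← ι₁_exTensor, Category.assoc]
    rfl

/-- A simplex of `Ex^∞ X` is represented at a finite stage, and two representatives agree at a later
one. As `exIterTensor` commutes with the transition maps, the resulting value depends only on the
simplex. -/
lemma exists_exInfTensor (X : SSet.{w}) : ∃ θ : exInf.obj X ⊗ Δ[1] ⟶ exInf.obj (X ⊗ Δ[1]),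
    ∀ i, (exIterι i).app X ▷ Δ[1] ≫ θ = exIterTensor i X ≫ (exIterι i).app (X ⊗ Δ[1]) := by
  have key (n : SimplexCategoryᵒᵖ) (z : (exInf.obj X ⊗ Δ[1]).obj n) :
      ∃ y : (exInf.obj (X ⊗ Δ[1])).obj n, ∀ (i : ℕ) (x : ((exIter i).obj X).obj n),
        ((exIterι i).app X).app n x = z.1 →
          ((exIterι i).app (X ⊗ Δ[1])).app n ((exIterTensor i X).app n (pair x z.2)) = y := by
    obtain ⟨i, x, hx⟩ := exInf_exists_rep z.1
    refine ⟨_, fun j y hy => (?_ : _ = ((exIterι i).app (X ⊗ Δ[1])).app n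
      ((exIterTensor i X).app n (pair x z.2)))⟩
    obtain ⟨l, hj, hi, h⟩ := (exInf_rep_eq_iff _ _).1 (hy.trans hx.symm)
    refine (exInf_rep_eq_iff _ _).2 ⟨l, hj, hi, ?_⟩
    have e (i : ℕ) (hi : i ≤ l) (x : ((exIter i).obj X).obj n) :
        ((exIterMap hi).app (X ⊗ Δ[1])).app n ((exIterTensor i X).app n (pair x z.2)) =
          (exIterTensor l X).app n (pair (((exIterMap hi).app X).app n x) z.2) :=
      (app_congr (exIterMap_exIterTensor hi X) (pair x z.2)).symm
    rw [e, e, h]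
  choose θ hθ using key
  refine ⟨{ app n := ↾(θ n), naturality n m f := ?_ }, fun i => ?_⟩
  · ext z
    obtain ⟨i, x, hx⟩ := exInf_exists_rep z.1
    have h₁ := hθ n z i x hx
    have h₂ := hθ m ((exInf.obj X ⊗ Δ[1]).map f z) i (((exIter i).obj X).map f x) (by
      have := ConcreteCategory.congr_hom (((exIterι i).app X).naturality f) x
      exact this.trans (congrArg ((exInf.obj X).map f) hx))
    exact h₂.symm.trans ((app_map (exIterTensor i X ≫ (exIterι i).app (X ⊗ Δ[1])) f
      (pair x z.2)).trans (congrArg ((exInf.obj (X ⊗ Δ[1])).map f) h₁))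
  · ext n z
    exact (hθ n (((exIterι i).app X).app n z.1, z.2) i z.1 rfl).symm

/-- The natural map `Ex^∞ X ⊗ Δ[1] ⟶ Ex^∞ (X ⊗ Δ[1])`. -/
def exInfTensor (X : SSet.{w}) : exInf.obj X ⊗ Δ[1] ⟶ exInf.obj (X ⊗ Δ[1]) :=
  (exists_exInfTensor X).choose

lemma exIterι_exInfTensor (i : ℕ) (X : SSet.{w}) :
    (exIterι i).app X ▷ Δ[1] ≫ exInfTensor X = exIterTensor i X ≫ (exIterι i).app (X ⊗ Δ[1]) :=
  (exists_exInfTensor X).choose_spec i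

lemma exInf_tensor_hom_ext {X Z : SSet.{w}} {a b : exInf.obj X ⊗ Δ[1] ⟶ Z}
    (h : ∀ i, (exIterι i).app X ▷ Δ[1] ≫ a = (exIterι i).app X ▷ Δ[1] ≫ b) : a = b := by
  ext n z
  obtain ⟨i, x, hx⟩ := exInf_exists_rep z.1
  have := app_congr (h i) (pair x z.2)
  obtain ⟨z₁, z₂⟩ := z
  dsimp only at hx
  subst hx
  exact this

lemma exInf_hom_ext {X Z : SSet.{w}} {a b : exInf.obj X ⟶ Z}
    (h : ∀ i, (exIterι i).app X ≫ a = (exIterι i).app X ≫ b) : a = b := by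
  ext n z
  obtain ⟨i, x, rfl⟩ := exInf_exists_rep z
  exact app_congr (h i) x

lemma exInfTensor_naturality {X Y : SSet.{w}} (f : X ⟶ Y) :
    exInf.map f ▷ Δ[1] ≫ exInfTensor Y = exInfTensor X ≫ exInf.map (f ▷ Δ[1]) := by
  refine exInf_tensor_hom_ext fun i => ?_
  rw [← comp_whiskerRight_assoc, ← (exIterι i).naturality, comp_whiskerRight_assoc,
    exIterι_exInfTensor, ← Category.assoc, exIterTensor_naturality, ← Category.assoc,
    exIterι_exInfTensor, Category.assoc, Category.assoc, (exIterι i).naturality]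

lemma ι₀_exInfTensor (X : SSet.{w}) : ι₀ ≫ exInfTensor X = exInf.map ι₀ := by
  refine exInf_hom_ext fun i => ?_
  rw [← Category.assoc, ← ι₀_comp, Category.assoc, exIterι_exInfTensor, ← Category.assoc,
    ι₀_exIterTensor, (exIterι i).naturality]

lemma ι₁_exInfTensor (X : SSet.{w}) : ι₁ ≫ exInfTensor X = exInf.map ι₁ := by
  refine exInf_hom_ext fun i => ?_
  rw [← Category.assoc, ← ι₁_comp, Category.assoc, exIterι_exInfTensor, ← Category.assoc,
    ι₁_exIterTensor, (exIterι i).naturality]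

/-- This is stage `0` of the tower, where `exIterTensor` is the identity. It controls constant
loops, whose base point comes from the given simplicial set. -/
lemma toExInf_tensor (X : SSet.{w}) :
    toExInf.app X ▷ Δ[1] ≫ exInfTensor X = toExInf.app (X ⊗ Δ[1]) :=
  (exIterι_exInfTensor 0 X).trans (Category.id_comp _)

end SSet

/-! ### Homotopies of loop spaces induced by pointed homotopies -/

namespace PSSet

open CartesianMonoidalCategory

/-- A homotopy `X ⊗ Δ[1] ⟶ Y` that is constant on the base point. -/
def IsPointedHomotopy {X Y : PSSet.{w}} (h : forget.obj X ⊗ Δ[1] ⟶ forget.obj Y) : Prop :=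
  ∀ (m : SimplexCategoryᵒᵖ) (τ : Δ[1].obj m),
    h.app m (SSet.pair (X := forget.obj X) (X.obj m).point τ) = (Y.obj m).point

lemma IsPointedHomotopy.lift_basept {X Y : PSSet.{w}}
    {h : forget.obj X ⊗ Δ[1] ⟶ forget.obj Y} (hh : IsPointedHomotopy h) {T : SSet.{w}}
    (τ : T ⟶ Δ[1]) : lift (basept X T) τ ≫ h = basept Y T := by
  ext m x
  exact hh m (τ.app m x)

/-- The homotopy of loops induced by a homotopy. -/
def loopHomotopyApp {X Y : PSSet.{w}} (h : forget.obj X ⊗ Δ[1] ⟶ forget.obj Y) {T : SSet.{w}}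
    (γ : T ⊗ Δ[1] ⟶ SSet.exInf.obj (forget.obj X)) (τ : T ⟶ Δ[1]) :
    T ⊗ Δ[1] ⟶ SSet.exInf.obj (forget.obj Y) :=
  lift γ (fst T Δ[1] ≫ τ) ≫ SSet.exInfTensor _ ≫ SSet.exInf.map h

/-- The base point of `Ex^∞ X` comes from `X` along `toExInf`, so the induced homotopy on it is
computed by `h` itself, which preserves base points. This is why loops remain loops during the
homotopy. -/
lemma lift_exBasept {X Y : PSSet.{w}} {h : forget.obj X ⊗ Δ[1] ⟶ forget.obj Y}
    (hh : IsPointedHomotopy h) {T : SSet.{w}} (τ : T ⟶ Δ[1]) :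
    lift (exBasept X T) τ ≫ SSet.exInfTensor _ ≫ SSet.exInf.map h = exBasept Y T := by
  have h₁ : lift (exBasept X T) τ = lift (basept X T) τ ≫ SSet.toExInf.app _ ▷ Δ[1] :=
    (lift_whiskerRight _ _ _).symm
  have h₂ := SSet.toExInf_tensor (forget.obj X)
  have h₃ : SSet.toExInf.app (forget.obj X ⊗ Δ[1]) ≫ SSet.exInf.map h =
    h ≫ SSet.toExInf.app _ := (SSet.toExInf.naturality h).symm
  have h₄ := hh.lift_basept τ
  refine (congrArg (· ≫ SSet.exInfTensor _ ≫ SSet.exInf.map h) h₁).trans ?_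
  refine (Category.assoc _ _ _).trans ?_
  refine (congrArg (lift (basept X T) τ ≫ ·)
    ((Category.assoc _ _ _).symm.trans (congrArg (· ≫ SSet.exInf.map h) h₂))).trans ?_
  exact (congrArg (lift (basept X T) τ ≫ ·) h₃).trans
    ((Category.assoc _ _ _).symm.trans (congrArg (· ≫ SSet.toExInf.app (forget.obj Y)) h₄))

lemma loopHomotopyApp_isLoop {X Y : PSSet.{w}} {h : forget.obj X ⊗ Δ[1] ⟶ forget.obj Y}
    (hh : IsPointedHomotopy h) {T : SSet.{w}} {γ : T ⊗ Δ[1] ⟶ SSet.exInf.obj (forget.obj X)}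
    (hγ : X.IsLoop γ) (τ : T ⟶ Δ[1]) : Y.IsLoop (loopHomotopyApp h γ τ) := by
  constructor
  · rw [loopHomotopyApp, comp_lift_assoc, hγ.1, ← Category.assoc SSet.ι₀, SSet.ι₀_fst,
      Category.id_comp, lift_exBasept hh]
  · rw [loopHomotopyApp, comp_lift_assoc, hγ.2, ← Category.assoc SSet.ι₁, SSet.ι₁_fst,
      Category.id_comp, lift_exBasept hh]

lemma loopHomotopyApp_precomp {X Y : PSSet.{w}} (h : forget.obj X ⊗ Δ[1] ⟶ forget.obj Y)
    {T T' : SSet.{w}} (γ : T ⊗ Δ[1] ⟶ SSet.exInf.obj (forget.obj X)) (τ : T ⟶ Δ[1]) (f : T' ⟶ T) :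
    f ▷ Δ[1] ≫ loopHomotopyApp h γ τ = loopHomotopyApp h (f ▷ Δ[1] ≫ γ) (f ≫ τ) := by
  rw [loopHomotopyApp, loopHomotopyApp, comp_lift_assoc, whiskerRight_fst_assoc]

lemma yonedaEquiv_symm_map {X : SSet.{w}} {n m : SimplexCategoryᵒᵖ} (f : n ⟶ m) (x : X.obj n) :
    SSet.stdSimplex.map f.unop ≫ SSet.yonedaEquiv.symm x = SSet.yonedaEquiv.symm (X.map f x) :=
  SSet.yonedaEquiv_symm_naturality_left (X := X) f.unop x

/-- The homotopy of loop spaces induced by a pointed homotopy. -/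
def loopHomotopy {X Y : PSSet.{w}} (h : forget.obj X ⊗ Δ[1] ⟶ forget.obj Y)
    (hh : IsPointedHomotopy h) : loopSpace.obj X ⊗ Δ[1] ⟶ loopSpace.obj Y where
  app m := ↾fun z => ⟨loopHomotopyApp h z.1.1 (SSet.yonedaEquiv.symm z.2),
    loopHomotopyApp_isLoop hh z.1.2 _⟩
  naturality n m f := by
    refine ConcreteCategory.hom_ext _ _ fun z => Subtype.ext ?_
    change loopHomotopyApp h (SSet.stdSimplex.map f.unop ▷ Δ[1] ≫ z.1.1)
      (SSet.yonedaEquiv.symm (Δ[1].map f z.2)) =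
        SSet.stdSimplex.map f.unop ▷ Δ[1] ≫ loopHomotopyApp h z.1.1 (SSet.yonedaEquiv.symm z.2)
    rw [loopHomotopyApp_precomp, yonedaEquiv_symm_map]

lemma ι₀_loopHomotopy {X Y : PSSet.{w}} (h : forget.obj X ⊗ Δ[1] ⟶ forget.obj Y)
    (hh : IsPointedHomotopy h) (r : X ⟶ Y) (hr : SSet.ι₀ ≫ h = forget.map r) :
    SSet.ι₀ ≫ loopHomotopy h hh = loopSpace.map r := by
  ext m γ
  apply Subtype.ext
  change lift γ.1 _ ≫ SSet.exInfTensor _ ≫ SSet.exInf.map h = γ.1 ≫ SSet.exInf.map (forget.map r)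
  rw [← hr, Functor.map_comp, ← SSet.ι₀_exInfTensor, Category.assoc, ← Category.assoc γ.1]
  congr 1

lemma ι₁_loopHomotopy {X Y : PSSet.{w}} (h : forget.obj X ⊗ Δ[1] ⟶ forget.obj Y)
    (hh : IsPointedHomotopy h) (r : X ⟶ Y) (hr : SSet.ι₁ ≫ h = forget.map r) :
    SSet.ι₁ ≫ loopHomotopy h hh = loopSpace.map r := by
  ext m γ
  apply Subtype.ext
  change lift γ.1 _ ≫ SSet.exInfTensor _ ≫ SSet.exInf.map h = γ.1 ≫ SSet.exInf.map (forget.map r)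
  rw [← hr, Functor.map_comp, ← SSet.ι₁_exInfTensor, Category.assoc, ← Category.assoc γ.1]
  congr 1

lemma loopHomotopy_naturality {X Y X' Y' : PSSet.{w}} (h : forget.obj X ⊗ Δ[1] ⟶ forget.obj Y)
    (hh : IsPointedHomotopy h) (h' : forget.obj X' ⊗ Δ[1] ⟶ forget.obj Y')
    (hh' : IsPointedHomotopy h') (a : X ⟶ X') (b : Y ⟶ Y')
    (hab : forget.map a ▷ Δ[1] ≫ h' = h ≫ forget.map b) :
    loopSpace.map a ▷ Δ[1] ≫ loopHomotopy h' hh' = loopHomotopy h hh ≫ loopSpace.map b := by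
  ext m z
  apply Subtype.ext
  change loopHomotopyApp h' (z.1.1 ≫ SSet.exInf.map (forget.map a)) (SSet.yonedaEquiv.symm z.2) =
    loopHomotopyApp h z.1.1 (SSet.yonedaEquiv.symm z.2) ≫ SSet.exInf.map (forget.map b)
  rw [loopHomotopyApp, loopHomotopyApp, Category.assoc, Category.assoc, ← Functor.map_comp, ← hab,
    Functor.map_comp]
  have := SSet.exInfTensor_naturality (forget.map a)
  rw [← reassoc_of% this, lift_whiskerRight_assoc]

end PSSet

/-! ### Homotopic maps agree in the homotopy category -/

namespace SSet

/-- The homotopy given by a map out of `X ⊗ Δ[1]`. -/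
def Homotopy.ofMap {X Y : SSet.{w}} {f g : X ⟶ Y} (h : X ⊗ Δ[1] ⟶ Y) (h₀ : ι₀ ≫ h = f)
    (h₁ : ι₁ ≫ h = g) : Homotopy f g where
  h := h
  h₀ := h₀
  h₁ := h₁
  -- The homotopy is relative to the empty subcomplex, so the condition is vacuous.
  rel := by
    ext n x
    exact x.1.2.elim

/-- The minimum `Δ[1] ⊗ Δ[1] ⟶ Δ[1]`. -/
def minMap : Δ[1] ⊗ Δ[1] ⟶ (Δ[1] : SSet.{w}) where
  app n := ↾fun x => stdSimplex.objEquiv.symm (SimplexCategory.mkHom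
    { toFun i := min (stdSimplex.objEquiv x.1 i) (stdSimplex.objEquiv x.2 i)
      monotone' i j h := min_le_min ((stdSimplex.objEquiv x.1).toOrderHom.monotone h)
        ((stdSimplex.objEquiv x.2).toOrderHom.monotone h) })
  naturality n m f := rfl

open CartesianMonoidalCategory in
-- The end inclusion `ι₀` is a homotopy inverse: the minimum contracts `Δ[1]` onto its vertex `0`.
-- Homotopies of maps out of `X ⊗ Δ[1]` restrict along `ι₀` to homotopies of maps out of `X`.
lemma weakEq_fst (X : SSet.{w}) : weakEq (fst X Δ[1]) := by
  intro K _
  refine ⟨fun g => ⟨ι₀ ≫ g, ⟨Homotopy.ofMap ((α_ _ _ _).hom ≫ X ◁ minMap ≫ g) ?_ ?_⟩⟩,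
    fun h h' ⟨H⟩ => ⟨Homotopy.ofMap (ι₀ ▷ Δ[1] ≫ H.h) ?_ ?_⟩⟩
  · rw [← Category.assoc, ← Category.assoc, ← Category.assoc]
    congr 1
    ext n x
    · rfl
    · apply stdSimplex.objEquiv.injective
      ext i : 3
      exact min_eq_right (Fin.zero_le (stdSimplex.objEquiv (n := ⦋1⦌) x.2 i))
  · rw [← Category.assoc, ← Category.assoc]
    convert Category.id_comp g using 2
    ext n x
    · rfl
    · apply stdSimplex.objEquiv.injective
      ext i : 3
      exact min_eq_left (Fin.le_last (n := 1) (stdSimplex.objEquiv (n := ⦋1⦌) x.2 i))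
  · rw [ι₀_comp_assoc, H.h₀, ← Category.assoc]; rfl
  · rw [ι₁_comp_assoc, H.h₁, ← Category.assoc]; rfl

end SSet

namespace FlfCor

variable {k : Type u} [Field k]

/-- Homotopic maps of presheaves become equal in the homotopy category. -/
lemma HoPSh.map_eq_of_homotopy {F G : (Sm k)ᵒᵖ ⥤ SSet.{u + 1}} (f g : F ⟶ G)
    (H : ∀ Y, F.obj Y ⊗ Δ[1] ⟶ G.obj Y)
    (hH : ∀ {Y Y' : (Sm k)ᵒᵖ} (a : Y ⟶ Y'), F.map a ▷ Δ[1] ≫ H Y' = H Y ≫ G.map a)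
    (h₀ : ∀ Y, SSet.ι₀ ≫ H Y = f.app Y) (h₁ : ∀ Y, SSet.ι₁ ≫ H Y = g.app Y) :
    (HoPSh.of k).map f = (HoPSh.of k).map g := by
  let F' : (Sm k)ᵒᵖ ⥤ SSet.{u + 1} := F ⋙ tensorRight Δ[1]
  let i₀ : F ⟶ F' := { app Y := SSet.ι₀, naturality _ _ a := (SSet.ι₀_comp (F.map a)).symm }
  let i₁ : F ⟶ F' := { app Y := SSet.ι₁, naturality _ _ a := (SSet.ι₁_comp (F.map a)).symm }
  let pr : F' ⟶ F :=
    { app Y := CartesianMonoidalCategory.fst _ _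
      naturality _ _ a := CartesianMonoidalCategory.whiskerRight_fst (F.map a) Δ[1] }
  let H' : F' ⟶ G := { app Y := H Y, naturality _ _ a := hH a }
  have hpr : presheafWeakEq k pr := fun Y => SSet.weakEq_fst _
  have : IsIso ((HoPSh.of k).map pr) := Localization.inverts _ _ _ hpr
  -- Both end inclusions are sections of the projection, which is inverted, so they become equal.
  have e : (HoPSh.of k).map i₀ = (HoPSh.of k).map i₁ := by
    have e₀ : i₀ ≫ pr = 𝟙 F := by ext1; funext Y; exact SSet.ι₀_fst _
    have e₁ : i₁ ≫ pr = 𝟙 F := by ext1; funext Y; exact SSet.ι₁_fst _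
    rw [← cancel_mono ((HoPSh.of k).map pr), ← Functor.map_comp, ← Functor.map_comp, e₀, e₁]
  have hf : f = i₀ ≫ H' := by ext1; funext Y; exact (h₀ Y).symm
  have hg : g = i₁ ≫ H' := by ext1; funext Y; exact (h₁ Y).symm
  rw [hf, hg, Functor.map_comp, Functor.map_comp, e]

/-- A homotopy between maps of presheaves of pointed spaces that is constant on the base
point. -/
structure PointedHomotopy {B B' : (Sm k)ᵒᵖ ⥤ PSSet.{u + 1}} (r r' : B ⟶ B') where
  h (Y : (Sm k)ᵒᵖ) : PSSet.forget.obj (B.obj Y) ⊗ Δ[1] ⟶ PSSet.forget.obj (B'.obj Y)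
  naturality {Y Y' : (Sm k)ᵒᵖ} (a : Y ⟶ Y') :
    PSSet.forget.map (B.map a) ▷ Δ[1] ≫ h Y' = h Y ≫ PSSet.forget.map (B'.map a)
  isPointed (Y : (Sm k)ᵒᵖ) : PSSet.IsPointedHomotopy (h Y)
  h₀ (Y : (Sm k)ᵒᵖ) : SSet.ι₀ ≫ h Y = PSSet.forget.map (r.app Y)
  h₁ (Y : (Sm k)ᵒᵖ) : SSet.ι₁ ≫ h Y = PSSet.forget.map (r'.app Y)

lemma PointedHomotopy.map_loopSpace_eq {B B' : (Sm k)ᵒᵖ ⥤ PSSet.{u + 1}} {r r' : B ⟶ B'}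
    (H : PointedHomotopy r r') :
    (HoPSh.of k).map (Functor.whiskerRight r PSSet.loopSpace) =
      (HoPSh.of k).map (Functor.whiskerRight r' PSSet.loopSpace) :=
  HoPSh.map_eq_of_homotopy _ _ (fun Y => PSSet.loopHomotopy (H.h Y) (H.isPointed Y))
    (fun a => PSSet.loopHomotopy_naturality _ _ _ _ _ _ (H.naturality a))
    (fun Y => PSSet.ι₀_loopHomotopy _ _ _ (H.h₀ Y))
    (fun Y => PSSet.ι₁_loopHomotopy _ _ _ (H.h₁ Y))

end FlfCor

/-! ### From a partially defined deformation to a map into `Ĉ₁` -/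

namespace FlfCor

variable {k : Type u} [Field k]

namespace Sm.Nbhd

/-- The intersection of two neighbourhoods. -/
def inter {Y : Sm k} (U V : Nbhd Y) : Nbhd Y where
  U := U.U ⊓ V.U
  zero_mem y := ⟨U.zero_mem y, V.zero_mem y⟩
  one_mem y := ⟨U.one_mem y, V.one_mem y⟩

lemma inter_le_left {Y : Sm k} (U V : Nbhd Y) : U.inter V ≤ U := fun _ h => h.1

lemma inter_le_right {Y : Sm k} (U V : Nbhd Y) : U.inter V ≤ V := fun _ h => h.2

/-- The neighbourhood `Y × 𝔸¹`. -/
def top (Y : Sm k) : Nbhd Y where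
  U := ⊤
  zero_mem _ := trivial
  one_mem _ := trivial

end Sm.Nbhd

open Sm

/-- The structure map `F(U) ⟶ (Ĉ₁ F)(Y)`. -/
def C1in (F : (Sm k)ᵒᵖ ⥤ SSet.{u + 1}) {Y : Sm k} (U : Nbhd Y) :
    F.obj (op U.toSm) ⟶ (C1 F).obj (op Y) := C1ι F U

lemma incl_C1in (F : (Sm k)ᵒᵖ ⥤ SSet.{u + 1}) {Y : Sm k} {V U : Nbhd Y} (h : V ≤ U) :
    F.map (Nbhd.incl h).op ≫ C1in F V = C1in F U := by
  have := map_C1ι F h (𝟙 _) (Nbhd.incl h) (Category.comp_id _)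
  rw [op_id, CategoryTheory.Functor.map_id, Category.id_comp] at this
  exact this.symm

lemma C1in_map (F : (Sm k)ᵒᵖ ⥤ SSet.{u + 1}) {Y' Y : Sm k} (g : Y' ⟶ Y) (U : Nbhd Y) :
    C1in F U ≫ (C1 F).map g.op = F.map (Nbhd.preimageHom g U).op ≫ C1in F (U.preimage g) :=
  C1ι_desc _ _ _ U

lemma C1in_evalZero (F : (Sm k)ᵒᵖ ⥤ SSet.{u + 1}) {Y : Sm k} (U : Nbhd Y) :
    C1in F U ≫ (evalZero F).app (op Y) = F.map U.zeroLift.op :=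
  C1ι_desc _ _ _ U

lemma C1in_evalOne (F : (Sm k)ᵒᵖ ⥤ SSet.{u + 1}) {Y : Sm k} (U : Nbhd Y) :
    C1in F U ≫ (evalOne F).app (op Y) = F.map U.oneLift.op :=
  C1ι_desc _ _ _ U

/-- A partially defined deformation of a presheaf of pointed spaces `B` to a self-map `r`: the
spaces `B(Y)` are directed unions of subspaces `T Y U` on which a deformation
`T Y U ⟶ B(U)` is defined, for `Y × {0, 1} ⊆ U ⊆ Y × 𝔸¹`. -/
structure RationalDeformation (B : (Sm k)ᵒᵖ ⥤ PSSet.{u + 1}) (r : B ⟶ B) where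
  T (Y : Sm k) (U : Nbhd Y) : PSSet.{u + 1}
  i {Y : Sm k} (U : Nbhd Y) : T Y U ⟶ B.obj (op Y)
  mono_i {Y : Sm k} (U : Nbhd Y) : Mono (PSSet.forget.map (i U))
  exists_eq (Y : Sm k) (n : SimplexCategoryᵒᵖ) (x : (PSSet.forget.obj (B.obj (op Y))).obj n) :
    ∃ (U : Nbhd Y) (y : (PSSet.forget.obj (T Y U)).obj n), (PSSet.forget.map (i U)).app n y = x
  s {Y : Sm k} (U : Nbhd Y) : T Y U ⟶ B.obj (op U.toSm)
  restr {Y : Sm k} {V U : Nbhd Y} (h : V ≤ U) : T Y U ⟶ T Y V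
  restr_i {Y : Sm k} {V U : Nbhd Y} (h : V ≤ U) : restr h ≫ i V = i U
  restr_s {Y : Sm k} {V U : Nbhd Y} (h : V ≤ U) : restr h ≫ s V = s U ≫ B.map (Nbhd.incl h).op
  base {Y' Y : Sm k} (g : Y' ⟶ Y) (U : Nbhd Y) : T Y U ⟶ T Y' (U.preimage g)
  base_i {Y' Y : Sm k} (g : Y' ⟶ Y) (U : Nbhd Y) : base g U ≫ i (U.preimage g) = i U ≫ B.map g.op
  base_s {Y' Y : Sm k} (g : Y' ⟶ Y) (U : Nbhd Y) :
    base g U ≫ s (U.preimage g) = s U ≫ B.map (Nbhd.preimageHom g U).op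
  s_zero {Y : Sm k} (U : Nbhd Y) : s U ≫ B.map U.zeroLift.op = i U
  s_one {Y : Sm k} (U : Nbhd Y) : s U ≫ B.map U.oneLift.op = i U ≫ r.app (op Y)

namespace RationalDeformation

variable {B : (Sm k)ᵒᵖ ⥤ PSSet.{u + 1}} {r : B ⟶ B} (D : RationalDeformation B r)

/-- The presheaf of loop spaces. -/
abbrev loops (B : (Sm k)ᵒᵖ ⥤ PSSet.{u + 1}) : (Sm k)ᵒᵖ ⥤ SSet.{u + 1} := B ⋙ PSSet.loopSpace

/-- The loops on which the deformation over `U` is defined. -/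
abbrev loopsT (Y : Sm k) (U : Nbhd Y) : SSet.{u + 1} := PSSet.loopSpace.obj (D.T Y U)

/-- The inclusion into all loops. -/
abbrev loopsi {Y : Sm k} (U : Nbhd Y) : D.loopsT Y U ⟶ (loops B).obj (op Y) :=
  PSSet.loopSpace.map (D.i U)

/-- The deformation of loops. -/
abbrev loopss {Y : Sm k} (U : Nbhd Y) : D.loopsT Y U ⟶ (loops B).obj (op U.toSm) :=
  PSSet.loopSpace.map (D.s U)

lemma isDirectedUnion (Y : Sm k) :
    SSet.IsDirectedUnion fun U : Nbhd Y => PSSet.forget.map (D.i U) where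
  nonempty := ⟨Nbhd.top Y⟩
  mono := D.mono_i
  directed U V := ⟨U.inter V, PSSet.forget.map (D.restr (U.inter_le_left V)),
    PSSet.forget.map (D.restr (U.inter_le_right V)),
    by rw [← Functor.map_comp, D.restr_i], by rw [← Functor.map_comp, D.restr_i]⟩
  exists_eq := D.exists_eq Y

lemma restr_loopsi {Y : Sm k} {V U : Nbhd Y} (h : V ≤ U) :
    PSSet.loopSpace.map (D.restr h) ≫ D.loopsi V = D.loopsi U := by
  rw [← Functor.map_comp, D.restr_i]

lemma restr_loopss {Y : Sm k} {V U : Nbhd Y} (h : V ≤ U) :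
    PSSet.loopSpace.map (D.restr h) ≫ D.loopss V = D.loopss U ≫ (loops B).map (Nbhd.incl h).op := by
  rw [← Functor.map_comp, D.restr_s, Functor.map_comp]
  rfl

lemma base_loopsi {Y' Y : Sm k} (g : Y' ⟶ Y) (U : Nbhd Y) :
    PSSet.loopSpace.map (D.base g U) ≫ D.loopsi (U.preimage g) =
      D.loopsi U ≫ (loops B).map g.op := by
  rw [← Functor.map_comp, D.base_i, Functor.map_comp]
  rfl

lemma base_loopss {Y' Y : Sm k} (g : Y' ⟶ Y) (U : Nbhd Y) :
    PSSet.loopSpace.map (D.base g U) ≫ D.loopss (U.preimage g) =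
      D.loopss U ≫ (loops B).map (Nbhd.preimageHom g U).op := by
  rw [← Functor.map_comp, D.base_s, Functor.map_comp]
  rfl

lemma restr_C1in {Y : Sm k} {V U : Nbhd Y} (h : V ≤ U) :
    PSSet.loopSpace.map (D.restr h) ≫ D.loopss V ≫ C1in (loops B) V =
      D.loopss U ≫ C1in (loops B) U := by
  have h₁ := D.restr_loopss h
  refine (Category.assoc _ _ _).symm.trans ((congrArg (· ≫ _) h₁).trans ?_)
  exact (Category.assoc _ _ _).trans (congrArg (D.loopss U ≫ ·) (incl_C1in (loops B) h))

/-- Both loops restrict to the intersection of `U` and `V`, where they coincide because the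
inclusion into all loops is injective. Restriction does not change the class in the colimit. -/
lemma C1in_eq {Y : Sm k} {U V : Nbhd Y} {n : SimplexCategoryᵒᵖ} (γ : (D.loopsT Y U).obj n)
    (δ : (D.loopsT Y V).obj n) (h : (D.loopsi U).app n γ = (D.loopsi V).app n δ) :
    (D.loopss U ≫ C1in (loops B) U).app n γ = (D.loopss V ≫ C1in (loops B) V).app n δ := by
  rw [← D.restr_C1in (U.inter_le_left V), ← D.restr_C1in (U.inter_le_right V)]
  have e : (PSSet.loopSpace.map (D.restr (U.inter_le_left V))).app n γ =
      (PSSet.loopSpace.map (D.restr (U.inter_le_right V))).app n δ := by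
    have := D.mono_i (U.inter V)
    apply PSSet.loopSpace_map_injective (D.i (U.inter V)) n
    refine (SSet.app_congr (D.restr_loopsi (U.inter_le_left V)) γ).trans (h.trans ?_)
    exact (SSet.app_congr (D.restr_loopsi (U.inter_le_right V)) δ).symm
  exact congrArg ((D.loopss (U.inter V) ≫ C1in (loops B) (U.inter V)).app n) e

/-- Every loop lies in the domain of the deformation over some `U`, and by `C1in_eq` the class of
the deformed loop does not depend on `U`. -/
lemma exists_section (Y : Sm k) : ∃ σ : (loops B).obj (op Y) ⟶ (C1 (loops B)).obj (op Y),
    ∀ U, D.loopsi U ≫ σ = D.loopss U ≫ C1in (loops B) U := by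
  have key (n : SimplexCategoryᵒᵖ) (γ : ((loops B).obj (op Y)).obj n) :
      ∃ y : ((C1 (loops B)).obj (op Y)).obj n, ∀ (U : Nbhd Y) (δ : (D.loopsT Y U).obj n),
        (D.loopsi U).app n δ = γ → (D.loopss U ≫ C1in (loops B) U).app n δ = y := by
    obtain ⟨U, γ', h⟩ := PSSet.loopSpace_exists_eq (D.isDirectedUnion Y) n γ
    exact ⟨_, fun V δ hδ => D.C1in_eq δ γ' (hδ.trans h.symm)⟩
  choose σ hσ using key
  refine ⟨{ app n := ↾(σ n), naturality n m f := ?_ }, fun U => ?_⟩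
  · ext γ
    obtain ⟨U, γ', h⟩ := PSSet.loopSpace_exists_eq (D.isDirectedUnion Y) n γ
    have h₁ := hσ n γ U γ' h
    have h₂ := hσ m (((loops B).obj (op Y)).map f γ) U ((D.loopsT Y U).map f γ')
      ((SSet.app_map _ _ _).trans (congrArg _ h))
    exact h₂.symm.trans ((SSet.app_map _ _ _).trans (congrArg _ h₁))
  · ext n γ
    exact (hσ n _ U γ rfl).symm

lemma loops_hom_ext {Y : Sm k} {X : SSet.{u + 1}} {a b : (loops B).obj (op Y) ⟶ X}
    (h : ∀ U, D.loopsi U ≫ a = D.loopsi U ≫ b) : a = b := by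
  ext n γ
  obtain ⟨U, γ', rfl⟩ := PSSet.loopSpace_exists_eq (D.isDirectedUnion Y) n γ
  exact SSet.app_congr (h U) γ'

/-- The section `F ⟶ Ĉ₁ F` on the loops `F` of `B`. -/
def sectionMap : loops B ⟶ C1 (loops B) where
  app Y := (D.exists_section Y.unop).choose
  naturality Y Y' g := D.loops_hom_ext fun U => by
    obtain ⟨g, rfl⟩ : ∃ g', g = Quiver.Hom.op g' := ⟨g.unop, rfl⟩
    have h (Y : Sm k) := (D.exists_section Y).choose_spec
    refine (Category.assoc _ _ _).symm.trans ?_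
    refine (congrArg (· ≫ _) (D.base_loopsi g U).symm).trans ?_
    refine (Category.assoc _ _ _).trans ?_
    refine (congrArg (PSSet.loopSpace.map (D.base g U) ≫ ·) (h _ _)).trans ?_
    refine (Category.assoc _ _ _).symm.trans ?_
    refine (congrArg (· ≫ _) (D.base_loopss g U)).trans ?_
    refine (Category.assoc _ _ _).trans ?_
    refine (congrArg (D.loopss U ≫ ·) (C1in_map (loops B) g U).symm).trans ?_
    refine (Category.assoc _ _ _).symm.trans ?_
    refine (congrArg (· ≫ (C1 (loops B)).map g.op) (h _ U).symm).trans ?_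
    exact Category.assoc _ _ _

lemma loopsi_sectionMap {Y : Sm k} (U : Nbhd Y) :
    D.loopsi U ≫ D.sectionMap.app (op Y) = D.loopss U ≫ C1in (loops B) U :=
  (D.exists_section Y).choose_spec U

/-- A strict equality, since the deformation over each `U` restricts at `t = 0` to the inclusion of
its domain. -/
lemma sectionMap_evalZero : D.sectionMap ≫ evalZero (loops B) = 𝟙 _ := by
  ext1
  funext Y
  refine D.loops_hom_ext fun U => ?_
  refine (Category.assoc _ _ _).symm.trans ?_
  refine (congrArg (· ≫ _) (D.loopsi_sectionMap U)).trans ?_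
  refine (Category.assoc _ _ _).trans ?_
  refine (congrArg (D.loopss U ≫ ·) (C1in_evalZero (loops B) U)).trans ?_
  refine (Functor.map_comp _ _ _).symm.trans ?_
  rw [D.s_zero]
  exact (Category.comp_id _).symm

lemma sectionMap_evalOne :
    D.sectionMap ≫ evalOne (loops B) = Functor.whiskerRight r PSSet.loopSpace := by
  ext1
  funext Y
  refine D.loops_hom_ext fun U => ?_
  refine (Category.assoc _ _ _).symm.trans ?_
  refine (congrArg (· ≫ _) (D.loopsi_sectionMap U)).trans ?_
  refine (Category.assoc _ _ _).trans ?_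
  refine (congrArg (D.loopss U ≫ ·) (C1in_evalOne (loops B) U)).trans ?_
  refine (Functor.map_comp _ _ _).symm.trans ?_
  rw [D.s_one]
  exact Functor.map_comp _ _ _

end RationalDeformation

/-- The self-map of a presheaf of pointed spaces that is constant at the base point. -/
def constBasept (B : (Sm k)ᵒᵖ ⥤ PSSet.{u + 1}) : B ⟶ B where
  app Y := { app m := ⟨fun _ => ((B.obj Y).obj m).point, rfl⟩
             naturality m m' f := Pointed.Hom.ext (funext fun _ =>
               ((B.obj Y).map f).map_point.symm) }
  naturality Y Y' g := by
    apply NatTrans.ext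
    funext m
    exact Pointed.Hom.ext (funext fun _ => ((B.map g).app m).map_point.symm)

end FlfCor

/-! ### The constant end map and rational contractibility of loops -/

namespace SSet

lemma exIter_map_eq_of_const {X Y : SSet.{w}} {f : X ⟶ Y}
    (hf : ∀ n (x y : X.obj n), f.app n x = f.app n y) (i : ℕ) (n : SimplexCategoryᵒᵖ)
    (x y : ((exIter i).obj X).obj n) :
    ((exIter i).map f).app n x = ((exIter i).map f).app n y := by
  induction i generalizing n with
  | zero => exact hf n x y
  | succ i ih =>
    apply ULift.ext
    change x.down ≫ (exIter i).map f = y.down ≫ (exIter i).map f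
    ext m z
    exact ih m _ _

/-- Being constant in every degree passes through `Ex`, whose simplices are maps into the previous
stage, and then to the colimit. For the base-point self-map this makes the induced map on loops
equal to the constant loop. -/
lemma exInf_map_eq_of_const {X Y : SSet.{w}} {f : X ⟶ Y}
    (hf : ∀ n (x y : X.obj n), f.app n x = f.app n y) {T : SSet.{w}} (a b : T ⟶ exInf.obj X) :
    a ≫ exInf.map f = b ≫ exInf.map f := by
  ext n t
  change (exInf.map f).app n (a.app n t) = (exInf.map f).app n (b.app n t)
  obtain ⟨i, x, hx⟩ := exInf_exists_rep (a.app n t)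
  obtain ⟨j, y, hy⟩ := exInf_exists_rep (b.app n t)
  rw [← hx, ← hy, natTrans_apply, natTrans_apply, exInf_rep_eq_iff]
  refine ⟨max i j, le_max_left _ _, le_max_right _ _, ?_⟩
  rw [← natTrans_apply, ← natTrans_apply]
  exact exIter_map_eq_of_const hf _ _ _ _

end SSet

namespace FlfCor

variable {k : Type u} [Field k]

/-- The constant loop, as a map from the terminal presheaf. -/
def constLoop (B : (Sm k)ᵒᵖ ⥤ PSSet.{u + 1}) : ⊤_ _ ⟶ B ⋙ PSSet.loopSpace where
  app Y := { app m := ↾fun _ => ⟨PSSet.exBasept (B.obj Y) _, rfl, rfl⟩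
             naturality _ _ _ := rfl }
  naturality Y Y' g := by
    ext m x
    exact Subtype.ext (PSSet.exBasept_comp (B.map g) _).symm

lemma loopSpace_constBasept (B : (Sm k)ᵒᵖ ⥤ PSSet.{u + 1}) :
    Functor.whiskerRight (constBasept B) PSSet.loopSpace = terminal.from _ ≫ constLoop B := by
  ext Y m γ
  apply Subtype.ext
  refine (SSet.exInf_map_eq_of_const (fun _ _ _ => rfl) γ.1 (PSSet.exBasept (B.obj Y) _)).trans ?_
  exact PSSet.exBasept_comp _ _

/-- The loops of a presheaf of pointed spaces are rationally contractible, if it can be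
rationally deformed to a null-homotopic self-map. -/
theorem RationalDeformation.rationallyContractible {B : (Sm k)ᵒᵖ ⥤ PSSet.{u + 1}} {r : B ⟶ B}
    (D : RationalDeformation B r)
    (hr : (HoPSh.of k).map (Functor.whiskerRight r PSSet.loopSpace) =
      (HoPSh.of k).map (Functor.whiskerRight (constBasept B) PSSet.loopSpace)) :
    RationallyContractible (B ⋙ PSSet.loopSpace) := by
  refine ⟨(HoPSh.of k).map D.sectionMap, ?_, (HoPSh.of k).map (terminal.from _),
    (HoPSh.of k).map (constLoop B), ?_⟩
  · rw [← Functor.map_comp, D.sectionMap_evalZero, CategoryTheory.Functor.map_id]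
  · rw [← Functor.map_comp, D.sectionMap_evalOne, hr, loopSpace_constBasept, Functor.map_comp]

end FlfCor

/-! ### Maps to `𝔾_m` as units -/

namespace FlfCor

variable {k : Type u} [Field k]

section Gm

open LaurentPolynomial

lemma laurent_hom_ext {R S : Type*} [CommRing R] [CommRing S] {f g : R[T;T⁻¹] →+* S}
    (h : ∀ r, f (C r) = g (C r)) (hT : f (T 1) = g (T 1)) : f = g := by
  apply IsLocalization.ringHom_ext (Submonoid.powers (Polynomial.X : Polynomial R))
  ext
  · simpa using h _
  · simpa using hT

/-- The ring homomorphism to the global sections given by a map to an affine scheme. -/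
def specSections {W : Scheme.{u}} {R : CommRingCat.{u}} (f : W ⟶ Spec R) : R ⟶ Γ(W, ⊤) :=
  (Scheme.ΓSpecIso R).inv ≫ f.appTop

lemma specSections_comp_map {W : Scheme.{u}} {R S : CommRingCat.{u}} (f : W ⟶ Spec R) (φ : S ⟶ R) :
    specSections (f ≫ Spec.map φ) = φ ≫ specSections f := by
  rw [specSections, specSections, Scheme.Hom.comp_appTop, Scheme.ΓSpecIso_inv_naturality_assoc]

lemma comp_specSections {W W' : Scheme.{u}} {R : CommRingCat.{u}} (g : W' ⟶ W) (f : W ⟶ Spec R) :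
    specSections (g ≫ f) = specSections f ≫ g.appTop := by
  rw [specSections, specSections, Scheme.Hom.comp_appTop, Category.assoc]

lemma specSections_injective {W : Scheme.{u}} {R : CommRingCat.{u}} {f g : W ⟶ Spec R}
    (h : specSections f = specSections g) : f = g :=
  ext_of_isAffine ((cancel_epi _).1 h)

lemma specSections_toSpecΓ (W : Scheme.{u}) : specSections W.toSpecΓ = 𝟙 _ := by
  simp [specSections]

lemma specSections_toSpecΓ_map {W : Scheme.{u}} {R : CommRingCat.{u}} (φ : R ⟶ Γ(W, ⊤)) :
    specSections (W.toSpecΓ ≫ Spec.map φ) = φ := by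
  rw [specSections_comp_map, specSections_toSpecΓ, Category.comp_id]

/-- The unit on `W` given by a map `W ⟶ 𝔾_m`. -/
def gmCoord {W : Over (SpecK k)} (f : W ⟶ Gm k) : Γ(W.left, ⊤) :=
  specSections (R := .of k[T;T⁻¹]) f.left (T 1)

lemma gmCoord_comp {W W' : Over (SpecK k)} (g : W' ⟶ W) (f : W ⟶ Gm k) :
    gmCoord (g ≫ f) = g.left.appTop (gmCoord f) :=
  ConcreteCategory.congr_hom (comp_specSections (R := .of k[T;T⁻¹]) g.left f.left) (T 1)

/-- The map `W ⟶ 𝔾_m` given by a unit on `W`. -/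
def gmOfUnit {W : Over (SpecK k)} (v : Γ(W.left, ⊤)ˣ) : W ⟶ Gm k :=
  Over.homMk (W.left.toSpecΓ ≫ Spec.map (CommRingCat.ofHom (LaurentPolynomial.eval₂
    (specSections (R := .of k) W.hom).hom v))) (by
    apply specSections_injective
    refine (specSections_comp_map _ _).trans ?_
    refine (congrArg (_ ≫ ·) (specSections_toSpecΓ_map _)).trans ?_
    ext r
    exact LaurentPolynomial.eval₂_C _ _ r)

lemma gmCoord_gmOfUnit {W : Over (SpecK k)} (v : Γ(W.left, ⊤)ˣ) : gmCoord (gmOfUnit v) = v := by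
  have : specSections (R := .of k[T;T⁻¹]) (gmOfUnit v).left = CommRingCat.ofHom
      (LaurentPolynomial.eval₂ (specSections (R := .of k) W.hom).hom v) :=
    specSections_toSpecΓ_map _
  refine (ConcreteCategory.congr_hom this (T 1)).trans ?_
  refine (LaurentPolynomial.eval₂_T _ _ 1).trans ?_
  simp

/-- The scalars are fixed by working over `Spec k`, so only the image of `T` is free. -/
lemma gm_hom_ext {W : Over (SpecK k)} {f g : W ⟶ Gm k} (h : gmCoord f = gmCoord g) : f = g := by
  ext1
  apply specSections_injective
  ext1
  refine laurent_hom_ext (fun r => ?_) h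
  have hw (f : W ⟶ Gm k) := ConcreteCategory.congr_hom ((specSections_comp_map (R := .of k[T;T⁻¹])
    (S := .of k) f.left _).symm.trans (congrArg specSections (Over.w f))) r
  exact (hw f).trans (hw g).symm

lemma gmCoord_one {W : Over (SpecK k)} (a : W ⟶ Over.mk (𝟙 (SpecK k))) :
    gmCoord (a ≫ Gm.one k) = 1 := by
  have := ConcreteCategory.congr_hom (specSections_comp_map (R := .of k) (S := .of k[T;T⁻¹]) a.left
    (CommRingCat.ofHom (LaurentPolynomial.eval₂ (RingHom.id k) 1))) (T 1)
  refine this.trans ?_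
  change specSections (R := .of k) a.left (LaurentPolynomial.eval₂ (RingHom.id k) 1 (T 1)) = 1
  rw [LaurentPolynomial.eval₂_T]
  simp

lemma isUnit_gmCoord {W : Over (SpecK k)} (f : W ⟶ Gm k) : IsUnit (gmCoord f) :=
  (isUnit_T 1).map (specSections (R := .of k[T;T⁻¹]) f.left).hom

instance : Mono (Gm.one k).left := by
  have h : (Gm.one k).left ≫ (Gm k).hom = 𝟙 _ := Over.w (Gm.one k)
  have : Mono ((Gm.one k).left ≫ (Gm k).hom) := by rw [h]; infer_instance
  exact mono_of_mono _ (Gm k).hom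

end Gm

/-! ### The deformation `(1 - t) x + t` and the contraction of the whisker -/

section Whisker

variable (k)

/-- The pointed scheme of `m`-simplices of the whiskered multiplicative group, as a scheme. -/
abbrev whiskerSch (m : SimplexCategory) : Over (SpecK k) := sigmaOver (whiskerSummand k m)

/-- The inclusion of a summand. -/
abbrev whiskerι (m : SimplexCategory) (i : WhiskerIndex m) :
    whiskerSummand k m i ⟶ whiskerSch k m := sigmaOverι (whiskerSummand k m) i

/-- The open and closed subset given by a summand. -/
def whiskerOpen (m : SimplexCategory) (i : WhiskerIndex m) : (whiskerSch k m).left.Opens :=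
  (whiskerι k m i).left.opensRange

/-- The map to `𝔾_m` that contracts the whisker. -/
def whiskerFold (m : SimplexCategory) : whiskerSch k m ⟶ Gm k :=
  sigmaOverDesc fun i => match i with
    | none => 𝟙 _
    | some _ => Gm.one k

variable {k}

lemma exists_mem_whiskerOpen {m : SimplexCategory} (x : (whiskerSch k m).left) :
    ∃ i, x ∈ whiskerOpen k m i := by
  obtain ⟨i, y, rfl⟩ := (sigmaOpenCover fun i => (whiskerSummand k m i).left).exists_eq x
  exact ⟨i, y, rfl⟩

lemma whiskerOpen_disjoint {m : SimplexCategory} {i j : WhiskerIndex m}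
    {x : (whiskerSch k m).left} (hi : x ∈ whiskerOpen k m i) (hj : x ∈ whiskerOpen k m j) :
    i = j := by
  obtain ⟨y, rfl⟩ := hi
  obtain ⟨z, hz⟩ := hj
  exact (congrArg Sigma.fst
    ((sigmaι_eq_iff (fun i => (whiskerSummand k m i).left) _ _ _ _).1 hz)).symm

/-- The composite is the identity on the summand `𝔾_m` and the point `1` on the others. The fold
itself is not a monomorphism, so maps also have to be compared summand by summand. -/
lemma mono_whiskerι_fold (m : SimplexCategory) (i : WhiskerIndex m) :
    Mono ((whiskerι k m i).left ≫ (whiskerFold k m).left) := by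
  have h : whiskerι k m i ≫ whiskerFold k m = _ := sigmaOverι_desc _ _ _
  rw [← Over.comp_left, h]
  obtain _ | σ := i
  · exact inferInstanceAs (Mono (𝟙 (Gm k).left))
  · exact inferInstanceAs (Mono (Gm.one k).left)

/-- Two maps to the whiskered multiplicative group take values in the same summands. -/
def SameSummand {m : SimplexCategory} {W : Scheme.{u}} (f g : W ⟶ (whiskerSch k m).left) : Prop :=
  ∀ z, ∃ i, f z ∈ whiskerOpen k m i ∧ g z ∈ whiskerOpen k m i

namespace SameSummand

variable {m : SimplexCategory} {W : Scheme.{u}} {f g h : W ⟶ (whiskerSch k m).left}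

lemma refl (f : W ⟶ (whiskerSch k m).left) : SameSummand f f := fun z =>
  let ⟨i, hi⟩ := exists_mem_whiskerOpen (f z)
  ⟨i, hi, hi⟩

lemma symm (hfg : SameSummand f g) : SameSummand g f := fun z =>
  let ⟨i, hi, hi'⟩ := hfg z
  ⟨i, hi', hi⟩

lemma mem (hfg : SameSummand f g) {z : W} {i : WhiskerIndex m} (hz : f z ∈ whiskerOpen k m i) :
    g z ∈ whiskerOpen k m i := by
  obtain ⟨j, hj, hj'⟩ := hfg z
  obtain rfl := whiskerOpen_disjoint hz hj
  exact hj'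

lemma trans (hfg : SameSummand f g) (hgh : SameSummand g h) : SameSummand f h := fun z =>
  let ⟨i, hi, hi'⟩ := hfg z
  ⟨i, hi, hgh.mem hi'⟩

lemma precomp (hfg : SameSummand f g) {W' : Scheme.{u}} (a : W' ⟶ W) :
    SameSummand (a ≫ f) (a ≫ g) := fun z => by
  simpa using hfg (a z)

/-- Locally on the source both maps land in one summand, and there the fold is a monomorphism. Thus
summands and coordinate together determine a map to the whiskered `𝔾_m`. -/
lemma hom_ext (hfg : SameSummand f g)
    (hμ : f ≫ (whiskerFold k m).left = g ≫ (whiskerFold k m).left) : f = g := by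
  refine Scheme.hom_ext_of_forall _ _ fun z => ?_
  obtain ⟨i, hi⟩ := exists_mem_whiskerOpen (f z)
  refine ⟨f ⁻¹ᵁ whiskerOpen k m i, hi, ?_⟩
  have hf : Set.range ((f ⁻¹ᵁ whiskerOpen k m i).ι ≫ f) ⊆ Set.range (whiskerι k m i).left := by
    rintro _ ⟨y, rfl⟩
    rw [Scheme.Hom.comp_apply]
    exact y.2
  have hg : Set.range ((f ⁻¹ᵁ whiskerOpen k m i).ι ≫ g) ⊆ Set.range (whiskerι k m i).left := by
    rintro _ ⟨y, rfl⟩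
    rw [Scheme.Hom.comp_apply]
    exact hfg.mem y.2
  rw [← IsOpenImmersion.lift_fac (whiskerι k m i).left _ hf,
    ← IsOpenImmersion.lift_fac (whiskerι k m i).left _ hg]
  congr 1
  have := mono_whiskerι_fold (k := k) m i
  rw [← cancel_mono ((whiskerι k m i).left ≫ (whiskerFold k m).left),
    IsOpenImmersion.lift_fac_assoc, IsOpenImmersion.lift_fac_assoc, Category.assoc, Category.assoc,
    hμ]

end SameSummand

lemma exists_glue_opens {W X : Scheme.{u}} {I : Type} (V : I → W.Opens)
    (hV : ∀ z, ∃ i, z ∈ V i) (f : ∀ i, (V i).toScheme ⟶ X)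
    (hf : ∀ (i j : I) (T : Scheme.{u}) (a : T ⟶ V i) (b : T ⟶ V j),
      a ≫ (V i).ι = b ≫ (V j).ι → a ≫ f i = b ≫ f j) :
    ∃ h : W ⟶ X, ∀ i, (V i).ι ≫ h = f i := by
  have hV : TopologicalSpace.IsOpenCover V := by
    rw [TopologicalSpace.IsOpenCover, eq_top_iff]
    intro z _
    rw [TopologicalSpace.Opens.mem_iSup]
    exact hV z
  have h (i j) := hf i j (pullback (V i).ι (V j).ι) _ _ pullback.condition
  exact ⟨(W.openCoverOfIsOpenCover V hV).glueMorphisms f h, fun i =>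
    (W.openCoverOfIsOpenCover V hV).ι_glueMorphisms f h i⟩

/-- A map to the whiskered multiplicative group can be modified on the summand `𝔾_m`. -/
lemma exists_whisker_modification {m : SimplexCategory} {W : Scheme.{u}}
    (q : W ⟶ (whiskerSch k m).left) (v : W ⟶ (Gm k).left)
    (hv : ∀ σ, (q ⁻¹ᵁ whiskerOpen k m (some σ)).ι ≫ v =
      (q ⁻¹ᵁ whiskerOpen k m (some σ)).ι ≫ q ≫ (whiskerFold k m).left) :
    ∃ q' : W ⟶ (whiskerSch k m).left, SameSummand q q' ∧ q' ≫ (whiskerFold k m).left = v := by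
  let V (i : WhiskerIndex m) : W.Opens := q ⁻¹ᵁ whiskerOpen k m i
  have hloc (i : WhiskerIndex m) : ∃ f : (V i).toScheme ⟶ (whiskerSch k m).left,
      SameSummand ((V i).ι ≫ q) f ∧ f ≫ (whiskerFold k m).left = (V i).ι ≫ v := by
    -- Over the summand `𝔾_m` the new coordinate is used as it stands. On a whisker cell nothing
    -- changes, and `hv` says that the prescribed coordinate is already the right one.
    obtain _ | σ := i
    · refine ⟨(V none).ι ≫ v ≫ (whiskerι k m none).left, fun z => ⟨none, ?_, ?_⟩, ?_⟩
      · rw [Scheme.Hom.comp_apply]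
        exact z.2
      · rw [← Category.assoc, Scheme.Hom.comp_apply]
        exact ⟨_, rfl⟩
      · have : (whiskerι k m none).left ≫ (whiskerFold k m).left = 𝟙 (Gm k).left :=
          congrArg (fun r => Over.Hom.left r) (sigmaOverι_desc (X := whiskerSummand k m) _ none)
        rw [Category.assoc, Category.assoc]
        erw [this]
        rw [Category.comp_id]
    · refine ⟨(V (some σ)).ι ≫ q, SameSummand.refl _, ?_⟩
      rw [hv, Category.assoc]
  choose f hf hf' using hloc
  have hmem (i) (z : V i) : ((V i).ι ≫ q) z ∈ whiskerOpen k m i := z.2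
  obtain ⟨q', hq'⟩ := exists_glue_opens V (fun z => exists_mem_whiskerOpen (q z)) f
    fun i j T a b hab => by
      -- On overlaps the local maps agree because they have the same summands, those of `q`, and the
      -- same coordinate `v`.
      refine SameSummand.hom_ext ?_ ?_
      · refine ((hf i).symm.precomp _).trans ?_
        refine SameSummand.trans ?_ ((hf j).precomp _)
        rw [← Category.assoc, ← Category.assoc, hab]
        exact SameSummand.refl _
      · rw [Category.assoc, Category.assoc, hf', hf', ← Category.assoc, ← Category.assoc, hab]
  refine ⟨q', fun z => ?_, Scheme.hom_ext_of_forall _ _ fun z => ?_⟩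
  · obtain ⟨i, hi⟩ := exists_mem_whiskerOpen (q z)
    refine ⟨i, hi, ?_⟩
    have h := (hf i).mem (hmem i ⟨z, hi⟩)
    rw [← hq'] at h
    exact h
  · obtain ⟨i, hi⟩ := exists_mem_whiskerOpen (q z)
    refine ⟨V i, hi, ?_⟩
    rw [← hf' i, ← hq', Category.assoc]

/-- The function `(1 - t) x + t`, where `x` is the function given by the map to `𝔾_m`. -/
def deformCoord {m : SimplexCategory} {W : Over (SpecK k)} (q : W ⟶ whiskerSch k m)
    (t : Γ(W.left, ⊤)) : Γ(W.left, ⊤) :=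
  (1 - t) * gmCoord (q ≫ whiskerFold k m) + t

lemma deformCoord_comp {m : SimplexCategory} {W W' : Over (SpecK k)} (g : W' ⟶ W)
    (q : W ⟶ whiskerSch k m) (t : Γ(W.left, ⊤)) :
    deformCoord (g ≫ q) (g.left.appTop t) = g.left.appTop (deformCoord q t) := by
  simp [deformCoord, gmCoord_comp]

lemma deformCoord_zero {m : SimplexCategory} {W : Over (SpecK k)} (q : W ⟶ whiskerSch k m) :
    deformCoord q 0 = gmCoord (q ≫ whiskerFold k m) := by
  simp [deformCoord]

lemma deformCoord_one {m : SimplexCategory} {W : Over (SpecK k)} (q : W ⟶ whiskerSch k m) :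
    deformCoord q 1 = 1 := by
  simp [deformCoord]

/-- On a whisker cell `x = 1`, and `(1 - t) · 1 + t = 1`. The new coordinate agrees there with the
old one, so only the summand `𝔾_m` has to be modified. -/
lemma exists_deform {m : SimplexCategory} {W : Over (SpecK k)} (q : W ⟶ whiskerSch k m)
    (t : Γ(W.left, ⊤)) (ht : IsUnit (deformCoord q t)) :
    ∃ q' : W ⟶ whiskerSch k m, SameSummand q.left q'.left ∧
      gmCoord (q' ≫ whiskerFold k m) = deformCoord q t := by
  let v : W ⟶ Gm k := gmOfUnit ht.unit
  have hv : gmCoord v = deformCoord q t := gmCoord_gmOfUnit _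
  obtain ⟨q', h, h'⟩ := exists_whisker_modification q.left v.left fun σ => by
    let V := q.left ⁻¹ᵁ whiskerOpen k m (some σ)
    let a : Over.mk (V.ι ≫ W.hom) ⟶ W := Over.homMk V.ι rfl
    have ha : ∀ z, (a ≫ q).left z ∈ whiskerOpen k m (some σ) := fun z => by
      rw [Over.comp_left, Scheme.Hom.comp_apply]
      exact z.2
    let b : Over.mk (V.ι ≫ W.hom) ⟶ Over.mk (𝟙 (SpecK k)) :=
      Over.homMk (V.ι ≫ W.hom) (Category.comp_id _)
    have hb : a ≫ q = b ≫ whiskerι k m (some σ) := by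
      ext1
      have hr : Set.range (a ≫ q).left ⊆ Set.range (whiskerι k m (some σ)).left := by
        rintro _ ⟨z, rfl⟩
        exact ha z
      rw [← IsOpenImmersion.lift_fac (whiskerι k m (some σ)).left _ hr]
      refine congrArg (· ≫ (whiskerι k m (some σ)).left) ?_
      -- The summand is a copy of `Spec k`, so the lift into it can only be the structure map.
      have h₁ : (whiskerι k m (some σ)).left ≫ (whiskerSch k m).hom = 𝟙 _ :=
        Over.w (whiskerι k m (some σ))
      refine (Category.comp_id _).symm.trans ?_
      rw [← h₁]
      refine (IsOpenImmersion.lift_fac_assoc _ _ _ _).trans ?_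
      exact Over.w (a ≫ q)
    have h₁ : gmCoord ((a ≫ q) ≫ whiskerFold k m) = 1 := by
      have h₂ : whiskerι k m (some σ) ≫ whiskerFold k m = Gm.one k := sigmaOverι_desc _ _ _
      rw [hb, Category.assoc, h₂, gmCoord_one]
    have : a ≫ v = a ≫ q ≫ whiskerFold k m := gm_hom_ext (by
      rw [← Category.assoc, h₁, gmCoord_comp, hv, ← deformCoord_comp, deformCoord, h₁]
      ring)
    exact congrArg (fun r => Over.Hom.left r) this
  refine ⟨Over.homMk q' ?_, h, ?_⟩
  · have h₁ : (whiskerFold k m).left ≫ (Gm k).hom = (whiskerSch k m).hom := Over.w _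
    rw [← h₁, ← Category.assoc, h']
    exact Over.w v
  · rw [← hv]
    congr 1
    ext1
    exact h'

/-- The map to the whiskered multiplicative group that is given by `(1 - t) x + t` on the summand
`𝔾_m`. -/
def deformMap {m : SimplexCategory} {W : Over (SpecK k)} (q : W ⟶ whiskerSch k m)
    (t : Γ(W.left, ⊤)) (ht : IsUnit (deformCoord q t)) : W ⟶ whiskerSch k m :=
  (exists_deform q t ht).choose

lemma deformMap_sameSummand {m : SimplexCategory} {W : Over (SpecK k)} (q : W ⟶ whiskerSch k m)
    (t : Γ(W.left, ⊤)) (ht : IsUnit (deformCoord q t)) :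
    SameSummand q.left (deformMap q t ht).left :=
  (exists_deform q t ht).choose_spec.1

/-- The uniqueness that turns each compatibility of `deformMap` (base change, end points, simplicial
structure maps) into a comparison of summands and coordinates. -/
lemma eq_deformMap {m : SimplexCategory} {W : Over (SpecK k)} {q q' : W ⟶ whiskerSch k m}
    {t : Γ(W.left, ⊤)} (ht : IsUnit (deformCoord q t)) (h : SameSummand q.left q'.left)
    (h' : gmCoord (q' ≫ whiskerFold k m) = deformCoord q t) : q' = deformMap q t ht := by
  obtain ⟨h₁, h₂⟩ := (exists_deform q t ht).choose_spec
  ext1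
  refine SameSummand.hom_ext (h.symm.trans h₁) ?_
  exact congrArg (fun r => Over.Hom.left r) (gm_hom_ext (h'.trans h₂.symm))

lemma gmCoord_deformMap {m : SimplexCategory} {W : Over (SpecK k)} (q : W ⟶ whiskerSch k m)
    (t : Γ(W.left, ⊤)) (ht : IsUnit (deformCoord q t)) :
    gmCoord (deformMap q t ht ≫ whiskerFold k m) = deformCoord q t :=
  (exists_deform q t ht).choose_spec.2

lemma isUnit_deformCoord_comp {m : SimplexCategory} {W W' : Over (SpecK k)} (g : W' ⟶ W)
    {q : W ⟶ whiskerSch k m} {t : Γ(W.left, ⊤)} (ht : IsUnit (deformCoord q t)) :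
    IsUnit (deformCoord (g ≫ q) (g.left.appTop t)) := by
  rw [deformCoord_comp]
  exact ht.map g.left.appTop.hom

lemma comp_deformMap {m : SimplexCategory} {W W' : Over (SpecK k)} (g : W' ⟶ W)
    (q : W ⟶ whiskerSch k m) (t : Γ(W.left, ⊤)) (ht : IsUnit (deformCoord q t)) :
    g ≫ deformMap q t ht =
      deformMap (g ≫ q) (g.left.appTop t) (isUnit_deformCoord_comp g ht) := by
  refine eq_deformMap _ ?_ ?_
  · exact (deformMap_sameSummand q t ht).precomp g.left
  · rw [Category.assoc, gmCoord_comp, gmCoord_deformMap, deformCoord_comp]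

lemma deformMap_zero {m : SimplexCategory} {W : Over (SpecK k)} (q : W ⟶ whiskerSch k m)
    (ht : IsUnit (deformCoord q 0)) : deformMap q 0 ht = q :=
  (eq_deformMap ht (SameSummand.refl _) (deformCoord_zero q).symm).symm

/-- The maximum of two maps to `⦋1⦌`. -/
def cellSup {m : SimplexCategory} (σ τ : m ⟶ ⦋1⦌) : m ⟶ ⦋1⦌ :=
  SimplexCategory.mkHom
    { toFun i := max (σ.toOrderHom i) (τ.toOrderHom i)
      monotone' i j h := max_le_max (σ.toOrderHom.monotone h) (τ.toOrderHom.monotone h) }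

lemma comp_cellSup {m m' : SimplexCategory} (φ : m' ⟶ m) (σ τ : m ⟶ ⦋1⦌) :
    φ ≫ cellSup σ τ = cellSup (φ ≫ σ) (φ ≫ τ) := rfl

lemma cellSup_zero {m : SimplexCategory} (σ : m ⟶ ⦋1⦌) :
    cellSup σ (SimplexCategory.const m ⦋1⦌ 0) = σ := by
  ext i : 3
  exact max_eq_left (Fin.zero_le (σ.toOrderHom i))

lemma zero_cellSup {m : SimplexCategory} (τ : m ⟶ ⦋1⦌) :
    cellSup (SimplexCategory.const m ⦋1⦌ 0) τ = τ := by
  ext i : 3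
  exact max_eq_right (Fin.zero_le (τ.toOrderHom i))

lemma cellSup_one {m : SimplexCategory} (σ : m ⟶ ⦋1⦌) :
    cellSup σ (SimplexCategory.const m ⦋1⦌ 1) = SimplexCategory.const m ⦋1⦌ 1 := by
  ext i : 3
  exact max_eq_right (Fin.le_last (n := 1) (σ.toOrderHom i))

lemma one_cellSup {m : SimplexCategory} (τ : m ⟶ ⦋1⦌) :
    cellSup (SimplexCategory.const m ⦋1⦌ 1) τ = SimplexCategory.const m ⦋1⦌ 1 := by
  ext i : 3
  exact max_eq_left (Fin.le_last (n := 1) (τ.toOrderHom i))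

variable (k) in
/-- The structure map to `Spec k`. -/
def toPt (W : Over (SpecK k)) : W ⟶ Over.mk (𝟙 (SpecK k)) := Over.homMk W.hom (Category.comp_id _)

lemma hom_pt_ext {W : Over (SpecK k)} (a b : W ⟶ Over.mk (𝟙 (SpecK k))) : a = b := by
  ext1
  have ha : a.left = W.hom := (Category.comp_id _).symm.trans (Over.w a)
  have hb : b.left = W.hom := (Category.comp_id _).symm.trans (Over.w b)
  rw [ha, hb]

lemma comp_toPt {W W' : Over (SpecK k)} (a : W ⟶ W') : a ≫ toPt k W' = toPt k W := hom_pt_ext _ _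

lemma toPt_pt : toPt k (Over.mk (𝟙 (SpecK k))) = 𝟙 _ := hom_pt_ext _ _

/-- The homotopy that contracts the whiskered multiplicative group without `𝔾_m` to the base
point. -/
def whiskerContract {m : SimplexCategory} (τ : m ⟶ ⦋1⦌) : whiskerSch k m ⟶ whiskerSch k m :=
  sigmaOverDesc fun i => match i with
    | none => toPt k (Gm k) ≫ whiskerCell k m τ
    | some σ => whiskerCell k m (cellSup σ.1 τ)

lemma whiskerι_none_contract {m : SimplexCategory} (τ : m ⟶ ⦋1⦌) :
    whiskerι k m none ≫ whiskerContract τ = toPt k (Gm k) ≫ whiskerCell k m τ :=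
  sigmaOverι_desc _ _ _

lemma whiskerι_some_contract {m : SimplexCategory} (τ : m ⟶ ⦋1⦌)
    (σ : { σ : m ⟶ ⦋1⦌ // σ ≠ SimplexCategory.const m ⦋1⦌ 0 }) :
    whiskerι k m (some σ) ≫ whiskerContract τ = whiskerCell k m (cellSup σ.1 τ) :=
  sigmaOverι_desc _ _ _

lemma whiskerCell_zero (m : SimplexCategory) :
    whiskerCell k m (SimplexCategory.const m ⦋1⦌ 0) = Gm.one k ≫ whiskerι k m none :=
  dif_pos rfl

lemma whiskerCell_contract {m : SimplexCategory} (σ τ : m ⟶ ⦋1⦌) :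
    whiskerCell k m σ ≫ whiskerContract τ = whiskerCell k m (cellSup σ τ) := by
  by_cases h : σ = SimplexCategory.const m ⦋1⦌ 0
  · subst h
    rw [whiskerCell_zero, Category.assoc, whiskerι_none_contract, zero_cellSup, ← Category.assoc,
      comp_toPt, toPt_pt, Category.id_comp]
  · rw [whiskerCell_of_ne k σ h]
    exact whiskerι_some_contract τ ⟨σ, h⟩

lemma whiskerContract_map {m m' : SimplexCategory} (φ : m' ⟶ m) (τ : m ⟶ ⦋1⦌) :
    whiskerContract τ ≫ whiskerMap k φ = whiskerMap k φ ≫ whiskerContract (φ ≫ τ) := by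
  refine sigmaOver_hom_ext fun i => ?_
  rw [← Category.assoc, ← Category.assoc]
  obtain _ | σ := i
  · rw [whiskerι_none_contract, whiskerι_none_map, whiskerι_none_contract, Category.assoc,
      whiskerCell_map]
  · rw [whiskerι_some_contract, whiskerι_some_map, whiskerCell_contract, whiskerCell_map,
      comp_cellSup]

lemma whiskerContract_one (m : SimplexCategory) :
    whiskerContract (SimplexCategory.const m ⦋1⦌ 1) =
      toPt k _ ≫ whiskerCell k m (SimplexCategory.const m ⦋1⦌ 1) := by
  refine sigmaOver_hom_ext fun i => ?_
  rw [← Category.assoc, comp_toPt]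
  obtain _ | σ := i
  · exact whiskerι_none_contract _
  · refine (whiskerι_some_contract _ σ).trans ?_
    rw [cellSup_one]
    exact ((congrArg (· ≫ _) toPt_pt).trans (Category.id_comp _)).symm

lemma whiskerι_none_fold (m : SimplexCategory) : whiskerι k m none ≫ whiskerFold k m = 𝟙 _ :=
  sigmaOverι_desc _ _ _

lemma whiskerι_some_fold (m : SimplexCategory)
    (σ : { σ : m ⟶ ⦋1⦌ // σ ≠ SimplexCategory.const m ⦋1⦌ 0 }) :
    whiskerι k m (some σ) ≫ whiskerFold k m = Gm.one k :=
  sigmaOverι_desc _ _ _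

lemma whiskerCell_fold {m : SimplexCategory} (σ : m ⟶ ⦋1⦌) :
    whiskerCell k m σ ≫ whiskerFold k m = Gm.one k := by
  by_cases h : σ = SimplexCategory.const m ⦋1⦌ 0
  · subst h
    rw [whiskerCell_zero, Category.assoc, whiskerι_none_fold]
    exact Category.comp_id _
  · rw [whiskerCell_of_ne k σ h]
    exact whiskerι_some_fold m ⟨σ, h⟩

lemma whiskerMap_fold {m m' : SimplexCategory} (φ : m' ⟶ m) :
    whiskerMap k φ ≫ whiskerFold k m' = whiskerFold k m := by
  refine sigmaOver_hom_ext fun i => ?_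
  rw [← Category.assoc]
  obtain _ | σ := i
  · rw [whiskerι_none_map, whiskerι_none_fold, whiskerι_none_fold]
  · rw [whiskerι_some_map, whiskerCell_fold, whiskerι_some_fold]

lemma whiskerContract_fold {m : SimplexCategory} (τ : m ⟶ ⦋1⦌) :
    whiskerContract τ ≫ whiskerFold k m = toPt k _ ≫ Gm.one k := by
  refine sigmaOver_hom_ext fun i => ?_
  rw [← Category.assoc, ← Category.assoc, comp_toPt]
  obtain _ | σ := i
  · rw [whiskerι_none_contract, Category.assoc, whiskerCell_fold]
  · rw [whiskerι_some_contract, whiskerCell_fold]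
    exact ((congrArg (· ≫ _) toPt_pt).trans (Category.id_comp _)).symm

lemma whiskerCell_mem {m : SimplexCategory} (σ : m ⟶ ⦋1⦌) :
    ∃ i, ∀ y, (whiskerCell k m σ).left y ∈ whiskerOpen k m i := by
  by_cases h : σ = SimplexCategory.const m ⦋1⦌ 0
  · subst h
    refine ⟨none, fun y => ?_⟩
    rw [whiskerCell_zero, Over.comp_left, Scheme.Hom.comp_apply]
    exact ⟨_, rfl⟩
  · rw [whiskerCell_of_ne k σ h]
    exact ⟨some ⟨σ, h⟩, fun y => ⟨y, rfl⟩⟩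

lemma whiskerMap_mem {m m' : SimplexCategory} (φ : m' ⟶ m) (i : WhiskerIndex m) :
    ∃ j, ∀ x ∈ whiskerOpen k m i, (whiskerMap k φ).left x ∈ whiskerOpen k m' j := by
  obtain _ | σ := i
  · refine ⟨none, ?_⟩
    rintro _ ⟨y, rfl⟩
    have h := whiskerι_none_map k φ
    rw [← Scheme.Hom.comp_apply, ← Over.comp_left, h]
    exact ⟨y, rfl⟩
  · obtain ⟨j, hj⟩ := whiskerCell_mem (k := k) (φ ≫ σ.1)
    refine ⟨j, ?_⟩
    rintro _ ⟨y, rfl⟩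
    have h := whiskerι_some_map k φ σ
    rw [← Scheme.Hom.comp_apply, ← Over.comp_left, h]
    exact hj y

lemma SameSummand.whiskerMap {m m' : SimplexCategory} {W : Scheme.{u}}
    {f g : W ⟶ (whiskerSch k m).left} (h : SameSummand f g) (φ : m' ⟶ m) :
    SameSummand (f ≫ (FlfCor.whiskerMap k φ).left) (g ≫ (FlfCor.whiskerMap k φ).left) := fun z => by
  obtain ⟨i, hf, hg⟩ := h z
  obtain ⟨j, hj⟩ := whiskerMap_mem (k := k) φ i
  refine ⟨j, ?_, ?_⟩
  · rw [Scheme.Hom.comp_apply]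
    exact hj _ hf
  · rw [Scheme.Hom.comp_apply]
    exact hj _ hg

lemma sameSummand_whiskerContract (m : SimplexCategory) :
    SameSummand (𝟙 _) (whiskerContract (k := k) (SimplexCategory.const m ⦋1⦌ 0)).left := fun z => by
  obtain ⟨i, hi⟩ := exists_mem_whiskerOpen z
  refine ⟨i, hi, ?_⟩
  obtain ⟨y, rfl⟩ := hi
  rw [← Scheme.Hom.comp_apply, ← Over.comp_left]
  obtain _ | σ := i
  · rw [whiskerι_none_contract, whiskerCell_zero, ← Category.assoc, Over.comp_left,
      Scheme.Hom.comp_apply]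
    exact ⟨_, rfl⟩
  · rw [whiskerι_some_contract, cellSup_zero, whiskerCell_of_ne k σ.1 σ.2]
    exact ⟨y, rfl⟩

/-- At `t = 1` the coordinate is identically `1` and the summands are unchanged: `𝔾_m` collapses to
its point `1` and the whisker stays fixed. This is where the contraction along the whisker starts,
so the two deformations join up. -/
lemma deformMap_one {m : SimplexCategory} {W : Over (SpecK k)} (q : W ⟶ whiskerSch k m)
    (ht : IsUnit (deformCoord q 1)) :
    deformMap q 1 ht = q ≫ whiskerContract (SimplexCategory.const m ⦋1⦌ 0) := by
  refine (eq_deformMap ht ?_ ?_).symm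
  · simpa using (sameSummand_whiskerContract m).precomp q.left
  · rw [Category.assoc, whiskerContract_fold, ← Category.assoc, gmCoord_one, deformCoord_one]

lemma deformCoord_whiskerMap {m m' : SimplexCategory} (φ : m' ⟶ m) {W : Over (SpecK k)}
    (q : W ⟶ whiskerSch k m) (t : Γ(W.left, ⊤)) :
    deformCoord (q ≫ whiskerMap k φ) t = deformCoord q t := by
  rw [deformCoord, deformCoord, Category.assoc, whiskerMap_fold]

/-- Structure maps preserve the coordinate and carry summands into summands, so the deformation is
simplicial. -/
lemma deformMap_whiskerMap {m m' : SimplexCategory} (φ : m' ⟶ m) {W : Over (SpecK k)}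
    (q : W ⟶ whiskerSch k m) (t : Γ(W.left, ⊤)) (ht : IsUnit (deformCoord q t))
    (ht' : IsUnit (deformCoord (q ≫ whiskerMap k φ) t)) :
    deformMap (q ≫ whiskerMap k φ) t ht' = deformMap q t ht ≫ whiskerMap k φ := by
  refine (eq_deformMap ht' ?_ ?_).symm
  · exact (deformMap_sameSummand q t ht).whiskerMap φ
  · rw [Category.assoc, whiskerMap_fold, gmCoord_deformMap, deformCoord_whiskerMap]

end Whisker

end FlfCor

/-! ### Replacing the right legs of a diagram of spans -/

namespace FlfCor

variable {k : Type u} [Field k]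

namespace FlfSpan

variable {D : Type (u + 1)} [Category.{u} D] {j : D ⥤ Over (SpecK k)} {ι : Type} [Finite ι]
  {P P' P'' : ι → PtdSch k}

/-- Replace the right leg of a span. -/
abbrev withLeg (α : FlfSpan j P) (q' : ∀ i, α.Z ⟶ (Functor.const D).obj (P' i).X) :
    FlfSpan j P' :=
  { α with q := q' }

/-- Right legs for a diagram of spans that are compatible with the morphisms of spans and have
smaller support. -/
structure IsLeg {C : Type*} [Category* C] (x : C ⥤ FlfSpan j P)
    (q' : ∀ c i, (x.obj c).Z ⟶ (Functor.const D).obj (P' i).X) : Prop where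
  support_le (c : C) (T : D) : ((x.obj c).withLeg (q' c)).support T ≤ (x.obj c).support T
  comp {c d : C} (φ : c ⟶ d) (i : ι) :
    (x.map φ).iso.hom ≫ (x.obj d).ιN ≫ q' d i = (x.obj c).ιN ≫ q' c i

namespace IsLeg

variable {C : Type*} [Category* C] {x : C ⥤ FlfSpan j P}
  {q' : ∀ c i, (x.obj c).Z ⟶ (Functor.const D).obj (P' i).X} (h : IsLeg x q')

/-- The inclusion of the support with respect to the new leg. -/
def incl (c : C) : ((x.obj c).withLeg (q' c)).N ⟶ (x.obj c).N :=
  (x.obj c).liftN ((x.obj c).withLeg (q' c)).ιN fun T z =>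
    h.support_le c T (((x.obj c).withLeg (q' c)).ιN_mem T z)

lemma incl_ιN (c : C) : h.incl c ≫ (x.obj c).ιN = ((x.obj c).withLeg (q' c)).ιN :=
  (x.obj c).liftN_ιN _ _

lemma incl_ιN_assoc (c : C) {M : D ⥤ Over (SpecK k)} (a : (x.obj c).Z ⟶ M) :
    h.incl c ≫ (x.obj c).ιN ≫ a = ((x.obj c).withLeg (q' c)).ιN ≫ a :=
  (x.obj c).liftN_ιN_assoc _ _ _

lemma mono_incl (c : C) : Mono (h.incl c) :=
  have : Mono (h.incl c ≫ (x.obj c).ιN) := by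
    rw [incl_ιN]
    exact inferInstanceAs (Mono ((x.obj c).withLeg (q' c)).ιN)
  mono_of_mono _ (x.obj c).ιN

/-- The restriction of a morphism of spans to the new supports. -/
def mapN {c d : C} (φ : c ⟶ d) :
    ((x.obj c).withLeg (q' c)).N ⟶ ((x.obj d).withLeg (q' d)).N :=
  ((x.obj d).withLeg (q' d)).liftN (h.incl c ≫ (x.map φ).iso.hom ≫ (x.obj d).ιN)
    (mem_support _ fun i => by
      have h' := h.comp φ i
      change (h.incl c ≫ (x.map φ).iso.hom ≫ (x.obj d).ιN) ≫ q' d i =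
        ((x.obj c).withLeg (q' c)).ιN ≫ q' c i
      rw [Category.assoc, Category.assoc, h', incl_ιN_assoc])

lemma mapN_ιN {c d : C} (φ : c ⟶ d) : h.mapN φ ≫ ((x.obj d).withLeg (q' d)).ιN =
    h.incl c ≫ (x.map φ).iso.hom ≫ (x.obj d).ιN :=
  ((x.obj d).withLeg (q' d)).liftN_ιN _ _

lemma mapN_incl {c d : C} (φ : c ⟶ d) :
    h.mapN φ ≫ h.incl d = h.incl c ≫ (x.map φ).iso.hom := by
  rw [← cancel_mono (x.obj d).ιN, Category.assoc, Category.assoc, incl_ιN]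
  exact h.mapN_ιN φ

lemma mapN_id (c : C) : h.mapN (𝟙 c) = 𝟙 _ := by
  have := h.mono_incl c
  rw [← cancel_mono (h.incl c), mapN_incl, x.map_id, id_iso, Iso.refl_hom, Category.comp_id,
    Category.id_comp]

lemma mapN_comp {c d e : C} (φ : c ⟶ d) (ψ : d ⟶ e) : h.mapN (φ ≫ ψ) = h.mapN φ ≫ h.mapN ψ := by
  have := h.mono_incl e
  rw [← cancel_mono (h.incl e), mapN_incl, Category.assoc, mapN_incl, ← Category.assoc,
    mapN_incl, x.map_comp, comp_iso, Iso.trans_hom, Category.assoc]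

/-- The morphism `x.map φ` has an inverse, which also restricts to the new supports. -/
lemma exists_inv {c d : C} (φ : c ⟶ d) : ∃ b, h.mapN φ ≫ b = 𝟙 _ ∧ b ≫ h.mapN φ = 𝟙 _ := by
  let b : ((x.obj d).withLeg (q' d)).N ⟶ ((x.obj c).withLeg (q' c)).N :=
    ((x.obj c).withLeg (q' c)).liftN (h.incl d ≫ (x.map φ).iso.inv ≫ (x.obj c).ιN)
      (mem_support _ fun i => by
        have h' : (x.map φ).iso.inv ≫ (x.obj c).ιN ≫ q' c i = (x.obj d).ιN ≫ q' d i := by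
          rw [← h.comp φ i, Iso.inv_hom_id_assoc]
        change (h.incl d ≫ (x.map φ).iso.inv ≫ (x.obj c).ιN) ≫ q' c i =
          ((x.obj d).withLeg (q' d)).ιN ≫ q' d i
        rw [Category.assoc, Category.assoc, h', incl_ιN_assoc])
  have hb : b ≫ h.incl c = h.incl d ≫ (x.map φ).iso.inv := by
    rw [← cancel_mono (x.obj c).ιN, Category.assoc, Category.assoc, incl_ιN]
    exact ((x.obj c).withLeg (q' c)).liftN_ιN _ _
  refine ⟨b, ?_, ?_⟩
  · have := h.mono_incl c
    rw [← cancel_mono (h.incl c), Category.assoc, hb, ← Category.assoc, mapN_incl, Category.assoc,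
      Iso.hom_inv_id, Category.comp_id, Category.id_comp]
  · have := h.mono_incl d
    rw [← cancel_mono (h.incl d), Category.assoc, mapN_incl, ← Category.assoc, hb, Category.assoc,
      Iso.inv_hom_id, Category.comp_id, Category.id_comp]

/-- The diagram of spans with the new right legs. -/
def functor : C ⥤ FlfSpan j P' where
  obj c := (x.obj c).withLeg (q' c)
  map {c d} φ :=
    { iso := ⟨h.mapN φ, (h.exists_inv φ).choose, (h.exists_inv φ).choose_spec.1,
        (h.exists_inv φ).choose_spec.2⟩
      w_p := by
        have h₁ := (x.map φ).w_p
        have h₂ := h.mapN_ιN φ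
        change h.mapN φ ≫ ((x.obj d).withLeg (q' d)).ιN ≫ (x.obj d).p =
          ((x.obj c).withLeg (q' c)).ιN ≫ (x.obj c).p
        rw [reassoc_of% h₂, h₁, incl_ιN_assoc]
      w_q i := by
        have h₁ := h.comp φ i
        have h₂ := h.mapN_ιN φ
        change h.mapN φ ≫ ((x.obj d).withLeg (q' d)).ιN ≫ q' d i =
          ((x.obj c).withLeg (q' c)).ιN ≫ q' c i
        rw [reassoc_of% h₂, h₁, incl_ιN_assoc] }
  map_id c := Hom.ext (Iso.ext (h.mapN_id c))
  map_comp φ ψ := Hom.ext (Iso.ext (h.mapN_comp φ ψ))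

lemma functor_congr {q'' : ∀ c i, (x.obj c).Z ⟶ (Functor.const D).obj (P' i).X}
    (h' : IsLeg x q'') (e : q' = q'') : h.functor = h'.functor := by
  subst e
  rfl

/-- Morphisms of spans are determined after inclusion into `Z`, and there both sides restrict the
morphism of the original diagram. -/
lemma functor_functor {q'' : ∀ c i, (x.obj c).Z ⟶ (Functor.const D).obj (P'' i).X}
    (h' : IsLeg h.functor q'') (h'' : IsLeg x q'') : h'.functor = h''.functor := by
  refine CategoryTheory.Functor.hext (fun c => rfl) fun c d φ => heq_of_eq (hom_ext ?_)
  refine (h'.mapN_ιN φ).trans (Eq.trans ?_ (h''.mapN_ιN φ).symm)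
  have h₁ : h.mapN φ ≫ ((x.obj d).withLeg (q' d)).ιN =
    h.incl c ≫ (x.map φ).iso.hom ≫ (x.obj d).ιN := h.mapN_ιN φ
  have h₂ : h'.incl c ≫ h.incl c = h''.incl c :=
    (cancel_mono (x.obj c).ιN).1 ((Category.assoc _ _ _).trans
      ((congrArg (h'.incl c ≫ ·) (h.incl_ιN c)).trans ((h'.incl_ιN c).trans
        (h''.incl_ιN c).symm)))
  refine (congrArg (h'.incl c ≫ ·) h₁).trans ?_
  exact (Category.assoc _ _ _).symm.trans
    (congrArg (· ≫ (x.map φ).iso.hom ≫ (x.obj d).ιN) h₂)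

lemma comp_push (h : IsLeg x q') (f : P' ⟶ P'') :
    IsLeg x fun c i => q' c i ≫ (Functor.const D).map (f i).hom where
  support_le c T := (support_pushObj_le f ((x.obj c).withLeg (q' c)) T).trans (h.support_le c T)
  comp φ i := by
    have := h.comp φ i
    rw [reassoc_of% this]

variable {D' : Type (u + 1)} [Category.{u} D']

lemma preAux (h : IsLeg x q') (H : D' ⥤ D) :
    IsLeg (x ⋙ FlfSpan.preAux H) fun c i => H.whiskerLeft (q' c i) where
  support_le c T := h.support_le c (H.obj T)
  comp φ i := congrArg H.whiskerLeft (h.comp φ i)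

lemma functor_preAux (H : D' ⥤ D) : (h.preAux H).functor = h.functor ⋙ FlfSpan.preAux H :=
  CategoryTheory.Functor.hext (fun c => rfl) fun c d φ => heq_of_eq (Hom.ext (Iso.ext rfl))

end IsLeg

variable {C : Type*} [Category* C]

/-- Composition with pointed maps is itself a change of legs, so commuting it with the deformation
reduces to an equality of legs. -/
lemma isLeg_push (x : C ⥤ FlfSpan j P) (f : P ⟶ P') :
    IsLeg x fun c i => (x.obj c).q i ≫ (Functor.const D).map (f i).hom where
  support_le c T := support_pushObj_le f (x.obj c) T
  comp φ i := by
    have := (x.map φ).w_q i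
    rw [reassoc_of% this]

lemma isLeg_push_functor (x : C ⥤ FlfSpan j P) (f : P ⟶ P') :
    (isLeg_push x f).functor = x ⋙ push f := by
  exact CategoryTheory.Functor.hext (fun c => rfl) fun c d φ => heq_of_eq (Hom.ext (Iso.ext rfl))

lemma isLeg_self (x : C ⥤ FlfSpan j P) : IsLeg x fun c i => (x.obj c).q i where
  support_le c T := le_rfl
  comp φ i := (x.map φ).w_q i

lemma isLeg_self_functor (x : C ⥤ FlfSpan j P) : (isLeg_self x).functor = x := by
  have := isLeg_push_functor x (𝟙 P)
  rw [push_id] at this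
  refine Eq.trans ?_ this
  refine IsLeg.functor_congr _ _ (funext fun c => funext fun i => ?_)
  exact ((congrArg ((x.obj c).q i ≫ ·) ((Functor.const D).map_id _)).trans
    (Category.comp_id _)).symm

end FlfSpan

end FlfCor

/-! ### Deforming diagrams of spans -/

namespace FlfCor

variable {k : Type u} [Field k]

lemma deformMap_congr {m : SimplexCategory} {W : Over (SpecK k)} {q q' : W ⟶ whiskerSch k m}
    {t t' : Γ(W.left, ⊤)} (hq : q = q') (h : t = t') (ht : IsUnit (deformCoord q t)) :
    deformMap q t ht = deformMap q' t' (by rw [← hq, ← h]; exact ht) := by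
  subst hq h
  rfl

variable (k) in
/-- The pointed schemes in the smash product `A ∧ 𝔾_m^{∧ n}` in simplicial degree `m`. -/
abbrev smashObj (n : ℕ) (A : Pointed.{0}) (m : SimplexCategory) : Option (Fin n) → PtdSch k :=
  ((smashWith (GmSmash k n)).obj A).obj (op m)

lemma whiskeredGm_pt (m : SimplexCategory) : ((whiskeredGm k).obj (op m)).pt =
    whiskerι k m (some ⟨SimplexCategory.const m ⦋1⦌ 1, const_one_ne _⟩) :=
  Category.id_comp _

lemma mem_whiskeredGm_away (m : SimplexCategory) (x : (whiskerSch k m).left) :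
    x ∈ ((whiskeredGm k).obj (op m)).away ↔
      x ∉ whiskerOpen k m (some ⟨SimplexCategory.const m ⦋1⦌ 1, const_one_ne _⟩) := by
  change ¬ (∃ y, ((whiskeredGm k).obj (op m)).pt.left y = x) ↔ _
  rw [whiskeredGm_pt]
  rfl

/-- The base point is a whole summand, so maps with the same summands avoid it at the same points.
Hence the deformation does not change supports. -/
lemma SameSummand.mem_away {m : SimplexCategory} {W : Scheme.{u}}
    {f g : W ⟶ (whiskerSch k m).left} (h : SameSummand f g) {z : W}
    (hz : f z ∈ ((whiskeredGm k).obj (op m)).away) :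
    g z ∈ ((whiskeredGm k).obj (op m)).away :=
  (mem_whiskeredGm_away m _).2 fun h' => (mem_whiskeredGm_away m _).1 hz (h.symm.mem h')

lemma appTop_comp_eq {X Y Y' Z : Over (SpecK k)} {a : X ⟶ Y} {b : Y ⟶ Z} {c : X ⟶ Y'}
    {d : Y' ⟶ Z} (h : a ≫ b = c ≫ d) (s : Γ(Z.left, ⊤)) :
    a.left.appTop (b.left.appTop s) = c.left.appTop (d.left.appTop s) := by
  have h' : a.left ≫ b.left = c.left ≫ d.left := congrArg (fun r => Over.Hom.left r) h
  have := ConcreteCategory.congr_hom (congrArg Scheme.Hom.appTop h') s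
  rwa [Scheme.Hom.comp_appTop, Scheme.Hom.comp_appTop] at this

/-- A compatible family of functions on a diagram of schemes. -/
@[ext]
structure DiagramFunction {D : Type (u + 1)} [Category.{u} D] (j : D ⥤ Over (SpecK k)) where
  val (T : D) : Γ((j.obj T).left, ⊤)
  map_val {T T' : D} (f : T ⟶ T') : (j.map f).left.appTop (val T') = val T

namespace DiagramFunction

variable {D D' : Type (u + 1)} [Category.{u} D] [Category.{u} D'] {j : D ⥤ Over (SpecK k)}

/-- The pullback of functions along a map of diagrams. -/
def comap {Z : D ⥤ Over (SpecK k)} (p : Z ⟶ j) (t : DiagramFunction j) : DiagramFunction Z where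
  val T := (p.app T).left.appTop (t.val T)
  map_val {T T'} f := by
    rw [← t.map_val f]
    exact appTop_comp_eq (p.naturality f) (t.val T')

/-- The restriction of functions along a functor. -/
def restrict (t : DiagramFunction j) (H : D' ⥤ D) : DiagramFunction (H ⋙ j) where
  val T := t.val (H.obj T)
  map_val f := t.map_val (H.map f)

instance : Zero (DiagramFunction j) := ⟨⟨fun _ => 0, fun _ => map_zero _⟩⟩

instance : One (DiagramFunction j) := ⟨⟨fun _ => 1, fun _ => map_one _⟩⟩

/-- The function on the diagram `j'` is the restriction of the function on `j`. -/
def IsRestriction (t : DiagramFunction j)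
    {j' : D' ⥤ Over (SpecK k)} (t' : DiagramFunction j') (H : D' ⥤ D) (hj : H ⋙ j = j') : Prop :=
  ∀ T, t'.val T = (eqToHom (congrArg (fun F : D' ⥤ Over (SpecK k) => F.obj T) hj).symm).left.appTop
    (t.val (H.obj T))

lemma IsRestriction.eq_restrict {t : DiagramFunction j}
    {H : D' ⥤ D} {t' : DiagramFunction (H ⋙ j)} (ht : t.IsRestriction t' H rfl) :
    t' = t.restrict H :=
  DiagramFunction.ext (funext fun T => (ht T).trans (by simp [DiagramFunction.restrict]))

end DiagramFunction

namespace FlfSpan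

variable {D D' : Type (u + 1)} [Category.{u} D] [Category.{u} D'] {j : D ⥤ Over (SpecK k)}
  {n : ℕ} {A A' : Pointed.{0}} {m m' : SimplexCategory}

/-- The map to a whiskered multiplicative group in the right leg of a span. -/
abbrev legGm (α : FlfSpan j (smashObj k n A m)) (i : Fin n) (T : D) :
    α.Z.obj T ⟶ whiskerSch k m := (α.q (some i)).app T

lemma map_legGm (α : FlfSpan j (smashObj k n A m)) (i : Fin n) {T T' : D} (f : T ⟶ T') :
    α.Z.map f ≫ α.legGm i T' = α.legGm i T :=
  ((α.q (some i)).naturality f).trans (Category.comp_id _)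

/-- The deformation is defined on a span. -/
def IsDeformable (t : DiagramFunction j) (α : FlfSpan j (smashObj k n A m)) : Prop :=
  ∀ i T, IsUnit (deformCoord (α.legGm i T) ((t.comap α.p).val T))

/-- The right leg of the deformed span. -/
def deformLeg (t : DiagramFunction j) (α : FlfSpan j (smashObj k n A m))
    (h : α.IsDeformable t) (i : Option (Fin n)) :
    α.Z ⟶ (Functor.const D).obj (smashObj k n A m i).X :=
  match i with
  | none => α.q none
  | some i =>
    { app T := deformMap (α.legGm i T) ((t.comap α.p).val T) (h i T)
      naturality T T' f := by
        refine Eq.trans ?_ (Category.comp_id _).symm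
        refine (comp_deformMap _ _ _ _).trans ?_
        exact deformMap_congr (α.map_legGm i f) ((t.comap α.p).map_val f) _ }

variable {C : Type*} [Category* C]

/-- The deformation keeps summands and so supports. A morphism of spans respects `p` and the old
legs on supports, hence the function `t` and the coordinates, hence the deformed legs. -/
lemma isLeg_deformLeg (t : DiagramFunction j) (x : C ⥤ FlfSpan j (smashObj k n A m))
    (h : ∀ c, (x.obj c).IsDeformable t) :
    IsLeg x fun c => (x.obj c).deformLeg t (h c) where
  support_le c T z hz i := by
    match i with
    | none => exact hz none
    | some i => exact (deformMap_sameSummand _ _ (h c i T)).symm.mem_away (hz (some i))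
  comp {c d} φ i := by
    match i with
    | none => exact (x.map φ).w_q none
    | some i =>
      have hq := (x.map φ).w_q (some i)
      have hp := (x.map φ).w_p
      apply NatTrans.ext
      funext T
      change (x.map φ).iso.hom.app T ≫ (x.obj d).ιN.app T ≫ deformMap _ _ (h d i T) =
        (x.obj c).ιN.app T ≫ deformMap _ _ (h c i T)
      rw [← Category.assoc, comp_deformMap, comp_deformMap]
      refine deformMap_congr ?_ ?_ _
      · exact (Category.assoc _ _ _).trans (congr_app hq T)
      · exact appTop_comp_eq ((Category.assoc _ _ _).trans (congr_app hp T)) (t.val T)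

/-- The deformation of a diagram of spans. -/
def deform (t : DiagramFunction j) (x : C ⥤ FlfSpan j (smashObj k n A m))
    (h : ∀ c, (x.obj c).IsDeformable t) : C ⥤ FlfSpan j (smashObj k n A m) :=
  (isLeg_deformLeg t x h).functor

lemma deform_congr {t : DiagramFunction j} {x y : C ⥤ FlfSpan j (smashObj k n A m)} (e : x = y)
    (h : ∀ c, (x.obj c).IsDeformable t) (h' : ∀ c, (y.obj c).IsDeformable t) :
    deform t x h = deform t y h' := by
  subst e
  rfl

lemma comp_deform {C' : Type*} [Category* C'] (y : C' ⥤ C) (t : DiagramFunction j)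
    (x : C ⥤ FlfSpan j (smashObj k n A m)) (h : ∀ c, (x.obj c).IsDeformable t) :
    y ⋙ deform t x h = deform t (y ⋙ x) fun c => h (y.obj c) :=
  CategoryTheory.Functor.hext (fun c => rfl) fun c d φ => heq_of_eq (Hom.ext (Iso.ext rfl))

lemma deform_zero (x : C ⥤ FlfSpan j (smashObj k n A m))
    (h : ∀ c, (x.obj c).IsDeformable 0) : deform 0 x h = x := by
  refine Eq.trans ?_ (isLeg_self_functor x)
  refine IsLeg.functor_congr _ _ (funext fun c => funext fun i => ?_)
  match i with
  | none => rfl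
  | some i =>
    apply NatTrans.ext
    funext T
    refine (deformMap_congr rfl (map_zero _) (h c i T)).trans ?_
    exact deformMap_zero _ _

/-- The contracting homotopy of the whiskers, as a pointed map. -/
def contractHom (n : ℕ) (A : Pointed.{0}) {m : SimplexCategory} (τ : m ⟶ ⦋1⦌) :
    smashObj k n A m ⟶ smashObj k n A m := fun i =>
  match i with
  | none => 𝟙 _
  | some i =>
    { hom := whiskerContract τ
      w := by
        have hpt := (whiskeredGm_pt (k := k) m).trans
          (whiskerCell_of_ne k _ (const_one_ne _)).symm
        change ((whiskeredGm k).obj (op m)).pt ≫ whiskerContract τ =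
          ((whiskeredGm k).obj (op m)).pt
        rw [hpt]
        refine (whiskerCell_contract _ τ).trans ?_
        rw [one_cellSup] }

lemma deform_one (x : C ⥤ FlfSpan j (smashObj k n A m))
    (h : ∀ c, (x.obj c).IsDeformable 1) :
    deform 1 x h = x ⋙ push (contractHom n A (SimplexCategory.const m ⦋1⦌ 0)) := by
  refine Eq.trans ?_ (isLeg_push_functor x _)
  refine IsLeg.functor_congr _ _ (funext fun c => funext fun i => ?_)
  match i with
  | none => exact (Category.comp_id _).symm
  | some i =>
    apply NatTrans.ext
    funext T
    refine (deformMap_congr rfl (map_one _) (h c i T)).trans ?_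
    exact deformMap_one _ _

/-- A pointed map of the smash products that is given by a simplicial structure map on the
whiskered multiplicative groups. -/
def IsStructureMap (f : smashObj k n A m ⟶ smashObj k n A' m') (φ : m' ⟶ m) : Prop :=
  ∀ i, (f (some i)).hom = whiskerMap k φ

/-- Structure maps do not change the `𝔾_m` coordinate, so the unit condition is literally the same.
-/
lemma IsDeformable.push {t : DiagramFunction j} {α : FlfSpan j (smashObj k n A m)}
    (h : α.IsDeformable t) {f : smashObj k n A m ⟶ smashObj k n A' m'} {φ : m' ⟶ m}
    (hf : IsStructureMap f φ) : (pushObj f α).IsDeformable t := fun i T => by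
  have e : (pushObj f α).legGm i T = α.legGm i T ≫ whiskerMap k φ :=
    congrArg (α.legGm i T ≫ ·) (hf i)
  rw [e, deformCoord_whiskerMap]
  exact h i T

/-- Both sides change the legs of `x` twice, so by `functor_functor` each is a single change of
legs; the two resulting legs agree by `deformMap_whiskerMap`. -/
lemma deform_push (t : DiagramFunction j) (x : C ⥤ FlfSpan j (smashObj k n A m))
    (h : ∀ c, (x.obj c).IsDeformable t) {f : smashObj k n A m ⟶ smashObj k n A' m'}
    {φ : m' ⟶ m} (hf : IsStructureMap f φ) (h' : ∀ c, ((x ⋙ push f).obj c).IsDeformable t) :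
    deform t (x ⋙ push f) h' = deform t x h ⋙ push f := by
  have h₁ (c) : ((isLeg_push x f).functor.obj c).IsDeformable t := h' c
  have e : (fun c => ((isLeg_push x f).functor.obj c).deformLeg t (h₁ c)) =
      fun c i => (x.obj c).deformLeg t (h c) i ≫ (Functor.const D).map (f i).hom := by
    funext c i
    match i with
    | none => rfl
    | some i =>
      apply NatTrans.ext
      funext T
      have e₁ : ((isLeg_push x f).functor.obj c).legGm i T =
          (x.obj c).legGm i T ≫ whiskerMap k φ := congrArg ((x.obj c).legGm i T ≫ ·) (hf i)
      refine (deformMap_congr e₁ rfl (h₁ c i T)).trans ?_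
      refine (deformMap_whiskerMap φ _ _ (h c i T) _).trans ?_
      exact congrArg (deformMap _ _ (h c i T) ≫ ·) (hf i).symm
  have h₂ := (isLeg_deformLeg t x h).comp_push f
  have h₃ := h₂
  rw [← e] at h₃
  rw [← isLeg_push_functor (deform t x h) f, deform_congr (isLeg_push_functor x f).symm h' h₁]
  refine ((isLeg_push x f).functor_functor (isLeg_deformLeg t _ h₁) h₃).trans ?_
  refine Eq.trans ?_ ((isLeg_deformLeg t x h).functor_functor (isLeg_push (deform t x h) f) h₂).symm
  exact IsLeg.functor_congr _ _ e

lemma IsDeformable.preAux {t : DiagramFunction j} {α : FlfSpan j (smashObj k n A m)}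
    (h : α.IsDeformable t) (H : D' ⥤ D) : (preObj H α).IsDeformable (t.restrict H) :=
  fun i T => h i (H.obj T)

/-- An equality and not just an isomorphism: restriction reindexes the chosen family `Z`, and the
deformed leg is computed on each `Z_T` separately. -/
lemma deform_preAux (t : DiagramFunction j) (x : C ⥤ FlfSpan j (smashObj k n A m))
    (h : ∀ c, (x.obj c).IsDeformable t) (H : D' ⥤ D)
    (h' : ∀ c, ((x ⋙ preAux H).obj c).IsDeformable (t.restrict H)) :
    deform (t.restrict H) (x ⋙ preAux H) h' = deform t x h ⋙ preAux H := by
  refine Eq.trans ?_ ((isLeg_deformLeg t x h).functor_preAux H)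
  refine IsLeg.functor_congr _ _ (funext fun c => funext fun i => ?_)
  match i with
  | none => rfl
  | some i => rfl

lemma IsDeformable.pre {t : DiagramFunction j} {α : FlfSpan j (smashObj k n A m)}
    (h : α.IsDeformable t) (H : D' ⥤ D) {j' : D' ⥤ Over (SpecK k)} (hj : H ⋙ j = j')
    {t' : DiagramFunction j'} (ht : t.IsRestriction t' H hj) :
    ((FlfSpan.pre H hj).obj α).IsDeformable t' := by
  subst hj
  rw [ht.eq_restrict]
  exact h.preAux H

lemma deform_pre (t : DiagramFunction j) (x : C ⥤ FlfSpan j (smashObj k n A m))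
    (h : ∀ c, (x.obj c).IsDeformable t) (H : D' ⥤ D) {j' : D' ⥤ Over (SpecK k)}
    (hj : H ⋙ j = j') {t' : DiagramFunction j'} (ht : t.IsRestriction t' H hj)
    (h' : ∀ c, ((x ⋙ pre H hj).obj c).IsDeformable t') :
    deform t' (x ⋙ pre H hj) h' = deform t x h ⋙ pre H hj := by
  subst hj
  obtain rfl := ht.eq_restrict
  exact deform_preAux t x h H h'

/-! ### Spans with empty support -/

/-- A span with empty support. -/
def IsNull {ι : Type} [Finite ι] {P : ι → PtdSch k} (α : FlfSpan j P) : Prop :=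
  ∀ T, IsEmpty (α.N.obj T).left

section Null

variable {ι : Type} [Finite ι] {P P' : ι → PtdSch k}

lemma IsNull.hom_ext {α : FlfSpan j P} (hα : α.IsNull) {F : D ⥤ Over (SpecK k)}
    (f g : α.N ⟶ F) : f = g := by
  apply NatTrans.ext
  funext T
  have := hα T
  exact over_hom_ext_of_isEmpty _ _

/-- The unique map out of a diagram of empty schemes. -/
def IsNull.desc {α : FlfSpan j P} (hα : α.IsNull) (F : D ⥤ Over (SpecK k)) : α.N ⟶ F where
  app T :=
    have := hα T
    Over.homMk (isInitialOfIsEmpty.to _) (isInitialOfIsEmpty.hom_ext _ _)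
  naturality T T' f :=
    have := hα T
    over_hom_ext_of_isEmpty _ _

/-- The unique morphism between spans with empty support. -/
def IsNull.hom {α β : FlfSpan j P} (hα : α.IsNull) (hβ : β.IsNull) : α ⟶ β where
  iso := ⟨hα.desc _, hβ.desc _, hα.hom_ext _ _, hβ.hom_ext _ _⟩
  w_p := hα.hom_ext _ _
  w_q _ := hα.hom_ext _ _

lemma IsNull.eq {α β : FlfSpan j P} (hα : α.IsNull) (f g : α ⟶ β) : f = g :=
  FlfSpan.hom_ext (hα.hom_ext _ _)

/-- The diagram given by spans with empty support and their unique morphisms. -/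
def ofNull (o : C → FlfSpan j P) (h : ∀ c, (o c).IsNull) : C ⥤ FlfSpan j P where
  obj := o
  map {c d} _ := (h c).hom (h d)
  map_id c := (h c).eq _ _
  map_comp _ _ := (h _).eq _ _

/-- Morphisms out of a span with empty support are unique, so only the objects have to be compared.
-/
lemma functor_ext_of_null {x y : C ⥤ FlfSpan j P} (h : ∀ c, (x.obj c).IsNull)
    (e : ∀ c, x.obj c = y.obj c) : x = y :=
  CategoryTheory.Functor.ext e fun c d φ => (h c).eq _ _

lemma isNull_iff {α : FlfSpan j P} :
    α.IsNull ↔ ∀ T (z : (α.Z.obj T).left), z ∉ α.support T :=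
  ⟨fun h T z hz => (h T).elim ⟨z, hz⟩, fun h T => ⟨fun z => h T z.1 z.2⟩⟩

lemma isNull_zero : (zero j P).IsNull :=
  isNull_iff.2 fun T z => (inferInstance : IsEmpty (emptyOver k).left).elim z

lemma IsNull.push {α : FlfSpan j P} (h : α.IsNull) (f : P ⟶ P') : (pushObj f α).IsNull :=
  isNull_iff.2 fun T z hz => isNull_iff.1 h T z (support_pushObj_le f α T hz)

lemma IsNull.pre {α : FlfSpan j P} (h : α.IsNull) (H : D' ⥤ D) {j' : D' ⥤ Over (SpecK k)}
    (hj : H ⋙ j = j') : ((pre H hj).obj α).IsNull := by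
  subst hj
  exact fun T => h (H.obj T)

end Null

/-- On the empty scheme the ring of functions is zero, and every element of it is a unit. -/
lemma isDeformable_zero (t : DiagramFunction j) :
    (zero j (smashObj k n A m)).IsDeformable t := fun i T => by
  have : IsEmpty ((zero j (smashObj k n A m)).Z.obj T).left :=
    inferInstanceAs (IsEmpty (emptyOver k).left)
  have : Subsingleton Γ(((zero j (smashObj k n A m)).Z.obj T).left, ⊤) := inferInstance
  exact isUnit_of_subsingleton _

lemma deform_const_zero (t : DiagramFunction j)
    (h : ∀ c : C, (((Functor.const C).obj (zero j (smashObj k n A m))).obj c).IsDeformable t) :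
    deform t ((Functor.const C).obj (zero j (smashObj k n A m))) h =
      (Functor.const C).obj (zero j (smashObj k n A m)) := by
  symm
  refine functor_ext_of_null (fun c => isNull_zero) fun c => ?_
  exact mk_congr rfl (funext fun i => const_empty_hom_ext _ _)

/-- At the end of the contraction every whiskered `𝔾_m` is sent to its base point. One such factor
already puts all of `Z` over the base point of the smash product, and `n > 0` supplies the factor of
index `0`. -/
lemma isNull_push_contract (hn : 0 < n) (α : FlfSpan j (smashObj k n A m)) :
    (pushObj (contractHom n A (SimplexCategory.const m ⦋1⦌ 1)) α).IsNull := by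
  refine isNull_iff.2 fun T z hz => ?_
  have h := (mem_whiskeredGm_away m _).1 (hz (some ⟨0, hn⟩))
  refine h ?_
  change (α.legGm ⟨0, hn⟩ T ≫ whiskerContract (SimplexCategory.const m ⦋1⦌ 1)).left z ∈ _
  rw [whiskerContract_one, whiskerCell_of_ne k _ (const_one_ne m), ← Category.assoc, Over.comp_left,
    Scheme.Hom.comp_apply]
  exact ⟨_, rfl⟩

end FlfSpan

end FlfCor

/-! ### The coordinate of `𝔸¹` and the open set on which a span can be deformed -/

namespace FlfCor

variable {k : Type u} [Field k]

lemma isUnit_of_mem_basicOpen {X : Scheme.{u}} (f : Γ(X, ⊤)) (h : ∀ x, x ∈ X.basicOpen f) :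
    IsUnit f := by
  have h' : X.basicOpen f = ⊤ := top_le_iff.1 fun x _ => h x
  have hf : IsUnit (X.presheaf.map (homOfLE (X.basicOpen_le f)).op f) :=
    RingedSpace.isUnit_res_basicOpen X.toRingedSpace f
  have : IsIso (homOfLE (X.basicOpen_le f)) := by
    exact ⟨homOfLE h'.ge, Subsingleton.elim _ _, Subsingleton.elim _ _⟩
  have hinv := hf.map (inv (X.presheaf.map (homOfLE (X.basicOpen_le f)).op)).hom
  have e : (inv (X.presheaf.map (homOfLE (X.basicOpen_le f)).op))
      (X.presheaf.map (homOfLE (X.basicOpen_le f)).op f) = f := by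
    rw [← CommRingCat.comp_apply, IsIso.hom_inv_id]
    rfl
  exact e ▸ hinv

lemma mem_basicOpen_appTop {X Y : Scheme.{u}} (f : X ⟶ Y) (s : Γ(Y, ⊤)) (x : X) :
    x ∈ X.basicOpen (f.appTop s) ↔ f x ∈ Y.basicOpen s := by
  rw [← Scheme.preimage_basicOpen_top]
  rfl

namespace Sm

namespace Nbhd

/-- The projection of a neighbourhood to `Y`. -/
def proj {Y : Sm k} (U : Nbhd Y) : U.toSm ⟶ Y :=
  ObjectProperty.homMk (Over.homMk (U.ι ≫ A1.proj Y) (by rfl))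

lemma comp_proj {Y T : Sm k} {U : Nbhd Y} (a : T ⟶ U.toSm) :
    (a ≫ U.proj).hom.left = (a.hom.left ≫ U.ι) ≫ A1.proj Y :=
  (Category.assoc _ _ _).symm

lemma incl_proj {Y : Sm k} {U V : Nbhd Y} (h : V ≤ U) : incl h ≫ U.proj = V.proj := by
  ext : 2
  rw [comp_proj, incl_ι]
  rfl

lemma preimageHom_proj {Y' Y : Sm k} (g : Y' ⟶ Y) (U : Nbhd Y) :
    preimageHom g U ≫ U.proj = (U.preimage g).proj ≫ g := by
  ext : 2
  rw [comp_proj, preimageHom_ι, Category.assoc, A1map_proj]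
  exact (Category.assoc _ _ _).symm

lemma zeroLift_proj {Y : Sm k} (U : Nbhd Y) : U.zeroLift ≫ U.proj = 𝟙 Y := by
  ext : 2
  rw [comp_proj, zeroLift_ι]
  exact AffineSpace.homOfVector_over _ _

lemma oneLift_proj {Y : Sm k} (U : Nbhd Y) : U.oneLift ≫ U.proj = 𝟙 Y := by
  ext : 2
  rw [comp_proj, oneLift_ι]
  exact AffineSpace.homOfVector_over _ _

/-- The coordinate function of `Y × 𝔸¹` on a neighbourhood. -/
def time {Y : Sm k} (U : Nbhd Y) : Γ(U.toSm.obj.left, ⊤) :=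
  U.ι.appTop (AffineSpace.coord _ PUnit.unit)

lemma appTop_time {Y T : Sm k} {U : Nbhd Y} (a : T ⟶ U.toSm) :
    a.hom.left.appTop U.time =
      (a.hom.left ≫ U.ι).appTop (AffineSpace.coord _ PUnit.unit) := by
  rw [Scheme.Hom.comp_appTop]
  rfl

lemma incl_time {Y : Sm k} {U V : Nbhd Y} (h : V ≤ U) :
    (incl h).hom.left.appTop U.time = V.time := by
  rw [appTop_time, incl_ι]
  rfl

lemma preimageHom_time {Y' Y : Sm k} (g : Y' ⟶ Y) (U : Nbhd Y) :
    (preimageHom g U).hom.left.appTop U.time = (U.preimage g).time := by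
  rw [appTop_time, preimageHom_ι, Scheme.Hom.comp_appTop, CommRingCat.comp_apply]
  exact congrArg (U.preimage g).ι.appTop (AffineSpace.map_appTop_coord _ _)

lemma zeroLift_time {Y : Sm k} (U : Nbhd Y) : U.zeroLift.hom.left.appTop U.time = 0 := by
  rw [appTop_time, zeroLift_ι]
  exact AffineSpace.homOfVector_appTop_coord _ _ _

lemma oneLift_time {Y : Sm k} (U : Nbhd Y) : U.oneLift.hom.left.appTop U.time = 1 := by
  rw [appTop_time, oneLift_ι]
  exact AffineSpace.homOfVector_appTop_coord _ _ _

end Nbhd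

end Sm

open Sm

namespace DiagramFunction

/-- The pullbacks of a function on `Y` to the schemes over `Y`. -/
def ofSection {Y : Sm k} (s : Γ(Y.obj.left, ⊤)) : DiagramFunction (FlfSpan.base Y) where
  val T := T.hom.hom.left.appTop s
  map_val {T T'} f := by
    have h : f.left ≫ T'.hom = T.hom := Over.w f
    have h' := appTop_comp_eq (k := k) (a := f.left.hom) (b := T'.hom.hom) (c := 𝟙 _)
      (d := T.hom.hom) ((congrArg (fun r => r.hom) h).trans (Category.id_comp _).symm) s
    exact h'.trans (by simp)

lemma isRestriction_ofSection {Y' Y : Sm k} (g : Y' ⟶ Y) {s : Γ(Y.obj.left, ⊤)}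
    {s' : Γ(Y'.obj.left, ⊤)} (h : g.hom.left.appTop s = s') :
    (ofSection s).IsRestriction (ofSection s') (Over.map g) (FlfSpan.map_base g) := fun T => by
  subst h
  -- `Over.map` does not change the underlying scheme of `T`, so the transport in `IsRestriction` is
  -- definitionally an identity.
  change T.hom.hom.left.appTop (g.hom.left.appTop s) =
    (𝟙 T.left.obj : T.left.obj ⟶ _).left.appTop ((T.hom.hom ≫ g.hom).left.appTop s)
  rw [Over.comp_left, Scheme.Hom.comp_appTop]
  simp

lemma ofSection_zero {Y : Sm k} : ofSection (0 : Γ(Y.obj.left, ⊤)) = 0 :=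
  DiagramFunction.ext (funext fun _ => map_zero _)

lemma ofSection_one {Y : Sm k} : ofSection (1 : Γ(Y.obj.left, ⊤)) = 1 :=
  DiagramFunction.ext (funext fun _ => map_one _)

end DiagramFunction

namespace FlfSpan

open DiagramFunction

/-- As `Z_T = Z_W ×_W T`, a point of `T` over the image of the zero locus of `s` lifts to a point of
`Z_T` at which the pullback of `s` vanishes. A condition on functions on `Z_T` thus becomes a
condition on the image of `T` in `W`. -/
lemma isUnit_appTop_iff {D : Type (u + 1)} [Category.{u} D] {j : D ⥤ Over (SpecK k)} {ι : Type}
    {P : ι → PtdSch k} (α : FlfSpan j P) {T W : D} (g : T ⟶ W)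
    (s : Γ((α.Z.obj W).left, ⊤)) :
    IsUnit ((α.Z.map g).left.appTop s) ↔
      ∀ x, (j.map g).left x ∉
        (α.p.app W).left '' ((α.Z.obj W).left.basicOpen s : Set (α.Z.obj W).left)ᶜ := by
  have hp : (α.Z.map g).left ≫ (α.p.app W).left = (α.p.app T).left ≫ (j.map g).left :=
    congrArg (fun r => Over.Hom.left r) (α.p.naturality g)
  constructor
  · rintro h x ⟨z, hz, hx⟩
    have hpb : IsPullback (α.Z.map g).left (α.p.app T).left (α.p.app W).left (j.map g).left :=
      (α.equifibered g).map (Over.forget (SpecK k))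
    obtain ⟨y, hy, -⟩ := Scheme.Pullback.exists_preimage_pullback (f := (α.p.app W).left)
      (g := (j.map g).left) z x hx
    apply hz
    have e : (α.Z.map g).left (hpb.isoPullback.inv y) = z := by
      rw [← Scheme.Hom.comp_apply, hpb.isoPullback_inv_fst, hy]
    rw [← e]
    refine (mem_basicOpen_appTop _ _ _).1 ?_
    rw [Scheme.basicOpen_of_isUnit _ h]
    trivial
  · intro h
    refine isUnit_of_mem_basicOpen _ fun z => (mem_basicOpen_appTop _ _ _).2 ?_
    by_contra hz
    refine h ((α.p.app T).left z) ⟨_, hz, ?_⟩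
    rw [← Scheme.Hom.comp_apply, hp, Scheme.Hom.comp_apply]

variable {n : ℕ} {A : Pointed.{0}} {m : SimplexCategory}

/-- The deformation along the coordinate of `U` is defined on a span. -/
def IsDeformableOn {Y : Sm k} (U : Nbhd Y) (α : FlfSpan (base Y) (smashObj k n A m)) : Prop :=
  ((pre (Over.map U.proj) (map_base U.proj)).obj α).IsDeformable (ofSection U.time)

lemma isDeformableOn_iff {Y : Sm k} {U : Nbhd Y} {α : FlfSpan (base Y) (smashObj k n A m)} :
    α.IsDeformableOn U ↔ ∀ i (T : Over U.toSm),
      IsUnit (deformCoord (α.legGm i ((Over.map U.proj).obj T))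
        ((α.p.app ((Over.map U.proj).obj T)).left.appTop (T.hom.hom.left.appTop U.time))) :=
  Iff.rfl

lemma IsDeformableOn.anti {Y : Sm k} {U V : Nbhd Y} (hV : V ≤ U)
    {α : FlfSpan (base Y) (smashObj k n A m)} (h : α.IsDeformableOn U) : α.IsDeformableOn V := by
  have := h.pre (Over.map (Nbhd.incl hV)) (map_base _)
    (isRestriction_ofSection (Nbhd.incl hV) (Nbhd.incl_time hV))
  have e := pre_comp (P := smashObj k n A m) (Over.map U.proj) (Over.map (Nbhd.incl hV))
    (Over.map V.proj) (by rw [← Nbhd.incl_proj hV]; exact Over.mapComp_eq _ _)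
    (map_base _) (map_base _) (map_base _)
  unfold IsDeformableOn
  rw [e]
  exact this

/-- Over all of `Y × 𝔸¹`, the locus where some `(1 - t) x_i + t` is not invertible is closed in `Z ×
𝔸¹`, and its image under the finite map to `Y × 𝔸¹` is closed. The complement contains `Y × {0, 1}`,
because the functions are the units `x_i` at `t = 0` and `1` at `t = 1`. -/
lemma exists_isDeformableOn {Y : Sm k} (α : FlfSpan (base Y) (smashObj k n A m)) :
    ∃ U : Nbhd Y, α.IsDeformableOn U := by
  let V := Nbhd.top Y
  let W : Over Y := Over.mk V.proj
  let s (i : Fin n) : Γ((α.Z.obj W).left, ⊤) :=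
    deformCoord (α.legGm i W) ((α.p.app W).left.appTop V.time)
  let c (i : Fin n) : Set V.toSm.obj.left :=
    (α.p.app W).left '' ((α.Z.obj W).left.basicOpen (s i) : Set (α.Z.obj W).left)ᶜ
  have hc (i : Fin n) : IsClosed (c i) := by
    have := α.isFinite W
    exact (α.p.app W).left.isClosedMap _ ((α.Z.obj W).left.basicOpen (s i)).isOpen.isClosed_compl
  -- The bad loci are closed in the scheme `V`, while `U` has to be open in `Y.A1`. As `V` is
  -- everything, its inclusion is also a closed embedding.
  have hV : Topology.IsClosedEmbedding V.ι :=
    ⟨V.ι.isOpenEmbedding.isEmbedding, by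
      have : Set.range V.ι = Set.univ := Set.eq_univ_of_forall fun x => ⟨⟨x, trivial⟩, rfl⟩
      rw [this]
      exact isClosed_univ⟩
  have hs {T : Over Y} (g : T ⟶ W) (i : Fin n) :
      (α.Z.map g).left.appTop (s i) = deformCoord (α.legGm i T)
        ((α.p.app T).left.appTop (g.left.hom.left.appTop V.time)) := by
    rw [← deformCoord_comp, map_legGm]
    congr 1
    exact appTop_comp_eq (α.p.naturality g) V.time
  let C : Set Y.A1 := ⋃ i, V.ι '' c i
  have hC : IsClosed C := isClosed_iUnion_of_finite fun i => hV.isClosedMap _ (hc i)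
  have hmem {T : Over Y} (g : T ⟶ W)
      (h : ∀ i, IsUnit (deformCoord (α.legGm i T)
        ((α.p.app T).left.appTop (g.left.hom.left.appTop V.time)))) (x : T.left.obj.left) :
      V.ι (g.left.hom.left x) ∉ C := by
    intro hx
    obtain ⟨i, y, hy, hyx⟩ := Set.mem_iUnion.1 hx
    have h' := (α.isUnit_appTop_iff g (s i)).1 (by rw [hs]; exact h i) x
    exact h' (hV.injective hyx ▸ hy)
  -- A section along which the deformed functions are units misses `C`. Applied to the sections `0`
  -- and `1`, this gives the two membership conditions for `U`.
  have hsec (t : Y ⟶ V.toSm) (ht : t ≫ V.proj = 𝟙 Y)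
      (h : ∀ i, IsUnit (deformCoord (α.legGm i (Over.mk (𝟙 Y)))
        ((α.p.app (Over.mk (𝟙 Y))).left.appTop (t.hom.left.appTop V.time)))) (y) :
      (t.hom.left ≫ V.ι) y ∉ C := by
    rw [Scheme.Hom.comp_apply]
    exact hmem (T := Over.mk (𝟙 Y)) (Over.homMk t ht) h y
  let U : Nbhd Y :=
    { U := ⟨Cᶜ, hC.isOpen_compl⟩
      zero_mem y := by
        rw [← V.zeroLift_ι]
        refine hsec V.zeroLift V.zeroLift_proj (fun i => ?_) y
        have e : (α.p.app (Over.mk (𝟙 Y))).left.appTop (V.zeroLift.hom.left.appTop V.time) = 0 :=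
          (congrArg _ V.zeroLift_time).trans (map_zero _)
        exact ((congrArg (deformCoord _) e).trans (deformCoord_zero _)).symm ▸ isUnit_gmCoord _
      one_mem y := by
        rw [← V.oneLift_ι]
        refine hsec V.oneLift V.oneLift_proj (fun i => ?_) y
        have e : (α.p.app (Over.mk (𝟙 Y))).left.appTop (V.oneLift.hom.left.appTop V.time) = 1 :=
          (congrArg _ V.oneLift_time).trans (map_one _)
        exact ((congrArg (deformCoord _) e).trans (deformCoord_one _)).symm ▸ isUnit_one }
  have hU : U ≤ V := fun _ _ => trivial
  refine ⟨U, isDeformableOn_iff.2 fun i T => ?_⟩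
  let g : (Over.map U.proj).obj T ⟶ W := Over.homMk (T.hom ≫ Nbhd.incl hU) (by
    change (T.hom ≫ Nbhd.incl hU) ≫ V.proj = T.hom ≫ U.proj
    rw [Category.assoc, Nbhd.incl_proj])
  -- Points of `U` avoid `C`, so the criterion `isUnit_appTop_iff` gives invertibility over every `T
  -- ⟶ U`.
  have key := (α.isUnit_appTop_iff g (s i)).2 fun x hx => by
    have h₁ : V.ι (g.left.hom.left x) = U.ι (T.hom.hom.left x) := by
      have : g.left.hom.left ≫ V.ι = T.hom.hom.left ≫ U.ι :=
        Nbhd.comp_ι _ _ _ (Nbhd.incl_ι hU)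
      refine (Scheme.Hom.comp_apply _ _ _).symm.trans (Eq.trans ?_ (Scheme.Hom.comp_apply _ _ _))
      exact congrArg (fun r : T.left.obj.left ⟶ Y.A1 => r x) this
    exact U.ι_mem (T.hom.hom.left x) (Set.mem_iUnion.2 ⟨i, _, hx, h₁⟩)
  rw [hs] at key
  have h₂ : g.left.hom.left.appTop V.time = T.hom.hom.left.appTop U.time := by
    rw [← Nbhd.incl_time hU, ← CommRingCat.comp_apply, ← Scheme.Hom.comp_appTop]
    rfl
  rw [h₂] at key
  exact key

lemma exists_isDeformableOn_of_finite {Y : Sm k} {C : Type*} [Finite C]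
    (x : C → FlfSpan (base Y) (smashObj k n A m)) : ∃ U : Nbhd Y, ∀ c, (x c).IsDeformableOn U := by
  choose U hU using fun c => exists_isDeformableOn (x c)
  have key (s : Set C) (hs : s.Finite) : ∃ V : Nbhd Y, ∀ c ∈ s, V ≤ U c := by
    induction s, hs using Set.Finite.induction_on with
    | empty => exact ⟨Nbhd.top Y, by simp⟩
    | @insert a s _ _ ih =>
      obtain ⟨V, hV⟩ := ih
      refine ⟨V.inter (U a), ?_⟩
      rintro c (rfl | hc)
      · exact Nbhd.inter_le_right _ _
      · exact (Nbhd.inter_le_left _ _).trans (hV c hc)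
  obtain ⟨V, hV⟩ := key _ Set.finite_univ
  exact ⟨V, fun c => (hU c).anti (hV c trivial)⟩

end FlfSpan

end FlfCor

/-! ### Simplices of the bar construction and homotopies of its self-maps -/

namespace FlfCor

open Sm FlfSpan

variable {k : Type u} [Field k]

variable (k) in
/-- The presheaf of pointed spaces `B h^flf(𝔾_m^{∧ n})`. -/
def bar (n : ℕ) : (Sm k)ᵒᵖ ⥤ PSSet.{u + 1} := diagPresheaf.obj (circle ⋙ hflf (GmSmash k n))

variable (k) in
/-- The pointed schemes in the smash product `S¹ ∧ 𝔾_m^{∧ n}` in simplicial degree `m`. -/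
abbrev barTarget (n : ℕ) (m : SimplexCategory) : Option (Fin n) → PtdSch k :=
  smashObj k n (circle.obj (op m)) m

/-- The `m`-simplices of `B h^flf(𝔾_m^{∧ n})(Y)`. -/
abbrev Chain (n : ℕ) (Y : Sm k) (m : SimplexCategory) :=
  Fin (m.len + 1) ⥤ FlfSpan (base Y) (barTarget k n m)

namespace Chain

variable {n : ℕ} {Y Y' : Sm k} {m m' : SimplexCategory}

/-- The simplicial structure maps of `S¹ ∧ 𝔾_m^{∧ n}`. -/
def structureHom (φ : m' ⟶ m) : barTarget k n m ⟶ barTarget k n m' :=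
  ((smashWith (GmSmash k n)).map (circle.map φ.op)).app (op m) ≫
    ((smashWith (GmSmash k n)).obj (circle.obj (op m'))).map φ.op

/-- The circle only affects the factor `none`; on the whiskered factors its structure map is the
identity. -/
lemma isStructureMap_structureHom (φ : m' ⟶ m) :
    IsStructureMap (k := k) (n := n) (structureHom φ) φ := fun _ =>
  (congrArg (· ≫ whiskerMap k φ) (whiskerMap_id k m)).trans (Category.id_comp _)

lemma contractHom_structureHom (φ : m' ⟶ m) (τ : m ⟶ ⦋1⦌) :
    contractHom n _ τ ≫ structureHom (k := k) φ = structureHom φ ≫ contractHom n _ (φ ≫ τ) := by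
  funext i
  match i with
  | none =>
    exact (Category.id_comp (structureHom (k := k) φ none)).trans
      (Category.comp_id (structureHom (k := k) φ none)).symm
  | some i =>
    apply PtdSch.hom_ext
    change whiskerContract τ ≫ (structureHom (k := k) φ (some i)).hom =
      (structureHom (k := k) φ (some i)).hom ≫ whiskerContract (φ ≫ τ)
    rw [isStructureMap_structureHom φ i]
    exact whiskerContract_map φ τ

/-- The simplicial structure maps of `B h^flf(𝔾_m^{∧ n})(Y)`. -/
def face (φ : m' ⟶ m) (x : Chain n Y m) : Chain n Y m' :=
  ((SimplexCategory.toCat.map φ).toFunctor ⋙ x) ⋙ push (structureHom φ)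

/-- The base change of simplices. -/
def pullback (g : Y' ⟶ Y) (x : Chain n Y m) : Chain n Y' m := x ⋙ pre (Over.map g) (map_base g)

/-- The base point. -/
def basept (n : ℕ) (Y : Sm k) (m : SimplexCategory) : Chain n Y m :=
  (Functor.const _).obj (FlfSpan.zero _ _)

/-- The diagonal applies the structure maps of the circle and of `𝔾_m^{∧ n}` one after the other;
`push_comp` merges the two compositions. -/
lemma bar_map (φ : m' ⟶ m) (x : Chain n Y m) :
    (((bar k n).obj (op Y)).map φ.op).toFun x = x.face φ := by
  refine Eq.trans ?_ (congrArg (((SimplexCategory.toCat.map φ).toFunctor ⋙ x) ⋙ ·)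
    (push_comp _ _).symm)
  rfl

lemma pullback_face (φ : m' ⟶ m) (g : Y' ⟶ Y) (x : Chain n Y m) :
    (x.pullback g).face φ = (x.face φ).pullback g :=
  congrArg (((SimplexCategory.toCat.map φ).toFunctor ⋙ x) ⋙ ·)
    (pre_push (Over.map g) (map_base g) (structureHom φ))

lemma pullback_id (x : Chain n Y m) : x.pullback (𝟙 Y) = x :=
  congrArg (x ⋙ ·) (pre_id (j := base Y) (Over.map (𝟙 Y)) (Over.mapId_eq Y) (map_base (𝟙 Y)))

lemma pullback_comp {Y'' : Sm k} (g : Y' ⟶ Y) (g' : Y'' ⟶ Y') (x : Chain n Y m) :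
    x.pullback (g' ≫ g) = (x.pullback g).pullback g' :=
  congrArg (x ⋙ ·) (pre_comp (Over.map g) (Over.map g') (Over.map (g' ≫ g)) (Over.mapComp_eq _ _)
    (map_base g) (map_base g') (map_base (g' ≫ g)))

lemma const_comp {C : Type*} [Category* C] {E E' : Type*} [Category* E] [Category* E'] (e : E)
    (F : E ⥤ E') : (Functor.const C).obj e ⋙ F = (Functor.const C).obj (F.obj e) :=
  CategoryTheory.Functor.ext (fun _ => rfl) fun _ _ _ => by simp

lemma pullback_basept (g : Y' ⟶ Y) : (basept n Y m).pullback g = basept n Y' m :=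
  (const_comp _ _).trans (congrArg (Functor.const _).obj (pre_zero _ _))

lemma basept_push (f : barTarget k n m ⟶ barTarget k n m) :
    basept n Y m ⋙ push f = basept n Y m :=
  (const_comp _ _).trans (congrArg (Functor.const _).obj (push_zero _))

lemma basept_face (φ : m' ⟶ m) : (basept n Y m).face φ = basept n Y m' :=
  (const_comp _ _).trans (congrArg (Functor.const _).obj (push_zero _))

/-- The contraction of the whiskers. -/
def contract (τ : m ⟶ ⦋1⦌) (x : Chain n Y m) : Chain n Y m := x ⋙ push (contractHom n _ τ)

lemma contract_face (φ : m' ⟶ m) (τ : m ⟶ ⦋1⦌) (x : Chain n Y m) :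
    (x.contract τ).face φ = (x.face φ).contract (φ ≫ τ) := by
  have h := congrArg (push (j := base Y)) (contractHom_structureHom (k := k) (n := n) φ τ)
  rw [push_comp, push_comp] at h
  exact congrArg (((SimplexCategory.toCat.map φ).toFunctor ⋙ x) ⋙ ·) h

lemma contract_pullback (g : Y' ⟶ Y) (τ : m ⟶ ⦋1⦌) (x : Chain n Y m) :
    (x.contract τ).pullback g = (x.pullback g).contract τ :=
  congrArg (x ⋙ ·) (pre_push (Over.map g) (map_base g) _).symm

lemma contract_basept (τ : m ⟶ ⦋1⦌) : (basept n Y m).contract τ = basept n Y m :=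
  basept_push _

/-- A simplex whose vertices are spans with empty support. -/
def IsNull (x : Chain n Y m) : Prop := ∀ c, (x.obj c).IsNull

/-- The homotopy that replaces empty spans by the base point. -/
def collapse (τ : m ⟶ ⦋1⦌) (x : Chain n Y m) (hx : x.IsNull) : Chain n Y m :=
  -- Vertices at time `0` keep their span and vertices at time `1` get the zero span. The edges are
  -- the unique morphisms between spans with empty support.
  ofNull (fun c => if τ.toOrderHom c = 0 then x.obj c else FlfSpan.zero _ _) fun c => by
    dsimp only
    split
    · exact hx c
    · exact isNull_zero

lemma IsNull.face {x : Chain n Y m} (hx : x.IsNull) (φ : m' ⟶ m) : (x.face φ).IsNull :=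
  fun c => (hx _).push _

lemma IsNull.pullback {x : Chain n Y m} (hx : x.IsNull) (g : Y' ⟶ Y) : (x.pullback g).IsNull :=
  fun c => FlfSpan.IsNull.pre (hx c) (Over.map g) (map_base g)

lemma collapse_isNull (τ : m ⟶ ⦋1⦌) (x : Chain n Y m) (hx : x.IsNull) : (x.collapse τ hx).IsNull :=
  fun c => by
    change (ite _ _ _ : FlfSpan _ _).IsNull
    split
    · exact hx c
    · exact isNull_zero

lemma collapse_obj_of_eq {τ : m ⟶ ⦋1⦌} (x : Chain n Y m) (hx : x.IsNull) {c : Fin (m.len + 1)}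
    (h : τ.toOrderHom c = 0) : (x.collapse τ hx).obj c = x.obj c := if_pos h

lemma collapse_obj_of_ne {τ : m ⟶ ⦋1⦌} (x : Chain n Y m) (hx : x.IsNull) {c : Fin (m.len + 1)}
    (h : τ.toOrderHom c ≠ 0) : (x.collapse τ hx).obj c = FlfSpan.zero _ _ := if_neg h

lemma collapse_congr {τ : m ⟶ ⦋1⦌} {x y : Chain n Y m} (e : x = y) (hx : x.IsNull)
    (hy : y.IsNull) : x.collapse τ hx = y.collapse τ hy := by
  subst e
  rfl

lemma collapse_face (φ : m' ⟶ m) (τ : m ⟶ ⦋1⦌) (x : Chain n Y m) (hx : x.IsNull) :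
    (x.collapse τ hx).face φ = (x.face φ).collapse (φ ≫ τ) (hx.face φ) := by
  refine functor_ext_of_null ((collapse_isNull τ x hx).face φ) fun c => ?_
  by_cases h : τ.toOrderHom (φ.toOrderHom c) = 0
  · exact (congrArg (push (structureHom φ)).obj (collapse_obj_of_eq x hx h)).trans
      (collapse_obj_of_eq (τ := φ ≫ τ) (x.face φ) (hx.face φ) h).symm
  · exact (congrArg (push (structureHom φ)).obj (collapse_obj_of_ne x hx h)).trans
      ((push_zero _).trans (collapse_obj_of_ne (τ := φ ≫ τ) (x.face φ) (hx.face φ) h).symm)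

lemma collapse_pullback (g : Y' ⟶ Y) (τ : m ⟶ ⦋1⦌) (x : Chain n Y m) (hx : x.IsNull) :
    (x.collapse τ hx).pullback g = (x.pullback g).collapse τ (hx.pullback g) := by
  refine functor_ext_of_null ((collapse_isNull τ x hx).pullback g) fun c => ?_
  by_cases h : τ.toOrderHom c = 0
  · exact (congrArg (pre (Over.map g) (map_base g)).obj (collapse_obj_of_eq x hx h)).trans
      (collapse_obj_of_eq (x.pullback g) (hx.pullback g) h).symm
  · exact (congrArg (pre (Over.map g) (map_base g)).obj (collapse_obj_of_ne x hx h)).trans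
      ((pre_zero _ _).trans (collapse_obj_of_ne (x.pullback g) (hx.pullback g) h).symm)

lemma collapse_zero (x : Chain n Y m) (hx : x.IsNull) :
    x.collapse (SimplexCategory.const m ⦋1⦌ 0) hx = x :=
  functor_ext_of_null (collapse_isNull _ x hx) fun c => collapse_obj_of_eq x hx rfl

lemma collapse_one (x : Chain n Y m) (hx : x.IsNull) :
    x.collapse (SimplexCategory.const m ⦋1⦌ 1) hx = basept n Y m :=
  functor_ext_of_null (collapse_isNull _ x hx) fun c =>
    collapse_obj_of_ne x hx (one_ne_zero (α := Fin 2))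

lemma collapse_basept (τ : m ⟶ ⦋1⦌) (h : (basept n Y m).IsNull) :
    (basept n Y m).collapse τ h = basept n Y m :=
  functor_ext_of_null (collapse_isNull _ _ h) fun c => ite_self _

lemma isNull_contract (hn : 0 < n) (x : Chain n Y m) :
    (x.contract (SimplexCategory.const m ⦋1⦌ 1)).IsNull :=
  fun c => isNull_push_contract hn (x.obj c)

end Chain

/-- A self-map of `B h^flf(𝔾_m^{∧ n})` given by natural operations on simplices. -/
def barEnd {n : ℕ} (F : ∀ (Y : Sm k) (m : SimplexCategory), Chain n Y m → Chain n Y m)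
    (hF : ∀ Y m m' (φ : m' ⟶ m) x, (F Y m x).face φ = F Y m' (x.face φ))
    (hF' : ∀ Y Y' (g : Y' ⟶ Y) m x, (F Y m x).pullback g = F Y' m (x.pullback g))
    (hF₀ : ∀ Y m, F Y m (Chain.basept n Y m) = Chain.basept n Y m) : bar k n ⟶ bar k n where
  app Y :=
    { app m := ⟨F Y.unop m.unop, hF₀ _ _⟩
      naturality m m' φ := Pointed.Hom.ext (funext fun x => 
        (congrArg (F Y.unop m'.unop) (Chain.bar_map φ.unop x)).trans
          ((hF _ _ _ φ.unop x).symm.trans (Chain.bar_map φ.unop _).symm)) }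
  naturality Y Y' g := by
    apply NatTrans.ext
    funext m
    exact Pointed.Hom.ext (funext fun x => (hF' _ _ g.unop m.unop x).symm)

/-- A homotopy of self-maps of `B h^flf(𝔾_m^{∧ n})` given by natural operations on simplices. -/
def barHomotopy {n : ℕ}
    (H : ∀ (Y : Sm k) (m : SimplexCategory), (m ⟶ ⦋1⦌) → Chain n Y m → Chain n Y m)
    (hH : ∀ Y m m' (φ : m' ⟶ m) τ x, (H Y m τ x).face φ = H Y m' (φ ≫ τ) (x.face φ))
    (hH' : ∀ Y Y' (g : Y' ⟶ Y) m τ x, (H Y m τ x).pullback g = H Y' m τ (x.pullback g))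
    (hH₀ : ∀ Y m τ, H Y m τ (Chain.basept n Y m) = Chain.basept n Y m) {r r' : bar k n ⟶ bar k n}
    (hr : ∀ (Y : Sm k) m (x : Chain n Y m), ((r.app (op Y)).app (op m)).toFun x =
      H Y m (SimplexCategory.const m ⦋1⦌ 0) x)
    (hr' : ∀ (Y : Sm k) m (x : Chain n Y m), ((r'.app (op Y)).app (op m)).toFun x =
      H Y m (SimplexCategory.const m ⦋1⦌ 1) x) : PointedHomotopy r r' where
  h Y :=
    { app m := ↾fun z => H Y.unop m.unop (SSet.stdSimplex.objEquiv z.2) z.1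
      naturality m m' φ := by
        ext z
        exact (congrArg (H Y.unop m'.unop (φ.unop ≫ SSet.stdSimplex.objEquiv z.2))
          (Chain.bar_map φ.unop z.1)).trans
            ((hH _ _ _ φ.unop _ z.1).symm.trans (Chain.bar_map φ.unop _).symm) }
  naturality {Y Y'} g := by
    ext m z
    exact (hH' _ _ g.unop m.unop _ z.1).symm
  isPointed Y m τ := hH₀ _ _ _
  h₀ Y := by
    ext m x
    exact (hr _ _ x).symm
  h₁ Y := by
    ext m x
    exact (hr' _ _ x).symm

/-- The contraction of the whiskers by a constant path. -/
def barContract (n : ℕ) (a : Fin 2) : bar k n ⟶ bar k n :=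
  barEnd (fun _ m => Chain.contract (SimplexCategory.const m ⦋1⦌ a))
    (fun _ _ _ φ x => Chain.contract_face φ _ x) (fun _ _ g _ x => Chain.contract_pullback g _ x)
    fun _ _ => Chain.contract_basept _

/-- The homotopy that contracts the whiskers. -/
def contractHomotopy (n : ℕ) : PointedHomotopy (barContract (k := k) n 0) (barContract n 1) :=
  barHomotopy (fun _ _ τ x => x.contract τ) (fun _ _ _ φ τ x => Chain.contract_face φ τ x)
    (fun _ _ g _ τ x => Chain.contract_pullback g τ x) (fun _ _ τ => Chain.contract_basept τ)
    (fun _ _ _ => rfl) fun _ _ _ => rfl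

/-- The homotopy from the contracted spans, which have empty support, to the base point. -/
def collapseHomotopy {n : ℕ} (hn : 0 < n) :
    PointedHomotopy (barContract (k := k) n 1) (constBasept (bar k n)) :=
  barHomotopy
    (fun _ m τ x => (x.contract (SimplexCategory.const m ⦋1⦌ 1)).collapse τ (x.isNull_contract hn))
    (fun _ _ _ φ τ x => (Chain.collapse_face φ τ _ _).trans
      (Chain.collapse_congr (Chain.contract_face φ _ x) _ _))
    (fun _ _ g _ τ x => (Chain.collapse_pullback g τ _ _).trans
      (Chain.collapse_congr (Chain.contract_pullback g _ x) _ _))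
    (fun Y m τ => (Chain.collapse_congr (Chain.contract_basept _) _
      (Chain.contract_basept (n := n) (Y := Y) (SimplexCategory.const m ⦋1⦌ 1) ▸
        Chain.isNull_contract hn _)).trans
      (Chain.collapse_basept τ _))
    (fun _ _ _ => (Chain.collapse_zero _ _).symm) fun _ _ _ => (Chain.collapse_one _ _).symm

end FlfCor

/-! ### The rational deformation of the bar construction -/

namespace FlfCor

open Sm FlfSpan DiagramFunction

variable {k : Type u} [Field k]

namespace Chain

variable {n : ℕ} {Y Y' : Sm k} {m m' : SimplexCategory}

/-- The deformation along the coordinate of `U` is defined on a simplex. -/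
def IsDeformableOn (U : Nbhd Y) (x : Chain n Y m) : Prop := ∀ c, (x.obj c).IsDeformableOn U

/-- The deformation of a simplex, over a neighbourhood `U`. -/
def deform (U : Nbhd Y) (x : Chain n Y m) (h : x.IsDeformableOn U) : Chain n U.toSm m :=
  FlfSpan.deform (ofSection U.time) (x.pullback U.proj) h

/-- Shrinking `U`, base change in `Y` and evaluation at the two ends are all pullbacks along some
`g` into `U`. In each case it remains to identify the pulled back coordinate `s` and the projected
simplex `y`. -/
lemma deform_pullback {U : Nbhd Y} {x : Chain n Y m} (h : x.IsDeformableOn U) (g : Y' ⟶ U.toSm)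
    {s : Γ(Y'.obj.left, ⊤)} (hs : g.hom.left.appTop U.time = s) {y : Chain n Y' m}
    (hy : x.pullback (g ≫ U.proj) = y) (hy' : ∀ c, (y.obj c).IsDeformable (ofSection s)) :
    (x.deform U h).pullback g = FlfSpan.deform (ofSection s) y hy' := by
  subst hy
  have e : x.pullback (g ≫ U.proj) = x.pullback U.proj ⋙ pre (Over.map g) (map_base g) :=
    pullback_comp _ _ x
  have h₁ (c) : ((x.pullback U.proj ⋙ pre (Over.map g) (map_base g)).obj c).IsDeformable
      (ofSection s) := e ▸ hy' c
  exact ((deform_congr e hy' h₁).trans (deform_pre (ofSection U.time) (x.pullback U.proj) h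
    (Over.map g) (map_base g) (isRestriction_ofSection g hs) h₁)).symm

lemma IsDeformableOn.pullback_isDeformable {U : Nbhd Y} {x : Chain n Y m}
    (h : x.IsDeformableOn U) (g : Y' ⟶ U.toSm)
    {s : Γ(Y'.obj.left, ⊤)} (hs : g.hom.left.appTop U.time = s) {y : Chain n Y' m}
    (hy : x.pullback (g ≫ U.proj) = y) (c) : (y.obj c).IsDeformable (ofSection s) := by
  subst hy
  rw [pullback_comp]
  exact (h c).pre (Over.map g) (map_base g) (isRestriction_ofSection g hs)

lemma IsDeformableOn.anti {U V : Nbhd Y} {x : Chain n Y m} (h : x.IsDeformableOn U) (hV : V ≤ U) :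
    x.IsDeformableOn V := fun c => (h c).anti hV

lemma IsDeformableOn.pullback {U : Nbhd Y} {x : Chain n Y m} (h : x.IsDeformableOn U)
    (g : Y' ⟶ Y) : (x.pullback g).IsDeformableOn (U.preimage g) := by
  have hy : x.pullback (U.preimageHom g ≫ U.proj) =
      (x.pullback g).pullback (U.preimage g).proj := by
    rw [Nbhd.preimageHom_proj, pullback_comp]
  intro c
  exact h.pullback_isDeformable (U.preimageHom g) (Nbhd.preimageHom_time g U) hy c

lemma IsDeformableOn.face {U : Nbhd Y} {x : Chain n Y m} (h : x.IsDeformableOn U)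
    (φ : m' ⟶ m) : (x.face φ).IsDeformableOn U := fun c => by
  have h₁ : (((x.pullback U.proj).face φ).obj c).IsDeformable (ofSection U.time) :=
    IsDeformable.push (h ((SimplexCategory.toCat.map φ).toFunctor.obj c))
      (isStructureMap_structureHom (k := k) (n := n) φ)
  have h₂ : (((x.face φ).pullback U.proj).obj c).IsDeformable (ofSection U.time) := by
    rw [← pullback_face]
    exact h₁
  exact h₂

/-- A structure map reindexes the vertices and then composes with pointed maps; the deformation
commutes with the former by `comp_deform` and with the latter by `deform_push`. -/
lemma deform_face {U : Nbhd Y} {x : Chain n Y m} (h : x.IsDeformableOn U) (φ : m' ⟶ m) :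
    (x.deform U h).face φ = (x.face φ).deform U (h.face φ) := by
  have e : ((SimplexCategory.toCat.map φ).toFunctor ⋙ x.pullback U.proj) ⋙
      push (structureHom φ) = (x.face φ).pullback U.proj := pullback_face φ U.proj x
  have h₀ (c) : (((SimplexCategory.toCat.map φ).toFunctor ⋙ x.pullback U.proj).obj c).IsDeformable
      (ofSection U.time) := h ((SimplexCategory.toCat.map φ).toFunctor.obj c)
  have h₁ (c) : ((((SimplexCategory.toCat.map φ).toFunctor ⋙ x.pullback U.proj) ⋙
      push (structureHom φ)).obj c).IsDeformable (ofSection U.time) :=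
    IsDeformable.push (h₀ c) (isStructureMap_structureHom φ)
  have e₁ := deform_congr e h₁ (h.face φ)
  have e₂ := deform_push (ofSection U.time) _ h₀ (isStructureMap_structureHom φ) h₁
  have e₃ : (SimplexCategory.toCat.map φ).toFunctor ⋙ x.deform U h =
      FlfSpan.deform (ofSection U.time) _ h₀ := comp_deform _ _ (x.pullback U.proj) h
  exact (congrArg (· ⋙ push (structureHom φ)) e₃).trans (e₂.symm.trans e₁)

lemma deform_incl {U V : Nbhd Y} {x : Chain n Y m} (h : x.IsDeformableOn U) (hV : V ≤ U) :
    (x.deform U h).pullback (Nbhd.incl hV) = x.deform V (h.anti hV) := by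
  have hy : x.pullback (Nbhd.incl hV ≫ U.proj) = x.pullback V.proj := by rw [Nbhd.incl_proj]
  exact deform_pullback h (Nbhd.incl hV) (Nbhd.incl_time hV) hy (h.anti hV)

lemma deform_preimageHom {U : Nbhd Y} {x : Chain n Y m} (h : x.IsDeformableOn U) (g : Y' ⟶ Y) :
    (x.deform U h).pullback (U.preimageHom g) =
      (x.pullback g).deform (U.preimage g) (h.pullback g) := by
  have hy : x.pullback (U.preimageHom g ≫ U.proj) =
      (x.pullback g).pullback (U.preimage g).proj := by
    rw [Nbhd.preimageHom_proj, pullback_comp]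
  exact deform_pullback h (U.preimageHom g) (Nbhd.preimageHom_time g U) hy (h.pullback g)

lemma deform_zeroLift {U : Nbhd Y} {x : Chain n Y m} (h : x.IsDeformableOn U) :
    (x.deform U h).pullback U.zeroLift = x := by
  have hy : x.pullback (U.zeroLift ≫ U.proj) = x := by rw [Nbhd.zeroLift_proj, pullback_id]
  have h' := h.pullback_isDeformable U.zeroLift U.zeroLift_time hy
  refine (deform_pullback h U.zeroLift U.zeroLift_time hy h').trans ?_
  -- The proof `h'` depends on the function at time `0`, so it is generalized before that function
  -- is rewritten.
  revert h'
  rw [ofSection_zero]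
  exact fun h' => deform_zero _ _

lemma deform_oneLift {U : Nbhd Y} {x : Chain n Y m} (h : x.IsDeformableOn U) :
    (x.deform U h).pullback U.oneLift = x.contract (SimplexCategory.const m ⦋1⦌ 0) := by
  have hy : x.pullback (U.oneLift ≫ U.proj) = x := by rw [Nbhd.oneLift_proj, pullback_id]
  have h' := h.pullback_isDeformable U.oneLift U.oneLift_time hy
  refine (deform_pullback h U.oneLift U.oneLift_time hy h').trans ?_
  revert h'
  rw [ofSection_one]
  exact fun h' => deform_one _ _

lemma isDeformableOn_basept (U : Nbhd Y) : (basept n Y m).IsDeformableOn U := fun c => by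
  have h : (((basept n Y m).pullback U.proj).obj c).IsDeformable (ofSection U.time) := by
    rw [pullback_basept]
    exact isDeformable_zero _
  exact h

lemma deform_basept (U : Nbhd Y) :
    (basept n Y m).deform U (isDeformableOn_basept U) = basept n U.toSm m :=
  (deform_congr (pullback_basept U.proj) _ fun c => isDeformable_zero _).trans
    (deform_const_zero _ _)

/-- Only the vertices of a simplex impose a condition, and there are finitely many of them. -/
lemma exists_isDeformableOn (x : Chain n Y m) : ∃ U : Nbhd Y, x.IsDeformableOn U :=
  exists_isDeformableOn_of_finite x.obj

end Chain

/-- The subspace of `B h^flf(𝔾_m^{∧ n})(Y)` on which the deformation over `U` is defined. -/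
def barOn (n : ℕ) {Y : Sm k} (U : Nbhd Y) : PSSet.{u + 1} where
  obj m := ⟨{ x : Chain n Y m.unop // x.IsDeformableOn U },
    ⟨Chain.basept n Y m.unop, Chain.isDeformableOn_basept U⟩⟩
  map φ := ⟨fun x => ⟨x.1.face φ.unop, x.2.face φ.unop⟩, Subtype.ext (Chain.basept_face φ.unop)⟩
  map_id m := Pointed.Hom.ext (funext fun x => Subtype.ext
    ((Chain.bar_map (𝟙 m.unop) x.1).symm.trans (congrArg
      (fun f : ((bar k n).obj (op Y)).obj m ⟶ ((bar k n).obj (op Y)).obj m => f.toFun x.1)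
      (((bar k n).obj (op Y)).map_id m))))
  map_comp {m m' m''} φ ψ := Pointed.Hom.ext (funext fun x => Subtype.ext (by
    refine (Chain.bar_map (ψ.unop ≫ φ.unop) x.1).symm.trans ((congrArg
      (fun f : ((bar k n).obj (op Y)).obj m ⟶ ((bar k n).obj (op Y)).obj m'' => f.toFun x.1)
      (((bar k n).obj (op Y)).map_comp φ ψ)).trans ?_)
    exact (congrArg (((bar k n).obj (op Y)).map ψ).toFun (Chain.bar_map φ.unop x.1)).trans
      (Chain.bar_map ψ.unop _)))

/-- The inclusion of the subspace on which the deformation is defined. -/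
def barOnι (n : ℕ) {Y : Sm k} (U : Nbhd Y) : barOn n U ⟶ (bar k n).obj (op Y) where
  app m := ⟨fun x => x.1, rfl⟩
  naturality m m' φ := Pointed.Hom.ext (funext fun x => (Chain.bar_map φ.unop x.1).symm)

/-- The deformation of spans along `(1 - t) x + t`. -/
def barDeformation (n : ℕ) : RationalDeformation (bar k n) (barContract n 0) where
  T Y U := barOn n U
  i U := barOnι n U
  mono_i {Y} U := by
    have (m : SimplexCategoryᵒᵖ) : Mono ((PSSet.forget.map (barOnι n U)).app m) :=
      (mono_iff_injective _).2 Subtype.val_injective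
    exact NatTrans.mono_of_mono_app _
  exists_eq Y m x := by
    obtain ⟨U, hU⟩ := Chain.exists_isDeformableOn (n := n) (Y := Y) (m := m.unop) x
    exact ⟨U, ⟨x, hU⟩, rfl⟩
  s U :=
    { app m := ⟨fun x => x.1.deform U x.2, Chain.deform_basept U⟩
      naturality m m' φ := Pointed.Hom.ext (funext fun x =>
        (Chain.deform_face x.2 φ.unop).symm.trans (Chain.bar_map φ.unop _).symm) }
  restr h :=
    { app m := ⟨fun x => ⟨x.1, x.2.anti h⟩, rfl⟩
      naturality m m' φ := rfl }
  restr_i h := rfl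
  restr_s {Y V U} h := by
    apply NatTrans.ext
    funext m
    exact Pointed.Hom.ext (funext fun x => (Chain.deform_incl x.2 h).symm)
  base g U :=
    { app m := ⟨fun x => ⟨x.1.pullback g, x.2.pullback g⟩, Subtype.ext (Chain.pullback_basept g)⟩
      naturality m m' φ := Pointed.Hom.ext (funext fun x =>
        Subtype.ext (Chain.pullback_face φ.unop g x.1).symm) }
  base_i g U := rfl
  base_s {Y' Y} g U := by
    apply NatTrans.ext
    funext m
    exact Pointed.Hom.ext (funext fun x => (Chain.deform_preimageHom x.2 g).symm)
  s_zero {Y} U := by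
    apply NatTrans.ext
    funext m
    exact Pointed.Hom.ext (funext fun x => Chain.deform_zeroLift x.2)
  s_one {Y} U := by
    apply NatTrans.ext
    funext m
    exact Pointed.Hom.ext (funext fun x => Chain.deform_oneLift x.2)

end FlfCor

end

theorem proposition3p9 (k : Type u) [Field k] [PerfectField k] (n : ℕ) (hn : 0 < n) :
    FlfCor.RationallyContractible (FlfCor.gp (FlfCor.hflf (FlfCor.GmSmash k n))) :=
  (FlfCor.barDeformation n).rationallyContractible
    -- The end map of the deformation is slid along the whisker and then collapsed to the base
    -- point; on loops each homotopy becomes an equality after localization.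
    ((FlfCor.contractHomotopy n).map_loopSpace_eq.trans
      (FlfCor.collapseHomotopy hn).map_loopSpace_eq)
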